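/- **Conventions.** An *embedded cycle* of $X$ is the image of a continuous injective map from the unit circle to $X$. An $\mathbb{R}$-*tree* is a geodesic metric space without embedded cycles, and an $\mathbb{R}$-*graph* is a compact geodesic metric space $(X,d)$ such that every $x\in X$ is the center of an open ball $B_\varepsilon(x)$, $\varepsilon>0$, which is an $\mathbb{R}$-tree for the restricted distance. The *core* $\mathrm{core}(X)$ of an $\mathbb{R}$-graph $X$ is the union of all simple arcs of $X$ having both endpoints in embedded cycles. Let $k(X)$ be the set of $x\in\mathrm{core}(X)$ of degree at least $3$ in $\mathrm{core}(X)$, the degree being the number of connected components of $(B_\varepsilon(x)\cap \mathrm{core}(X))\setminus\{x\}$ for all small $\varepsilon>0$. Let $e(X)$ be the set of closures of the connected components of $\mathrm{core}(X)\setminus k(X)$. The *kernel* $\ker(X)$ is the multigraph $(k(X),e(X))$, in which the ends of $e\in e(X)$ are the elements of $e\cap k(X)$. Write $\ell(e)$ for the length (one-dimensional Hausdorff measure) of a simple arc or embedded cycle $e$. The *surplus* is $s(X)=|e(X)|-|k(X)|+1$ if $k(X)\neq\varnothing$; otherwise $s(X)=0$ if $\mathrm{core}(X)=\varnothing$, and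 $s(X)=1$ if not (then $\mathrm{core}(X)$ is a cycle $c$, and $e(X)=\{c\}$). For $r\in(0,1)$, let $\mathcal{A}_r$ be the class of $\mathbb{R}$-graphs $X$ with $$\ell(e)\ge r\ \text{ for all } e\in e(X),\qquad \sum_{e\in e(X)}\ell(e)\le 1/r,\qquad s(X)\le 1/r .$$ A *correspondence* between $(X,d)$ and $(X',d')$ is a measurable set $C\subset X\times X'$ such that every $x\in X$ is the first coordinate, and every $x'\in X'$ the second coordinate, of some element of $C$; its *distortion* is $\mathrm{dis}(C)=\sup\{|d(x,y)-d'(x',y')| : (x,x'),(y,y')\in C\}$. Subsets $A\subset X$, $A'\subset X'$ are *in correspondence via* $C$ if $C\cap(A\times A')$ is a correspondence between $A$ and $A'$. For $\varepsilon>0$, a correspondence $C$ between $\mathbb{R}$-graphs $X$ and $X'$ is an $\varepsilon$-*overlay* if one of the following holds. * $s(X)\ge2$, $s(X')\ge 2$, $\mathrm{dis}(C)<\varepsilon$, and there is a multigraph isomorphism $\chi$ from $\ker(X)$ to $\ker(X')$ such that $(v,\chi(v))\in C$ for every $v\in k(X)$ and, for every $e\in e(X)$, the edges $e$ and $\chi(e)$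 are in correspondence via $C$ and $|\ell(e)-\ell(\chi(e))|\le\varepsilon$. * $s(X)=s(X')=1$, $\mathrm{dis}(C)\le\varepsilon$, the unique embedded cycles $c$ of $X$ and $c'$ of $X'$ are in correspondence via $C$, and $|\ell(c)-\ell(c')|\le\varepsilon$. * $s(X)=s(X')=0$ and $\mathrm{dis}(C)\le\varepsilon$. **Proposition.** Fix $r\in(0,1)$. For every $\varepsilon>0$ there exists $\delta>0$ such that, for all $X,X'\in\mathcal{A}_r$ and every correspondence $C$ between $X$ and $X'$ with $\mathrm{dis}(C)\le\delta$, there exists an $\varepsilon$-overlay $C'$ of $X$ and $X'$ with $C\subset C'$. -/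

import Mathlib

open Set Filter Topology MeasureTheory

universe u v

noncomputable section

namespace RGraph

/-- A metric space is geodesic if any two points `x, y` are the endpoints of an isometrically
embedded interval (of length `dist x y`). -/
def IsGeodesicSpace (X : Type*) [MetricSpace X] : Prop :=
  ∀ x y : X, ∃ f : ℝ → X, f 0 = x ∧ f (dist x y) = y ∧
    ∀ s ∈ Icc 0 (dist x y), ∀ t ∈ Icc 0 (dist x y), dist (f s) (f t) = |s - t|

/-- An embedded cycle is the image of a continuous injective function on the unit circle. -/
def IsEmbeddedCycle {X : Type*} [MetricSpace X] (c : Set X) : Prop :=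
  ∃ f : Circle → X, Continuous f ∧ Function.Injective f ∧ range f = c

/-- An `ℝ`-tree is an acyclic geodesic metric space. -/
def IsRTree (X : Type*) [MetricSpace X] : Prop :=
  IsGeodesicSpace X ∧ ∀ c : Set X, ¬ IsEmbeddedCycle c

/-- An `ℝ`-graph is a compact geodesic metric space which is locally an `ℝ`-tree: every point is
the center of an open ball which, with the restricted distance, is an `ℝ`-tree. -/
def IsRGraph (X : Type*) [MetricSpace X] : Prop :=
  CompactSpace X ∧ IsGeodesicSpace X ∧ ∀ x : X, ∃ ε > 0, IsRTree (Metric.ball x ε)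

/-- The core: the union of all simple arcs having both endpoints in embedded cycles. -/
def core (X : Type*) [MetricSpace X] : Set X :=
  {z | ∃ γ : unitInterval → X, Continuous γ ∧ Function.Injective γ ∧
    (∃ c, IsEmbeddedCycle c ∧ γ 0 ∈ c) ∧ (∃ c, IsEmbeddedCycle c ∧ γ 1 ∈ c) ∧ z ∈ range γ}

/-- The set of connected components of a subset `S` (each viewed as a subset of `X`). -/
def components {X : Type*} [TopologicalSpace X] (S : Set X) : Set (Set X) :=
  connectedComponentIn S '' S

/-- The degree of `x` in `Y`: the number of connected components of `(B_ε(x) ∩ Y) \ {x}` for all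
small enough `ε > 0`. For the spaces considered here this number does not depend on `ε` once `ε`
is small, and the `liminf` as `ε → 0+` is this eventual value. -/
def degreeIn {X : Type*} [MetricSpace X] (Y : Set X) (x : X) : ℕ∞ :=
  liminf (fun ε : ℝ => (components ((Metric.ball x ε ∩ Y) \ {x})).encard) (𝓝[>] 0)

/-- The vertices of the kernel: the points of the core whose degree in the core is at least
three. -/
def kernelVertices (X : Type*) [MetricSpace X] : Set X :=
  {x | x ∈ core X ∧ 3 ≤ degreeIn (core X) x}

/-- The edges of the kernel: the closures of the connected components of the core deprived of the
kernel vertices. When the core is a cycle, the only edge is this cycle; when there is no cycle,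
there is no edge. -/
def kernelEdges (X : Type*) [MetricSpace X] : Set (Set X) :=
  closure '' components (core X \ kernelVertices X)

/-- `e` has ends `x` and `y` (with `x = y` for a loop). An edge contains no kernel vertices except
its ends. -/
def IsKernelLink {X : Type*} [MetricSpace X] (e : kernelEdges X) (x y : kernelVertices X) : Prop :=
  (e : Set X) ∩ kernelVertices X = {(x : X), (y : X)}

/-- An isomorphism between the multigraphs `ker X` and `ker X'`: bijections between the vertices
and between the edges which respect the ends of the edges. -/
structure KernelIso (X X' : Type*) [MetricSpace X] [MetricSpace X'] where
  onVertices : kernelVertices X ≃ kernelVertices X'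
  onEdges : kernelEdges X ≃ kernelEdges X'
  isLink_iff : ∀ (e : kernelEdges X) (x y : kernelVertices X),
    IsKernelLink (onEdges e) (onVertices x) (onVertices y) ↔ IsKernelLink e x y

open Classical in
/-- The surplus: `0` if there is no cycle, `1` if the core is a cycle, and otherwise the surplus
`|E| - |V| + 1` of the kernel. -/
def surplus (X : Type*) [MetricSpace X] : ℤ :=
  if (kernelVertices X).Nonempty then
    ((kernelEdges X).ncard : ℤ) - ((kernelVertices X).ncard : ℤ) + 1
  else if core X = ∅ then 0 else 1

/-- The length of a simple arc or of an embedded cycle, as its one-dimensional Hausdorff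
measure. -/
def length {X : Type*} [MetricSpace X] [MeasurableSpace X] [BorelSpace X] (e : Set X) : ENNReal :=
  Measure.hausdorffMeasure 1 e

/-- The class `𝒜_r` of `ℝ`-graphs whose core edges have length at least `r`, with total length of
the core edges at most `1 / r`, and with surplus at most `1 / r`. If the core is a cycle, then this
cycle is the only edge, and the first two conditions say that its length is in `[r, 1 / r]`. -/
def InClassA (r : ℝ) (X : Type*) [MetricSpace X] [MeasurableSpace X] [BorelSpace X] : Prop :=
  IsRGraph X ∧
  (∀ e ∈ kernelEdges X, ENNReal.ofReal r ≤ length e) ∧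
  (∑' e : kernelEdges X, length (e : Set X)) ≤ ENNReal.ofReal (1 / r) ∧
  (surplus X : ℝ) ≤ 1 / r

/-- `C ⊆ X × X'` is a correspondence between `X` and `X'`. -/
def IsCorrespondence {X X' : Type*} [MeasurableSpace X] [MeasurableSpace X']
    (C : Set (X × X')) : Prop :=
  MeasurableSet C ∧ (∀ x, ∃ x', (x, x') ∈ C) ∧ (∀ x', ∃ x, (x, x') ∈ C)

/-- The subsets `A` and `A'` are in correspondence via `C`: the set `C ∩ (A × A')` is a
correspondence between `A` and `A'`. -/
def InCorrespondenceVia {X X' : Type*} [MeasurableSpace X] [MeasurableSpace X']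
    (C : Set (X × X')) (A : Set X) (A' : Set X') : Prop :=
  IsCorrespondence {p : A × A' | ((p.1 : X), (p.2 : X')) ∈ C}

/-- The distortion of `C ⊆ X × X'`, as an extended nonnegative real. -/
def dis {X X' : Type*} [MetricSpace X] [MetricSpace X'] (C : Set (X × X')) : ENNReal :=
  ⨆ p ∈ C, ⨆ q ∈ C, ENNReal.ofReal |dist p.1 q.1 - dist p.2 q.2|

/-- `C` is an `ε`-overlay of the `ℝ`-graphs `X` and `X'`. This only makes sense when the surpluses
of `X` and `X'` are both at least two, both one, or both zero. -/
def IsOverlay (ε : ℝ) {X X' : Type*} [MetricSpace X] [MeasurableSpace X] [BorelSpace X]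
    [MetricSpace X'] [MeasurableSpace X'] [BorelSpace X'] (C : Set (X × X')) : Prop :=
  IsCorrespondence C ∧
  ((2 ≤ surplus X ∧ 2 ≤ surplus X' ∧ dis C < ENNReal.ofReal ε ∧
      ∃ χ : KernelIso X X',
        (∀ v : kernelVertices X, ((v : X), (χ.onVertices v : X')) ∈ C) ∧
        ∀ e : kernelEdges X, InCorrespondenceVia C (e : Set X) (χ.onEdges e : Set X') ∧
          |(length (e : Set X)).toReal - (length (χ.onEdges e : Set X')).toReal| ≤ ε) ∨
    (surplus X = 1 ∧ surplus X' = 1 ∧ dis C ≤ ENNReal.ofReal ε ∧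
      ∃ (c : Set X) (c' : Set X'),
        (∀ b, IsEmbeddedCycle b ↔ b = c) ∧ (∀ b', IsEmbeddedCycle b' ↔ b' = c') ∧
        InCorrespondenceVia C c c' ∧ |(length c).toReal - (length c').toReal| ≤ ε) ∨
    (surplus X = 0 ∧ surplus X' = 0 ∧ dis C ≤ ENNReal.ofReal ε))

end RGraph

end

/-! Everything happens at a scale `h = r / 100` below which a graph of the class looks like a tree.
Every embedded cycle contains a kernel edge, so its length is at least `r`, and geodesic triangles
of perimeter less than `r` must be tripods. This gives the four-point condition on balls of radius
`8 * h` (`TreeScale`) with `h` depending on `r` only (`IsRGraph.treeScale`). The condition lets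
approximate alignments be corrected into exact ones.

Cycles of `X` have no direct image in `X'`, so the core is first described metrically: it is the
union of the bi-infinite local geodesics (`exists_locGeod_core`, `locGeod_mem_core`). Indeed a local
geodesic ray in a compact space meets itself again and so produces a cycle in each direction of
time. Such geodesics can be built from any family of pairs of points that prolong one another
(`exists_locGeod_of_pairs`). Take points at steps `h` along the core of `X` and related points of
`X'`. The latter are only nearly aligned, but the medians of consecutive triples are exactly
aligned, hence belong to the core of `X'` (`Approx.exists_core`). Likewise a kernel vertex is the
centre of a tripod of the core with legs of length `h`, and the median of points related to the
three tips is a vertex of `X'` (`Approx.exists_vertex`). Distinct vertices are more than `8 * h`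
apart, which makes this a bijection.

An edge is sampled at steps close to `h / 4`, and core points of `X'` are chosen near the samples.
The union of the segments between consecutive ones is closed, has two opposite directions at each of
its points that is not a vertex, and meets the vertices only at its ends. A connectedness argument
(`component_subset`) shows that such a set is exactly one edge of `X'`
(`EdgeChain.closure_component`), longer by at most the number of steps times the error. Exchanging
`X` and `X'` gives the inverse map and the opposite length inequality.

The overlay is a thickening of the closure of `C` by a multiple of `δ`. Its type is decided by
whether there are vertices and whether the core is empty, both of which agree for `X` and `X'`; the
handshake inequality shows that one vertex forces surplus at least two. -/

noncomputable section

namespace RGraph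

/-! ### Metric betweenness and segments in geodesic spaces. -/

section Between

variable {X : Type*} [MetricSpace X]

/-- The point `m` lies metrically between `x` and `y`. -/
def Btw (x m y : X) : Prop := dist x m + dist m y = dist x y

/-- The metric segment of all points between `x` and `y`. -/
def seg (x y : X) : Set X := {m | Btw x m y}

theorem Btw.symm {x m y : X} (h : Btw x m y) : Btw y m x := by
  unfold Btw at *
  linarith [dist_comm x m, dist_comm m y, dist_comm x y]

theorem btw_comm {x m y : X} : Btw x m y ↔ Btw y m x := ⟨Btw.symm, Btw.symm⟩

theorem btw_left (x y : X) : Btw x x y := by simp [Btw]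

theorem btw_right (x y : X) : Btw x y y := by simp [Btw]

theorem Btw.of_ge {x m y : X} (h : dist x m + dist m y ≤ dist x y) : Btw x m y :=
  le_antisymm h (dist_triangle _ _ _)

theorem not_btw_iff {x m y : X} : ¬ Btw x m y ↔ dist x y < dist x m + dist m y := by
  unfold Btw
  constructor
  · intro h
    exact lt_of_le_of_ne (dist_triangle _ _ _) (Ne.symm h)
  · intro h h'
    linarith

theorem Btw.dist_le_left {x m y : X} (h : Btw x m y) : dist x m ≤ dist x y := by
  unfold Btw at h
  linarith [dist_nonneg (x := m) (y := y)]

theorem Btw.dist_le_right {x m y : X} (h : Btw x m y) : dist m y ≤ dist x y := by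
  unfold Btw at h
  linarith [dist_nonneg (x := x) (y := m)]

theorem Btw.trans_left {x m n y : X} (h : Btw x m y) (h' : Btw x n m) : Btw x n y := by
  apply Btw.of_ge
  unfold Btw at *
  linarith [dist_triangle n m y]

theorem Btw.trans_left' {x m n y : X} (h : Btw x m y) (h' : Btw x n m) : Btw n m y := by
  apply Btw.of_ge
  unfold Btw at *
  linarith [dist_triangle x n y]

theorem Btw.trans_right {x m n y : X} (h : Btw x m y) (h' : Btw m n y) : Btw x n y :=
  (h.symm.trans_left h'.symm).symm

theorem Btw.trans_right' {x m n y : X} (h : Btw x m y) (h' : Btw m n y) : Btw x m n :=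
  (h.symm.trans_left' h'.symm).symm

theorem btw_self_iff {x m : X} : Btw x m x ↔ m = x := by
  unfold Btw
  rw [dist_self, dist_comm m x]
  constructor
  · intro h
    have := dist_nonneg (x := x) (y := m)
    exact (dist_eq_zero.1 (by linarith)).symm
  · rintro rfl
    simp

theorem seg_comm (x y : X) : seg x y = seg y x := by
  ext m
  exact btw_comm

theorem left_mem_seg (x y : X) : x ∈ seg x y := btw_left x y

theorem right_mem_seg (x y : X) : y ∈ seg x y := btw_right x y

theorem isClosed_seg (x y : X) : IsClosed (seg x y) :=
  isClosed_eq (by fun_prop) continuous_const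

theorem seg_subset_left {x m y : X} (h : Btw x m y) : seg x m ⊆ seg x y :=
  fun _ hn => h.trans_left hn

theorem seg_subset_right {x m y : X} (h : Btw x m y) : seg m y ⊆ seg x y :=
  fun _ hn => h.trans_right hn

theorem exists_btw (hX : IsGeodesicSpace X) (x y : X) {s : ℝ} (h0 : 0 ≤ s) (h1 : s ≤ dist x y) :
    ∃ m, dist x m = s ∧ Btw x m y := by
  obtain ⟨f, hf0, hf1, hf⟩ := hX x y
  have h2 : (0 : ℝ) ∈ Icc 0 (dist x y) := ⟨le_rfl, dist_nonneg⟩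
  have h3 : dist x y ∈ Icc 0 (dist x y) := ⟨dist_nonneg, le_rfl⟩
  have e1 := hf 0 h2 s ⟨h0, h1⟩
  have e2 := hf s ⟨h0, h1⟩ _ h3
  rw [hf0, zero_sub, abs_neg, abs_of_nonneg h0] at e1
  rw [hf1, abs_sub_comm, abs_of_nonneg (by linarith)] at e2
  exact ⟨f s, e1, by unfold Btw; rw [e1, e2]; ring⟩

/-- A path along a geodesic, contained in the metric segment. -/
theorem exists_geodesic_subset_seg (hX : IsGeodesicSpace X) (x y : X) :
    ∃ f : ℝ → X, f 0 = x ∧ f (dist x y) = y ∧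
      (∀ s ∈ Icc 0 (dist x y), ∀ t ∈ Icc 0 (dist x y), dist (f s) (f t) = |s - t|) ∧
      ContinuousOn f (Icc 0 (dist x y)) ∧ f '' Icc 0 (dist x y) ⊆ seg x y := by
  obtain ⟨f, hf0, hf1, hf⟩ := hX x y
  have h2 : (0 : ℝ) ∈ Icc 0 (dist x y) := ⟨le_rfl, dist_nonneg⟩
  have h3 : dist x y ∈ Icc 0 (dist x y) := ⟨dist_nonneg, le_rfl⟩
  refine ⟨f, hf0, hf1, hf, ?_, ?_⟩
  · have : LipschitzOnWith 1 f (Icc 0 (dist x y)) := by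
      apply LipschitzOnWith.of_dist_le_mul
      intro s hs t ht
      rw [hf s hs t ht, Real.dist_eq]
      simp
    exact this.continuousOn
  · rintro _ ⟨s, hs, rfl⟩
    have e1 := hf 0 h2 s hs
    have e2 := hf s hs _ h3
    rw [hf0, zero_sub, abs_neg, abs_of_nonneg hs.1] at e1
    rw [hf1, abs_sub_comm, abs_of_nonneg (by linarith [hs.2])] at e2
    change dist x (f s) + dist (f s) y = dist x y
    rw [e1, e2]; ring

theorem isPreconnected_seg (hX : IsGeodesicSpace X) (x y : X) : IsPreconnected (seg x y) := by
  apply isPreconnected_of_forall x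
  intro m hm
  obtain ⟨f, hf0, hf1, hf, hc, hs⟩ := exists_geodesic_subset_seg hX x m
  refine ⟨f '' Icc 0 (dist x m), hs.trans (seg_subset_left hm), ?_, ?_, ?_⟩
  · exact ⟨0, ⟨le_rfl, dist_nonneg⟩, hf0⟩
  · exact ⟨_, ⟨dist_nonneg, le_rfl⟩, hf1⟩
  · exact isPreconnected_Icc.image f hc

end Between

/-! ### Tree geometry at a fixed scale. -/

/-- A geodesic space in which the four-point condition of trees holds for points lying in a
common ball of radius `8 * h`. -/
structure TreeScale (X : Type*) [MetricSpace X] (h : ℝ) : Prop where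
  pos : 0 < h
  geo : IsGeodesicSpace X
  hyp : ∀ p w x y z : X, dist p w ≤ 8 * h → dist p x ≤ 8 * h → dist p y ≤ 8 * h →
    dist p z ≤ 8 * h →
    dist w x + dist y z ≤ dist w y + dist x z ∨ dist w x + dist y z ≤ dist w z + dist x y

namespace TreeScale

variable {X : Type*} [MetricSpace X] {h : ℝ}

theorem mono (hT : TreeScale X h) {h' : ℝ} (h0 : 0 < h') (hle : h' ≤ h) : TreeScale X h' :=
  ⟨h0, hT.geo, fun p w x y z h1 h2 h3 h4 =>
    hT.hyp p w x y z (by linarith) (by linarith) (by linarith) (by linarith)⟩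

/-- Points of a short segment are determined up to their distance by the distance to an end. -/
theorem dist_eq_of_btw (hT : TreeScale X h) {x y m n : X} (hxy : dist x y ≤ 8 * h)
    (hm : Btw x m y) (hn : Btw x n y) : dist m n = |dist x m - dist x n| := by
  have hm1 := hm.dist_le_left
  have hn1 := hn.dist_le_left
  have h0 := hT.pos
  have key := hT.hyp x m n x y (by linarith) (by linarith) (by simp; linarith) hxy
  unfold Btw at hm hn
  have c1 := dist_comm m x
  have c2 := dist_comm n x
  have t1 := abs_dist_sub_le m n x
  rw [c1, c2] at t1
  apply le_antisymm _ t1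
  rcases key with key | key
  · refine le_trans ?_ (le_abs_self _); linarith
  · refine le_trans ?_ (neg_le_abs _); linarith

theorem btw_unique (hT : TreeScale X h) {x y m n : X} (hxy : dist x y ≤ 8 * h)
    (hm : Btw x m y) (hn : Btw x n y) (he : dist x m = dist x n) : m = n := by
  have := hT.dist_eq_of_btw hxy hm hn
  rw [he, sub_self, abs_zero] at this
  exact dist_eq_zero.1 this

theorem btw_of_le (hT : TreeScale X h) {x y m n : X} (hxy : dist x y ≤ 8 * h)
    (hm : Btw x m y) (hn : Btw x n y) (he : dist x m ≤ dist x n) : Btw x m n := by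
  have := hT.dist_eq_of_btw hxy hm hn
  rw [abs_sub_comm, abs_of_nonneg (by linarith)] at this
  unfold Btw
  linarith

theorem seg_eq_image (hT : TreeScale X h) {x y : X} (hxy : dist x y ≤ 8 * h) :
    ∃ f : ℝ → X, f 0 = x ∧ f (dist x y) = y ∧
      (∀ s ∈ Icc 0 (dist x y), ∀ t ∈ Icc 0 (dist x y), dist (f s) (f t) = |s - t|) ∧
      ContinuousOn f (Icc 0 (dist x y)) ∧ f '' Icc 0 (dist x y) = seg x y := by
  obtain ⟨f, hf0, hf1, hf, hc, hs⟩ := exists_geodesic_subset_seg hT.geo x y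
  refine ⟨f, hf0, hf1, hf, hc, hs.antisymm ?_⟩
  intro m hm
  have h1 : dist x m ∈ Icc 0 (dist x y) := ⟨dist_nonneg, Btw.dist_le_left hm⟩
  refine ⟨dist x m, h1, ?_⟩
  apply hT.btw_unique hxy (hs ⟨_, h1, rfl⟩) hm
  have := hf 0 ⟨le_rfl, dist_nonneg⟩ _ h1
  rwa [hf0, zero_sub, abs_neg, abs_of_nonneg h1.1] at this

/-- The median of three nearby points, with its distances to them. -/
theorem exists_median (hT : TreeScale X h) {x y z : X} (hxy : dist x y ≤ 8 * h)
    (hxz : dist x z ≤ 8 * h) :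
    ∃ m, Btw x m y ∧ Btw x m z ∧ Btw y m z ∧
      2 * dist x m = dist x y + dist x z - dist y z := by
  have t1 := dist_triangle x y z
  have t2 := dist_triangle y x z
  have t3 := dist_triangle x z y
  have c1 := dist_comm x y
  have c2 := dist_comm y z
  have h0 := hT.pos
  obtain ⟨m, hm1, hm2⟩ := exists_btw hT.geo x y (s := (dist x y + dist x z - dist y z) / 2)
    (by linarith) (by linarith)
  have hm3 := hm2.dist_le_left
  have key := hT.hyp x m z x y (by linarith) (by linarith) (by simp; linarith) hxy
  unfold Btw at hm2 ⊢
  have c3 := dist_comm x m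
  have c4 := dist_comm y m
  have c5 := dist_comm z x
  have t4 := dist_triangle x m z
  have t5 := dist_triangle y m z
  have : dist m z ≤ (dist x z + dist y z - dist x y) / 2 := by
    rcases key with key | key <;> linarith [dist_comm z y]
  refine ⟨m, hm2, ?_, ?_, ?_⟩ <;> linarith

/-- Local geodesics are geodesics. -/
theorem btw_concat (hT : TreeScale X h) {p a b c d : X} (ha : dist p a ≤ 8 * h)
    (hb : dist p b ≤ 8 * h) (hc : dist p c ≤ 8 * h) (hd : dist p d ≤ 8 * h)
    (h1 : Btw a b c) (h2 : Btw b c d) (hbc : b ≠ c) : Btw a b d := by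
  have key := hT.hyp p a c b d ha hc hb hd
  have := dist_pos.2 hbc
  have c1 := dist_comm b c
  apply Btw.of_ge
  unfold Btw at *
  rcases key with key | key <;> linarith

/-- Two directions that both agree with a third one agree. -/
theorem btw_or_btw (hT : TreeScale X h) {q p a b c : X} (hp : dist q p ≤ 8 * h)
    (ha : dist q a ≤ 8 * h) (hb : dist q b ≤ 8 * h) (hc : dist q c ≤ 8 * h)
    (h1 : Btw a p c) : Btw a p b ∨ Btw b p c := by
  by_contra! hcon
  rw [not_btw_iff, not_btw_iff] at hcon
  have key := hT.hyp q a c b p ha hc hb hp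
  have c1 := dist_comm b c
  have c2 := dist_comm c p
  have c3 := dist_comm b p
  unfold Btw at h1
  rcases key with key | key <;> linarith [hcon.1, hcon.2]

/-- Balls are convex. -/
theorem dist_le_max (hT : TreeScale X h) {p a b m : X} (ha : dist p a ≤ 4 * h)
    (hb : dist p b ≤ 4 * h) (hm : Btw a m b) : dist p m ≤ max (dist p a) (dist p b) := by
  have h0 := hT.pos
  have t := dist_triangle_left a b p
  have m1 := hm.dist_le_left
  have m2 := hm.dist_le_right
  have key := hT.hyp a p m a b (by rw [dist_comm]; linarith) (by linarith) (by simp; linarith)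
    (by linarith)
  have c1 := dist_comm m a
  rcases key with key | key
  · apply le_max_of_le_left; linarith
  · apply le_max_of_le_right; linarith

/-- Points of a preconnected set avoiding `p` lie in the same direction from `p`. -/
theorem not_btw_of_isPreconnected (hT : TreeScale X h) {p a b : X} {T : Set X}
    (hT' : IsPreconnected T) (hp : p ∉ T) (hnear : ∀ x ∈ T, dist p x ≤ 8 * h) (ha : a ∈ T)
    (hb : b ∈ T) : ¬ Btw a p b := by
  intro hab
  let U : Set X := {y | dist a y < dist a p + dist p y}
  -- The radius `dist p y` is the largest for which the ball cannot contain a point opposite to `y`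
  -- as seen from `p`. So `U` and `W` separate the points in the direction of `a` from those in the
  -- opposite directions.
  let W : Set X := ⋃ y ∈ {y | y ∈ T ∧ Btw a p y}, Metric.ball y (dist p y)
  have hU : IsOpen U := isOpen_lt (by fun_prop) (by fun_prop)
  have hW : IsOpen W := isOpen_biUnion fun y _ => Metric.isOpen_ball
  have hpos : ∀ y ∈ T, 0 < dist p y := fun y hy => dist_pos.2 fun h => hp (h ▸ hy)
  have hcover : T ⊆ U ∪ W := by
    intro y hy
    by_cases h1 : Btw a p y
    · right
      exact mem_biUnion (x := y) ⟨hy, h1⟩ (Metric.mem_ball_self (hpos y hy))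
    · left
      exact not_btw_iff.1 h1
  have haU : a ∈ U := by
    change dist a a < dist a p + dist p a
    have := hpos a ha
    rw [dist_self, dist_comm a p]; linarith
  have hbW : b ∈ W := mem_biUnion (x := b) ⟨hb, hab⟩ (Metric.mem_ball_self (hpos b hb))
  obtain ⟨z, hzT, hzU, hzW⟩ := hT' U W hU hW hcover ⟨a, ha, haU⟩ ⟨b, hb, hbW⟩
  obtain ⟨y, ⟨hyT, hay⟩, hzy⟩ := mem_iUnion₂.1 hzW
  rw [Metric.mem_ball] at hzy
  have h0 := hT.pos
  rcases hT.btw_or_btw (q := p) (by simp; linarith) (hnear a ha) (hnear z hzT) (hnear y hyT) hay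
    with h1 | h1
  · exact not_btw_iff.2 hzU h1
  · unfold Btw at h1
    linarith [dist_nonneg (x := z) (y := p)]

/-- A path covers the segment between its ends. -/
theorem seg_subset_image (hT : TreeScale X h) {γ : ℝ → X} {α β : ℝ} (hαβ : α ≤ β)
    (hγ : ContinuousOn γ (Icc α β)) {p : X} (hp : ∀ t ∈ Icc α β, dist p (γ t) ≤ 2 * h) :
    seg (γ α) (γ β) ⊆ γ '' Icc α β := by
  intro m hm
  by_contra hcon
  have h1 := hp α ⟨le_rfl, hαβ⟩
  have h2 := hp β ⟨hαβ, le_rfl⟩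
  have h0 := hT.pos
  have h3 := hT.dist_le_max (by linarith) (by linarith) hm
  have h4 : dist p m ≤ 2 * h := h3.trans (max_le h1 h2)
  refine hT.not_btw_of_isPreconnected (isPreconnected_Icc.image γ hγ) hcon ?_
    ⟨α, ⟨le_rfl, hαβ⟩, rfl⟩ ⟨β, ⟨hαβ, le_rfl⟩, rfl⟩ hm
  rintro _ ⟨t, ht, rfl⟩
  have := dist_triangle_left m (γ t) p
  linarith [hp t ht]

/-- A simple path runs inside the segment between its ends. -/
theorem btw_of_injOn (hT : TreeScale X h) {γ : ℝ → X} {α β t : ℝ} (ht : t ∈ Icc α β)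
    (hγ : ContinuousOn γ (Icc α β)) (hi : InjOn γ (Icc α β)) {p : X}
    (hp : ∀ t ∈ Icc α β, dist p (γ t) ≤ 2 * h) : Btw (γ α) (γ t) (γ β) := by
  have hαβ : α ≤ β := ht.1.trans ht.2
  have h0 := hT.pos
  have h1 := hp α ⟨le_rfl, hαβ⟩
  have h2 := hp β ⟨hαβ, le_rfl⟩
  have h3 := hp t ht
  obtain ⟨m, hm1, hm2, hm3, -⟩ := hT.exists_median (x := γ α) (y := γ β) (z := γ t)
    (by linarith [dist_triangle_left (γ α) (γ β) p])
    (by linarith [dist_triangle_left (γ α) (γ t) p])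
  have s1 : Icc α t ⊆ Icc α β := Icc_subset_Icc_right ht.2
  have s2 : Icc t β ⊆ Icc α β := Icc_subset_Icc_left ht.1
  obtain ⟨u, hu, hum⟩ := hT.seg_subset_image ht.1 (hγ.mono s1) (p := p)
    (fun s hs => hp s (s1 hs)) hm2
  obtain ⟨w, hw, hwm⟩ := hT.seg_subset_image ht.2 (hγ.mono s2) (p := p)
    (fun s hs => hp s (s2 hs)) hm3.symm
  -- The median lies on the segments from `γ t` to both ends, so both halves of the path pass
  -- through it. For a simple path this can only happen at time `t`.
  have : u = w := hi (s1 hu) (s2 hw) (hum.trans hwm.symm)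
  have hut : u = t := le_antisymm hu.2 (this ▸ hw.1)
  rw [← hut, hum]
  exact hm1

/-- Measure of short segments. -/
theorem length_seg_le [MeasurableSpace X] [BorelSpace X] (hT : TreeScale X h) {x y : X}
    (hxy : dist x y ≤ 8 * h) : length (seg x y) ≤ ENNReal.ofReal (dist x y) := by
  obtain ⟨f, -, -, hf, -, hs⟩ := hT.seg_eq_image hxy
  have hl : LipschitzOnWith 1 f (Icc 0 (dist x y)) := by
    apply LipschitzOnWith.of_dist_le_mul
    intro s hs t ht
    rw [hf s hs t ht, Real.dist_eq]
    simp
  have := hl.hausdorffMeasure_image_le (d := 1) zero_le_one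
  rw [hs] at this
  simpa [length, hausdorffMeasure_real] using this

end TreeScale

/-! ### Embedded cycles as closed paths on intervals. -/

section Cycles

variable {X : Type*} [MetricSpace X]

theorem isEmbeddedCycle_image {f : ℝ → X} {α β : ℝ} (hαβ : α < β)
    (hf : ContinuousOn f (Icc α β)) (hi : InjOn f (Ico α β)) (he : f α = f β) :
    IsEmbeddedCycle (f '' Icc α β) := by
  have hp : 0 < β - α := by linarith
  have : Fact (0 < β - α) := ⟨hp⟩
  have hβ : α + (β - α) = β := by ring
  let F : AddCircle (β - α) → X := AddCircle.liftIco (β - α) α f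
  have hFc : Continuous F := AddCircle.liftIco_continuous (by rwa [hβ]) (by rwa [hβ])
  have hsurj : ∀ z : AddCircle (β - α), ∃ t ∈ Ico α β, z = (t : AddCircle (β - α)) := by
    intro z
    refine ⟨AddCircle.equivIco (β - α) α z, ?_, AddCircle.coe_equivIco.symm⟩
    have := (AddCircle.equivIco (β - α) α z).2
    exact ⟨this.1, this.2.trans_eq hβ⟩
  have hF : ∀ t ∈ Ico α β, F (t : AddCircle (β - α)) = f t := fun t ht =>
    AddCircle.liftIco_coe_apply (by rwa [hβ])
  let e := AddCircle.homeomorphCircle (T := β - α) hp.ne'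
  refine ⟨F ∘ e.symm, hFc.comp e.symm.continuous, ?_, ?_⟩
  · apply Function.Injective.comp _ e.symm.injective
    intro z w hzw
    obtain ⟨s, hs, rfl⟩ := hsurj z
    obtain ⟨t, ht, rfl⟩ := hsurj w
    rw [hF s hs, hF t ht] at hzw
    rw [hi hs ht hzw]
  · rw [e.symm.surjective.range_comp]
    ext x
    constructor
    · rintro ⟨z, rfl⟩
      obtain ⟨t, ht, rfl⟩ := hsurj z
      exact ⟨t, Ico_subset_Icc_self ht, (hF t ht).symm⟩
    · rintro ⟨t, ht, rfl⟩
      rcases eq_or_lt_of_le ht.2 with h | h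
      · exact ⟨(α : ℝ), by rw [hF α ⟨le_rfl, hαβ⟩, he, h]⟩
      · exact ⟨(t : ℝ), hF t ⟨ht.1, h⟩⟩

theorem IsEmbeddedCycle.isCompact {c : Set X} (hc : IsEmbeddedCycle c) : IsCompact c := by
  obtain ⟨f, hf, -, rfl⟩ := hc
  exact isCompact_range hf

theorem IsEmbeddedCycle.infinite {c : Set X} (hc : IsEmbeddedCycle c) : c.Infinite := by
  obtain ⟨f, -, hi, rfl⟩ := hc
  have : Infinite Circle := by
    have : (Circle.exp '' Icc (0 : ℝ) 1).Infinite :=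
      (Icc_infinite one_pos).image (Circle.exp_injOn_Icc (by linarith [Real.pi_gt_three]))
    exact infinite_univ_iff.1 (this.mono (subset_univ _))
  exact infinite_range_of_injective hi

/-- A simple path on `[-1, 1]` running in the cycle with a given midpoint. -/
theorem IsEmbeddedCycle.exists_path {c : Set X} (hc : IsEmbeddedCycle c) {q : X} (hq : q ∈ c) :
    ∃ γ : ℝ → X, Continuous γ ∧ InjOn γ (Icc (-1) 1) ∧ γ 0 = q ∧ range γ ⊆ c := by
  obtain ⟨f, hf, hi, rfl⟩ := hc
  obtain ⟨z, rfl⟩ := hq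
  refine ⟨fun t => f (z * Circle.exp t), ?_, ?_, by simp, ?_⟩
  · exact hf.comp (continuous_const.mul Circle.exp.continuous)
  · intro s hs t ht hst
    exact Circle.exp_injOn_Icc (by linarith [Real.pi_gt_three]) hs ht (mul_left_cancel (hi hst))
  · rintro _ ⟨t, rfl⟩
    exact ⟨_, rfl⟩

theorem mem_core_of_path {γ : ℝ → X} {α β t : ℝ} (hαβ : α < β) (hγ : ContinuousOn γ (Icc α β))
    (hi : InjOn γ (Icc α β)) {c c' : Set X} (hc : IsEmbeddedCycle c) (hc' : IsEmbeddedCycle c')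
    (hα : γ α ∈ c) (hβ : γ β ∈ c') (ht : t ∈ Icc α β) : γ t ∈ core X := by
  have hmem : ∀ u : unitInterval, α + u * (β - α) ∈ Icc α β := fun u =>
    ⟨by nlinarith [u.2.1, u.2.2], by nlinarith [u.2.1, u.2.2]⟩
  refine ⟨fun u => γ (α + u * (β - α)), ?_, ?_, ⟨c, hc, by simpa using hα⟩,
    ⟨c', hc', by simpa using hβ⟩, ?_⟩
  · exact hγ.comp_continuous (by fun_prop) hmem
  · intro u w huw
    have := hi (hmem u) (hmem w) huw
    have h1 : (u : ℝ) * (β - α) = w * (β - α) := by linarith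
    exact Subtype.ext (mul_right_cancel₀ (by linarith) h1)
  · have hp : 0 < β - α := by linarith
    refine ⟨⟨(t - α) / (β - α), div_nonneg (by linarith [ht.1]) hp.le,
      (div_le_one hp).2 (by linarith [ht.2])⟩, ?_⟩
    change γ _ = γ t
    congr 1
    field_simp
    ring

theorem IsEmbeddedCycle.subset_core {c : Set X} (hc : IsEmbeddedCycle c) : c ⊆ core X := by
  intro q hq
  obtain ⟨γ, hγ, hi, h0, hr⟩ := hc.exists_path hq
  rw [← h0]
  exact mem_core_of_path (α := -1) (β := 1) (by norm_num) hγ.continuousOn hi hc hc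
    (hr ⟨_, rfl⟩) (hr ⟨_, rfl⟩) (by norm_num)

end Cycles

/-! ### Sets with two opposite directions at each point. -/

section TwoSided

variable {X : Type*} [MetricSpace X] {h : ℝ}

/-- The set `Z` contains segments starting at `q` in two opposite directions. -/
def TwoSidedAt (h : ℝ) (Z : Set X) (q : X) : Prop :=
  ∃ a b, a ≠ q ∧ b ≠ q ∧ dist q a ≤ h ∧ dist q b ≤ h ∧ Btw a q b ∧ seg q a ⊆ Z ∧ seg q b ⊆ Z

theorem TwoSidedAt.mono {Z Z' : Set X} {q : X} (hq : TwoSidedAt h Z q) (hZ : Z ⊆ Z') :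
    TwoSidedAt h Z' q := by
  obtain ⟨a, b, h1, h2, h3, h4, h5, h6, h7⟩ := hq
  exact ⟨a, b, h1, h2, h3, h4, h5, h6.trans hZ, h7.trans hZ⟩

/-- A short piece of a simple path around an interior time lies within a ball of radius `h`, where
it runs inside the segment between its ends and also covers it. -/
theorem TreeScale.twoSidedAt_path (hT : TreeScale X h) {γ : ℝ → X} {α β t : ℝ}
    (ht : t ∈ Ioo α β) (hγ : ContinuousOn γ (Icc α β)) (hi : InjOn γ (Icc α β)) :
    TwoSidedAt h (γ '' Icc α β) (γ t) := by
  have hcont : ContinuousAt γ t := hγ.continuousAt (Icc_mem_nhds ht.1 ht.2)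
  obtain ⟨ε, hε, hball⟩ := Metric.continuousAt_iff.1 hcont h hT.pos
  have h0 := hT.pos
  set τ := min (ε / 2) (min (t - α) (β - t)) with hτ
  have τ1 : τ ≤ ε / 2 := min_le_left _ _
  have τ2 : τ ≤ t - α := (min_le_right _ _).trans (min_le_left _ _)
  have τ3 : τ ≤ β - t := (min_le_right _ _).trans (min_le_right _ _)
  have τ0 : 0 < τ := lt_min (by linarith) (lt_min (by linarith [ht.1]) (by linarith [ht.2]))
  have hsub : Icc (t - τ) (t + τ) ⊆ Icc α β := Icc_subset_Icc (by linarith) (by linarith)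
  have hnear : ∀ s ∈ Icc (t - τ) (t + τ), dist (γ t) (γ s) ≤ h := by
    intro s hs
    rw [dist_comm]
    refine (hball ?_).le
    rw [Real.dist_eq, abs_lt]
    constructor <;> linarith [hs.1, hs.2]
  have m1 : t - τ ∈ Icc (t - τ) (t + τ) := ⟨le_rfl, by linarith⟩
  have m2 : t + τ ∈ Icc (t - τ) (t + τ) := ⟨by linarith, le_rfl⟩
  have m3 : t ∈ Icc (t - τ) (t + τ) := ⟨by linarith, by linarith⟩
  have s1 : Icc (t - τ) t ⊆ Icc (t - τ) (t + τ) := Icc_subset_Icc_right (by linarith)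
  have s2 : Icc t (t + τ) ⊆ Icc (t - τ) (t + τ) := Icc_subset_Icc_left (by linarith)
  refine ⟨γ (t - τ), γ (t + τ), ?_, ?_, hnear _ m1, hnear _ m2, ?_, ?_, ?_⟩
  · intro he
    have := hi (hsub m1) (hsub m3) he
    linarith
  · intro he
    have := hi (hsub m2) (hsub m3) he
    linarith
  · exact hT.btw_of_injOn m3 (hγ.mono hsub) (hi.mono hsub) (p := γ t)
      fun s hs => by linarith [hnear s hs]
  · rw [seg_comm]
    exact (hT.seg_subset_image (by linarith) (hγ.mono (s1.trans hsub)) (p := γ t)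
      fun s hs => by linarith [hnear s (s1 hs)]).trans (image_mono (s1.trans hsub))
  · exact (hT.seg_subset_image (by linarith) (hγ.mono (s2.trans hsub)) (p := γ t)
      fun s hs => by linarith [hnear s (s2 hs)]).trans (image_mono (s2.trans hsub))

theorem TreeScale.twoSidedAt_cycle (hT : TreeScale X h) {c : Set X} (hc : IsEmbeddedCycle c)
    {q : X} (hq : q ∈ c) : TwoSidedAt h c q := by
  obtain ⟨γ, hγ, hi, h0, hr⟩ := hc.exists_path hq
  rw [← h0]
  exact (hT.twoSidedAt_path (by norm_num) hγ.continuousOn hi).mono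
    ((image_subset_range _ _).trans hr)

/-- Every point of the core lies in a closed two-sided subset of the core. -/
theorem TreeScale.exists_twoSided_of_mem_core (hT : TreeScale X h) {z : X} (hz : z ∈ core X) :
    ∃ Z, IsClosed Z ∧ z ∈ Z ∧ Z ⊆ core X ∧ ∀ q ∈ Z, TwoSidedAt h Z q := by
  obtain ⟨γ, hγ, hi, ⟨c, hc, h0⟩, ⟨c', hc', h1⟩, hz⟩ := hz
  refine ⟨range γ ∪ (c ∪ c'), ?_, Or.inl hz, ?_, ?_⟩
  · exact (isCompact_range hγ).isClosed.union
      (hc.isCompact.isClosed.union hc'.isCompact.isClosed)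
  · refine union_subset ?_ (union_subset hc.subset_core hc'.subset_core)
    intro w hw
    exact ⟨γ, hγ, hi, ⟨c, hc, h0⟩, ⟨c', hc', h1⟩, hw⟩
  · have k1 : ∀ q ∈ c, TwoSidedAt h (range γ ∪ (c ∪ c')) q := fun q hq =>
      (hT.twoSidedAt_cycle hc hq).mono (subset_union_left.trans subset_union_right)
    have k2 : ∀ q ∈ c', TwoSidedAt h (range γ ∪ (c ∪ c')) q := fun q hq =>
      (hT.twoSidedAt_cycle hc' hq).mono (subset_union_right.trans subset_union_right)
    rintro q (⟨t, rfl⟩ | hq | hq)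
    · by_cases t0 : t = 0
      · rw [t0]; exact k1 _ h0
      by_cases t1 : t = 1
      · rw [t1]; exact k2 _ h1
      have l0 : (0 : ℝ) < t := lt_of_le_of_ne t.2.1 fun e => t0 (Subtype.ext e.symm)
      have l1 : (t : ℝ) < 1 := lt_of_le_of_ne t.2.2 fun e => t1 (Subtype.ext e)
      have := hT.twoSidedAt_path (γ := fun s => γ (projIcc 0 1 zero_le_one s)) (t := t)
        (α := 0) (β := 1) ⟨l0, l1⟩ (hγ.comp continuous_projIcc).continuousOn
        (by
          intro s hs u hu hsu
          have := hi hsu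
          rw [projIcc_of_mem _ hs, projIcc_of_mem _ hu] at this
          exact congrArg Subtype.val this)
      simp only [projIcc_val] at this
      refine this.mono (Subset.trans ?_ subset_union_left)
      rintro _ ⟨s, -, rfl⟩
      exact ⟨_, rfl⟩
    · exact k1 q hq
    · exact k2 q hq

/-- Opposite directions are available in two-sided sets. -/
theorem TreeScale.exists_opposite (hT : TreeScale X h) {Z : Set X} {q a : X}
    (hq : TwoSidedAt h Z q) (ha : dist q a ≤ h) :
    ∃ b, b ≠ q ∧ dist q b ≤ h ∧ Btw a q b ∧ seg q b ⊆ Z := by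
  obtain ⟨a', b', h1, h2, h3, h4, h5, h6, h7⟩ := hq
  have h0 := hT.pos
  rcases hT.btw_or_btw (q := q) (by simp; linarith) (by linarith) (b := a) (by linarith)
    (by linarith) h5 with h8 | h8
  · exact ⟨a', h1, h3, h8.symm, h6⟩
  · exact ⟨b', h2, h4, h8, h7⟩

/-- Segments of length `h` can be found in any available direction. -/
theorem TreeScale.exists_extension [CompactSpace X] (hT : TreeScale X h) {Z : Set X}
    (hZ : IsClosed Z) (h2 : ∀ q ∈ Z, TwoSidedAt h Z q) {q a : X} (hq : q ∈ Z)
    (ha : dist q a ≤ h) : ∃ b, dist q b = h ∧ Btw a q b ∧ seg q b ⊆ Z := by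
  have h0 := hT.pos
  -- Ends of admissible segments of length at most `h`; a farthest one exists by compactness, and it
  -- could be prolonged if its length were less than `h`. With `a = q` the alignment condition is
  -- void and any direction is allowed.
  let B : Set X := {b | dist q b ≤ h ∧ Btw a q b ∧ seg q b ⊆ Z}
  have hB : IsClosed B := by
    apply isClosed_of_closure_subset
    intro b hb
    have hcl : IsClosed ({b | dist q b ≤ h} ∩ {b | dist a q + dist q b = dist a b}) :=
      (isClosed_le (by fun_prop) continuous_const).inter
        (isClosed_eq (by fun_prop) (by fun_prop))
    have hBs : B ⊆ {b | dist q b ≤ h} ∩ {b | dist a q + dist q b = dist a b} :=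
      fun x hx => ⟨hx.1, hx.2.1⟩
    have hbb := closure_minimal hBs hcl hb
    have hb1 : dist q b ≤ h := hbb.1
    have hb2 : Btw a q b := hbb.2
    refine ⟨hb1, hb2, ?_⟩
    intro m hm
    rcases eq_or_lt_of_le hm.dist_le_left with he | hlt
    · have : m = b := by
        unfold seg Btw at hm
        exact dist_eq_zero.1 (by simp only [mem_ofPred_eq] at hm; linarith)
      rw [this]
      exact closure_minimal (fun x hx => hx.2.2 (right_mem_seg _ _) : B ⊆ Z) hZ hb
    -- If `b'` is closer to `b` than `m` is, the segments from `q` to `b` and to `b'` separate only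
    -- beyond `m`, so `m` also lies on the second one.
    · obtain ⟨b', ⟨k1, -, k3⟩, k4⟩ := Metric.mem_closure_iff.1 hb _ (sub_pos.2 hlt)
      obtain ⟨m', e1, e2, -, e4⟩ := hT.exists_median (x := q) (y := b) (z := b')
        (by linarith) (by linarith)
      apply k3
      refine Btw.trans_left e2 (hT.btw_of_le (by linarith) hm e1 ?_)
      linarith [dist_triangle q b' b, dist_comm b b']
  obtain ⟨b, ⟨b1, b2, b3⟩, hmax⟩ := hB.isCompact.exists_isMaxOn (f := fun b => dist q b)
    ⟨q, by simpa [B] using h0.le, btw_right _ _, by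
      intro m hm
      rw [btw_self_iff.1 hm]
      exact hq⟩ (by fun_prop)
  refine ⟨b, ?_, b2, b3⟩
  by_contra hne
  have hlt : dist q b < h := lt_of_le_of_ne b1 hne
  have hbZ : b ∈ Z := b3 (right_mem_seg _ _)
  by_cases hbq : b = q
  · subst hbq
    obtain ⟨c, c1, c2, c3, c4⟩ := hT.exists_opposite (h2 b hbZ) ha
    have : dist b c ≤ dist b b := hmax ⟨c2, c3, c4⟩
    rw [dist_self] at this
    exact c1 (dist_le_zero.1 (by rwa [dist_comm]))
  · obtain ⟨c0, c1, c2, c3, c4⟩ := hT.exists_opposite (h2 b hbZ) (a := q)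
      (by rw [dist_comm]; linarith)
    have hpos : 0 < dist b c0 := dist_pos.2 c1.symm
    -- The added piece is cut so that the total length stays at most `h`, which keeps the new end in
    -- `B`.
    obtain ⟨c, d1, d2⟩ := exists_btw hT.geo b c0 (s := min (dist b c0) (h - dist q b))
      (le_min hpos.le (by linarith)) (min_le_left _ _)
    have d3 : 0 < dist b c := by rw [d1]; exact lt_min hpos (by linarith)
    have d4 : dist b c ≤ h - dist q b := by rw [d1]; exact min_le_right _ _
    have d5 : Btw q b c := c3.trans_right' d2
    have d6 : dist q b + dist b c = dist q c := d5
    have d7 : Btw a q c := hT.btw_concat (p := q) (by linarith) (by simp; linarith)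
      (by linarith) (by linarith) b2 d5 (Ne.symm hbq)
    have : dist q c ≤ dist q b := hmax ⟨by linarith, d7, by
      intro m hm
      rcases le_total (dist q m) (dist q b) with hle | hle
      · exact b3 (hT.btw_of_le (by linarith) hm d5 hle)
      · exact c4 (d2.trans_left (Btw.trans_left' hm (hT.btw_of_le (by linarith) d5 hm hle)))⟩
    linarith

end TwoSided

/-! ### Local geodesics, their returns, and the core. -/

section LocGeod

variable {X : Type*} [MetricSpace X] {h : ℝ}

/-- Bi-infinite local geodesics at scale `h`. -/
def LocGeod (h : ℝ) (f : ℝ → X) : Prop := ∀ s t, |s - t| ≤ h → dist (f s) (f t) = |s - t|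

theorem LocGeod.dist_eq {f : ℝ → X} (hf : LocGeod h f) {s t : ℝ} (hst : s ≤ t)
    (hle : t - s ≤ h) : dist (f s) (f t) = t - s := by
  have : |s - t| = t - s := by rw [abs_sub_comm, abs_of_nonneg (by linarith)]
  rw [hf s t (by rw [this]; exact hle), this]

theorem LocGeod.btw {f : ℝ → X} (hf : LocGeod h f) {s t u : ℝ} (hst : s ≤ t) (htu : t ≤ u)
    (hle : u - s ≤ h) : Btw (f s) (f t) (f u) := by
  unfold Btw
  rw [hf.dist_eq hst (by linarith), hf.dist_eq htu (by linarith),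
    hf.dist_eq (hst.trans htu) hle]
  ring

theorem LocGeod.continuous {f : ℝ → X} (hf : LocGeod h f) (h0 : 0 < h) : Continuous f := by
  rw [Metric.continuous_iff]
  intro t ε hε
  refine ⟨min ε h, lt_min hε h0, fun s hs => ?_⟩
  rw [Real.dist_eq] at hs
  rw [hf s t (hs.le.trans (min_le_right _ _))]
  exact hs.trans_le (min_le_left _ _)

theorem LocGeod.lt_of_eq {f : ℝ → X} (hf : LocGeod h f) {s t : ℝ} (hst : s < t)
    (he : f s = f t) : h < t - s := by
  by_contra! hle
  have := hf.dist_eq hst.le hle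
  rw [he, dist_self] at this
  linarith

theorem LocGeod.shift {f : ℝ → X} (hf : LocGeod h f) (u : ℝ) :
    LocGeod h (fun t => f (u + t)) := by
  intro s t hst
  have : u + s - (u + t) = s - t := by ring
  have h2 := hf (u + s) (u + t)
  rw [this] at h2
  exact h2 hst

theorem LocGeod.reflect {f : ℝ → X} (hf : LocGeod h f) : LocGeod h (fun t => f (-t)) := by
  intro s t hst
  have h2 := hf (-s) (-t)
  rw [neg_sub_neg, abs_sub_comm] at h2
  exact h2 hst

/-- Segments on a local geodesic. -/
theorem TreeScale.seg_eq_image_locGeod (hT : TreeScale X h) {f : ℝ → X} (hf : LocGeod h f)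
    {s t : ℝ} (hst : s ≤ t) (hle : t - s ≤ h) : seg (f s) (f t) = f '' Icc s t := by
  have h0 := hT.pos
  apply Subset.antisymm
  · refine hT.seg_subset_image hst (hf.continuous h0).continuousOn (p := f s) fun u hu => ?_
    rw [hf.dist_eq hu.1 (by linarith [hu.2])]
    linarith [hu.2]
  · rintro _ ⟨u, hu, rfl⟩
    exact hf.btw hu.1 hu.2 hle

/-- A local geodesic ray in a compact space returns to itself. -/
theorem TreeScale.exists_return [CompactSpace X] (hT : TreeScale X h) {f : ℝ → X}
    (hf : LocGeod h f) : ∃ s t, 0 ≤ s ∧ s < t ∧ f s = f t := by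
  have h0 := hT.pos
  -- Pieces of length `h` starting at even multiples of `h` are disjoint in time. Two of them with
  -- nearly equal ends must share a point, which is then a true return.
  obtain ⟨a, φ, hφ, hlim⟩ := CompactSpace.tendsto_subseq
    (fun n : ℕ => (f (2 * n * h), f (2 * n * h + h)))
  obtain ⟨N, hN⟩ := Metric.cauchySeq_iff.1 hlim.cauchySeq (h / 4) (by linarith)
  have hd := hN N le_rfl (N + 1) (by omega)
  have hlt : φ N < φ (N + 1) := hφ (by omega)
  simp only [Function.comp_apply, Prod.dist_eq, max_lt_iff] at hd
  set n := φ N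
  set k := φ (N + 1)
  have hnk : (n : ℝ) + 1 ≤ k := by exact_mod_cast hlt
  obtain ⟨hd1, hd2⟩ := hd
  set a := f (2 * n * h)
  set b := f (2 * n * h + h)
  set a' := f (2 * k * h)
  set b' := f (2 * k * h + h)
  have hab : dist a b = h := by
    rw [hf.dist_eq (by linarith) (by linarith)]; ring
  have hab' : dist a' b' = h := by
    rw [hf.dist_eq (by linarith) (by linarith)]; ring
  have t1 := dist_triangle a b b'
  have t2 := dist_triangle a' a b
  have t3 := dist_comm a a'
  have t4 := dist_comm a b
  -- The points `m` and `m'` cut from the segment `[a, b]` the short parts near its ends where the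
  -- segment `[a', b']` may differ from it. Between them the two agree.
  obtain ⟨m, m1, m2, m3, m4⟩ := hT.exists_median (x := a) (y := b) (z := a')
    (by linarith) (by linarith)
  obtain ⟨m', n1, n2, n3, n4⟩ := hT.exists_median (x := b) (y := a) (z := b')
    (by linarith) (by linarith)
  have t5 := dist_triangle a a' b
  have t6 := dist_triangle b b' a
  have t7 := dist_comm a b'
  have t8 := dist_comm b a'
  have n1' : dist b m' + dist m' a = dist b a := n1
  have m1' : dist a m + dist m b = dist a b := m1
  have c1 := dist_comm m' b
  have c2 := dist_comm m' a
  have hle : dist a m < dist a m' := by linarith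
  have hne : m ≠ m' := by rintro rfl; exact lt_irrefl _ hle
  have k1 : Btw a m m' := hT.btw_of_le (by linarith) m1 n1.symm hle.le
  have k2 : Btw m m' b := n1.symm.trans_left' k1
  have k3 : Btw a' m m' := m3.symm.trans_right' k2
  have k4 : Btw m m' b' := n3.trans_left' k1
  have k5 : Btw a' m b' := by
    have e1 := m3.symm.dist_le_left
    have e2 := n2.dist_le_left
    refine hT.btw_concat (p := b) (by linarith) ?_ (by linarith) (by linarith) k3 k4 hne
    rw [dist_comm]; linarith [m1.dist_le_right]
  have k6 := hT.seg_eq_image_locGeod hf (s := 2 * n * h) (t := 2 * n * h + h) (by linarith)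
    (by linarith)
  have k7 := hT.seg_eq_image_locGeod hf (s := 2 * k * h) (t := 2 * k * h + h) (by linarith)
    (by linarith)
  have k8 : m ∈ f '' Icc (2 * n * h) (2 * n * h + h) := k6 ▸ m1
  have k9 : m ∈ f '' Icc (2 * k * h) (2 * k * h + h) := k7 ▸ k5
  obtain ⟨s, hs, hsm⟩ := k8
  obtain ⟨t, ht, htm⟩ := k9
  refine ⟨s, t, le_trans (by positivity) hs.1, ?_, hsm.trans htm.symm⟩
  nlinarith [hs.2, ht.1]

/-- The first return of a local geodesic. -/
theorem LocGeod.exists_first_return {f : ℝ → X} (hf : LocGeod h f) (h0 : 0 < h) {u v : ℝ}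
    (hne : ¬ InjOn f (Icc u v)) :
    ∃ s t, u ≤ s ∧ s < t ∧ t ≤ v ∧ f s = f t ∧ InjOn f (Ico u t) := by
  have hc := hf.continuous h0
  -- Two times with the same image are more than `h` apart, so the closed condition `p.1 + h ≤ p.2`
  -- can replace `p.1 < p.2`. This makes the set compact.
  let A : Set (ℝ × ℝ) := (Icc u v ×ˢ Icc u v) ∩ {p | p.1 + h ≤ p.2} ∩ {p | f p.1 = f p.2}
  have hA : IsCompact A := ((isCompact_Icc.prod isCompact_Icc).inter_right
    (isClosed_le (by fun_prop) (by fun_prop))).inter_right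
    (isClosed_eq (by fun_prop) (by fun_prop))
  have hmem : ∀ s t, u ≤ s → s < t → t ≤ v → f s = f t → (s, t) ∈ A := by
    intro s t h1 h2 h3 h4
    exact ⟨⟨⟨⟨h1, by simp only; linarith⟩, ⟨by simp only; linarith, h3⟩⟩,
      (by have := hf.lt_of_eq h2 h4; simp only [mem_ofPred_eq]; linarith)⟩, h4⟩
  have hpair : ∀ w, ¬ InjOn f w → ∃ s ∈ w, ∃ t ∈ w, s < t ∧ f s = f t := by
    intro w hw
    simp only [InjOn, not_forall] at hw
    obtain ⟨s, hs, t, ht, he, hst⟩ := hw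
    rcases lt_or_gt_of_ne hst with hlt | hlt
    · exact ⟨s, hs, t, ht, hlt, he⟩
    · exact ⟨t, ht, s, hs, hlt, he.symm⟩
  obtain ⟨s, hs, t, ht, hst, he⟩ := hpair _ hne
  obtain ⟨⟨s', t'⟩, hmin1, hmin⟩ := hA.exists_isMinOn (f := Prod.snd)
    ⟨(s, t), hmem s t hs.1 hst ht.2 he⟩ (by fun_prop)
  obtain ⟨⟨⟨hs', ht'⟩, hlt⟩, he'⟩ := hmin1
  simp only [mem_ofPred_eq] at hlt he'
  refine ⟨s', t', hs'.1, by linarith, ht'.2, he', ?_⟩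
  by_contra hcon
  obtain ⟨a, ha, b, hb, hab, hfab⟩ := hpair _ hcon
  have : t' ≤ b := hmin (hmem a b ha.1 hab (by linarith [hb.2, ht'.2]) hfab)
  exact absurd hb.2 (not_lt.2 this)

theorem LocGeod.isEmbeddedCycle {f : ℝ → X} (hf : LocGeod h f) (h0 : 0 < h) {s t : ℝ}
    (hst : s < t) (he : f s = f t) (hi : InjOn f (Ico s t)) : IsEmbeddedCycle (f '' Icc s t) :=
  isEmbeddedCycle_image hst (hf.continuous h0).continuousOn hi he

/-- Bi-infinite local geodesics run in the core. -/
theorem TreeScale.locGeod_mem_core [CompactSpace X] (hT : TreeScale X h) {f : ℝ → X}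
    (hf : LocGeod h f) (u : ℝ) : f u ∈ core X := by
  wlog hu : u = 0 generalizing u f
  · simpa using this (hf.shift u) 0 rfl
  subst hu
  have h0 := hT.pos
  have hc := hf.continuous h0
  have key : ∀ g : ℝ → X, LocGeod h g →
      ∃ s t, 0 ≤ s ∧ s < t ∧ g s = g t ∧ InjOn g (Ico 0 t) := by
    intro g hg
    obtain ⟨s, t, hs, hst, he⟩ := hT.exists_return hg
    obtain ⟨s', t', h1, h2, -, h3, h4⟩ := hg.exists_first_return h0 (u := 0) (v := t) fun hi =>
      hst.ne (hi ⟨hs, hst.le⟩ ⟨by linarith, le_rfl⟩ he)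
    exact ⟨s', t', h1, h2, h3, h4⟩
  obtain ⟨s₁, t₁, hs₁, hst₁, he₁, hi₁⟩ := key f hf
  obtain ⟨s₂, t₂, hs₂, hst₂, he₂, hi₂⟩ := key _ hf.reflect
  have c₁ := hf.isEmbeddedCycle h0 hst₁ he₁ (hi₁.mono (Ico_subset_Ico_left hs₁))
  have c₂ := hf.reflect.isEmbeddedCycle h0 hst₂ he₂ (hi₂.mono (Ico_subset_Ico_left hs₂))
  -- The forward and the backward return each give a cycle. If the path joining them is simple, it
  -- puts `f 0` in the core by definition, unless it is reduced to a point, which already lies on a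
  -- cycle.
  by_cases hinj : InjOn f (Icc (-s₂) s₁)
  · rcases eq_or_lt_of_le (show -s₂ ≤ s₁ by linarith) with heq | hlt
    · have : s₁ = 0 := by linarith
      subst this
      exact c₁.subset_core ⟨0, ⟨le_rfl, hst₁.le⟩, rfl⟩
    · exact mem_core_of_path hlt hc.continuousOn hinj c₂ c₁ ⟨s₂, ⟨le_rfl, hst₂.le⟩, rfl⟩
        ⟨s₁, ⟨le_rfl, hst₁.le⟩, rfl⟩ ⟨by linarith, hs₁⟩
  -- Each half of the path is injective, so a coincidence involves one time on each side of `0`. The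
  -- coincidence with the shortest time gap closes up a cycle through `f 0`.
  · let A : Set (ℝ × ℝ) := (Icc (-s₂) 0 ×ˢ Icc 0 s₁) ∩ {p | p.1 + h ≤ p.2} ∩
      {p | f p.1 = f p.2}
    have hA : IsCompact A := ((isCompact_Icc.prod isCompact_Icc).inter_right
      (isClosed_le (by fun_prop) (by fun_prop))).inter_right
      (isClosed_eq (by fun_prop) (by fun_prop))
    have hmem : ∀ x y, -s₂ ≤ x → x < y → y ≤ s₁ → f x = f y → (x, y) ∈ A := by
      intro x y h1 h2 h3 h4
      have hx : x ≤ 0 := by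
        by_contra! hx
        exact h2.ne (hi₁ ⟨hx.le, by linarith⟩ ⟨by linarith, by linarith⟩ h4)
      have hy : 0 ≤ y := by
        by_contra! hy
        have : -x = -y := hi₂ ⟨by linarith, by linarith⟩ ⟨by linarith, by linarith⟩
          (by simpa using h4)
        linarith
      exact ⟨⟨⟨⟨h1, hx⟩, ⟨hy, h3⟩⟩,
        (by have := hf.lt_of_eq h2 h4; simp only [mem_ofPred_eq]; linarith)⟩, h4⟩
    simp only [InjOn, not_forall] at hinj
    obtain ⟨x, hx, y, hy, hxy, hne⟩ := hinj
    have hAne : A.Nonempty := by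
      rcases lt_or_gt_of_ne hne with hlt | hlt
      · exact ⟨_, hmem x y hx.1 hlt hy.2 hxy⟩
      · exact ⟨_, hmem y x hy.1 hlt hx.2 hxy.symm⟩
    obtain ⟨⟨a, b⟩, hab, hmin⟩ := hA.exists_isMinOn (f := fun p : ℝ × ℝ => p.2 - p.1) hAne
      (by fun_prop)
    obtain ⟨⟨⟨⟨ha1, ha2⟩, ⟨hb1, hb2⟩⟩, hlt⟩, he⟩ := hab
    simp only [mem_ofPred_eq] at ha1 ha2 hb1 hb2 hlt he
    refine (hf.isEmbeddedCycle h0 (s := a) (t := b) (by linarith) he ?_).subset_core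
      ⟨0, ⟨ha2, hb1⟩, rfl⟩
    have hlt' : ∀ x y, a ≤ x → x < y → y < b → f x ≠ f y := by
      intro x y h1 h2 h3 h4
      have : b - a ≤ y - x := hmin (hmem x y (by linarith) h2 (by linarith) h4)
      linarith
    intro x hx y hy hxy
    by_contra hne
    rcases lt_or_gt_of_ne hne with hlt | hlt
    · exact hlt' x y hx.1 hlt hy.2 hxy
    · exact hlt' y x hy.1 hlt hx.2 hxy.symm

end LocGeod

/-! ### Building local geodesics from aligned chains of points. -/

section Chains

variable {X : Type*} [MetricSpace X] {h : ℝ}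

/-- Provides the times at which a chain indexed by `ℤ` passes through its points, from the lengths
of its steps. -/
theorem exists_partial_sums (d : ℤ → ℝ) : ∃ T : ℤ → ℝ, T 0 = 0 ∧ ∀ i, T (i + 1) = T i + d i := by
  refine ⟨fun i => ∑ j ∈ Finset.Ico 0 i, d j - ∑ j ∈ Finset.Ico i 0, d j, by simp, fun i => ?_⟩
  beta_reduce
  rcases le_or_gt 0 i with hi | hi
  · have : Finset.Ico 0 (i + 1) = insert i (Finset.Ico 0 i) := by
      ext j; simp only [Finset.mem_Ico, Finset.mem_insert]; omega
    rw [this, Finset.sum_insert (by simp), Finset.Ico_eq_empty (a := i + 1) (by omega),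
      Finset.Ico_eq_empty (a := i) (by omega)]
    simp; ring
  · have : Finset.Ico i 0 = insert i (Finset.Ico (i + 1) 0) := by
      ext j; simp only [Finset.mem_Ico, Finset.mem_insert]; omega
    rw [this, Finset.sum_insert (by simp), Finset.Ico_eq_empty (b := i + 1) (by omega),
      Finset.Ico_eq_empty (b := i) (by omega)]
    simp

/-- Gluing geodesics along an aligned chain of points. -/
theorem exists_locGeod_of_chain (hX : IsGeodesicSpace X) (h0 : 0 < h) (m : ℤ → X)
    (hd : ∀ i, h ≤ dist (m i) (m (i + 1))) (hb : ∀ i, Btw (m i) (m (i + 1)) (m (i + 2))) :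
    ∃ f : ℝ → X, LocGeod h f ∧ f 0 = m 0 ∧ f (dist (m 0) (m 1)) = m 1 := by
  obtain ⟨T, hT0, hT⟩ := exists_partial_sums fun i => dist (m i) (m (i + 1))
  choose g hg0 hg1 hg hgc hgs using fun i => exists_geodesic_subset_seg hX (m i) (m (i + 1))
  have hmono : StrictMono T := strictMono_int_of_lt_succ fun i => by linarith [hT i, hd i]
  have hidx : ∀ t : ℝ, ∃ i, T i ≤ t ∧ t < T (i + 1) := by
    intro t
    have hup : ∀ n : ℕ, T 0 + n * h ≤ T n := by
      intro n
      induction n with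
      | zero => simp
      | succ n ih => push_cast; linarith [hT n, hd n]
    have hdown : ∀ n : ℕ, T (-n) ≤ T 0 - n * h := by
      intro n
      induction n with
      | zero => simp
      | succ n ih =>
        have h1 := hT (-(n + 1))
        have h2 := hd (-(n + 1))
        have e : -((n : ℤ) + 1) + 1 = -n := by ring
        rw [e] at h1 h2
        push_cast
        linarith
    obtain ⟨n, hn⟩ := exists_nat_gt (|t| / h)
    rw [div_lt_iff₀ h0] at hn
    obtain ⟨i, hi1, hi2⟩ := Int.exists_greatest_of_bdd (P := fun i => T i ≤ t)
      ⟨n, fun i hi => by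
        by_contra! hlt
        have := hmono hlt
        linarith [hup n, le_abs_self t]⟩
      ⟨-n, by linarith [hdown n, neg_abs_le t]⟩
    refine ⟨i, hi1, ?_⟩
    by_contra! hle
    have := hi2 _ hle
    omega
  choose idx hidx1 hidx2 using hidx
  let f : ℝ → X := fun t => g (idx t) (t - T (idx t))
  have huniq : ∀ i t, T i ≤ t → t < T (i + 1) → idx t = i := by
    intro i t h1 h2
    have k1 := hmono.lt_iff_lt.1 (h1.trans_lt (hidx2 t))
    have k2 := hmono.lt_iff_lt.1 ((hidx1 t).trans_lt h2)
    omega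
  have hf : ∀ i t, T i ≤ t → t ≤ T (i + 1) → f t = g i (t - T i) := by
    intro i t h1 h2
    rcases eq_or_lt_of_le h2 with he | hlt
    · have e1 : idx t = i + 1 := huniq _ _ he.ge (by
        rw [he]; exact hmono (by omega))
      have e2 : t - T i = dist (m i) (m (i + 1)) := by linarith [hT i]
      simp only [f]
      rw [e1, e2, hg1, he, sub_self, hg0]
    · simp only [f]
      rw [huniq i t h1 hlt]
  have hfm : ∀ i, f (T i) = m i := by
    intro i
    rw [hf i (T i) le_rfl (by linarith [hT i, hd i]), sub_self, hg0]
  have hin : ∀ i t, T i ≤ t → t ≤ T (i + 1) → t - T i ∈ Icc 0 (dist (m i) (m (i + 1))) := by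
    intro i t h1 h2
    exact ⟨by linarith, by linarith [hT i]⟩
  have hbtw : ∀ i t, T i ≤ t → t ≤ T (i + 1) → Btw (m i) (f t) (m (i + 1)) := by
    intro i t h1 h2
    rw [hf i t h1 h2]
    exact hgs i ⟨_, hin i t h1 h2, rfl⟩
  have hsame : ∀ i s t, T i ≤ s → s ≤ t → t ≤ T (i + 1) → dist (f s) (f t) = t - s := by
    intro i s t h1 h2 h3
    rw [hf i s h1 (h2.trans h3), hf i t (h1.trans h2) h3,
      hg i _ (hin i s h1 (h2.trans h3)) _ (hin i t (h1.trans h2) h3), abs_sub_comm,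
      abs_of_nonneg (by linarith)]
    ring
  -- Every step has length at least `h`, so a time interval of length at most `h` extends over at
  -- most two consecutive steps. The alignment at their common node then gives additivity.
  have hle : ∀ s t, s ≤ t → t - s ≤ h → dist (f s) (f t) = t - s := by
    intro s t h1 h2
    have a1 := hidx1 s
    have a2 := (hidx2 s).le
    set i := idx s
    rcases le_total t (T (i + 1)) with h3 | h3
    · exact hsame i s t a1 h1 h3
    · have b1 : t ≤ T (i + 1 + 1) := by linarith [hT (i + 1), hd (i + 1)]
      have b2 : Btw (f s) (m (i + 1)) (f t) := by
        have k := (hb i)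
        have e : i + 2 = i + 1 + 1 := by ring
        rw [e] at k
        exact (k.trans_right' (hbtw (i + 1) t h3 b1)).trans_left' (hbtw i s a1 a2)
      unfold Btw at b2
      rw [← hfm, hsame i s _ a1 a2 le_rfl, hsame (i + 1) _ t le_rfl h3 b1] at b2
      linarith
  refine ⟨f, ?_, ?_, ?_⟩
  · intro s t hst
    rcases le_total s t with hst' | hst'
    · rw [abs_sub_comm, abs_of_nonneg (by linarith)] at hst ⊢
      exact hle s t hst' hst
    · rw [abs_of_nonneg (by linarith)] at hst ⊢
      rw [dist_comm]
      exact hle t s hst' hst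
  · rw [← hT0, hfm]
  · have := hT 0
    rw [hT0, zero_add, zero_add] at this
    rw [← this, hfm]

/-- Directed pairs that can be prolonged in both directions give bi-infinite local geodesics. -/
theorem exists_locGeod_of_pairs (hX : IsGeodesicSpace X) (h0 : 0 < h) {S : Set (X × X)}
    (hd : ∀ a b, (a, b) ∈ S → h ≤ dist a b) (hsymm : ∀ a b, (a, b) ∈ S → (b, a) ∈ S)
    (hext : ∀ a b, (a, b) ∈ S → ∃ c, (b, c) ∈ S ∧ Btw a b c) {a b : X} (hab : (a, b) ∈ S) :
    ∃ f : ℝ → X, LocGeod h f ∧ f 0 = a ∧ f (dist a b) = b := by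
  choose! ext hext1 hext2 using hext
  have hseq : ∀ a b, (a, b) ∈ S → ∃ F : ℕ → X, F 0 = a ∧ F 1 = b ∧
      (∀ n, (F n, F (n + 1)) ∈ S) ∧ ∀ n, Btw (F n) (F (n + 1)) (F (n + 2)) := by
    intro a b hab
    let G : ℕ → X × X := fun n => Nat.rec (a, b) (fun _ p => (p.2, ext p.1 p.2)) n
    have hG : ∀ n, G n ∈ S := by
      intro n
      induction n with
      | zero => exact hab
      | succ n ih => exact hext1 (G n).1 (G n).2 ih
    refine ⟨fun n => (G n).1, rfl, rfl, fun n => ?_, fun n => ?_⟩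
    · exact hG n
    · exact hext2 (G n).1 (G n).2 (hG n)
  obtain ⟨F, hF0, hF1, hF, hFb⟩ := hseq a b hab
  obtain ⟨G, hG0, hG1, hG, hGb⟩ := hseq b a (hsymm a b hab)
  -- The sequence from `(b, a)` is read backwards with the shift `1 - i`, so that it overlaps the
  -- sequence from `(a, b)` at the indices `0` and `1`. Thus no alignment is left to check at the
  -- junction.
  let m : ℤ → X := fun i => if 0 ≤ i then F i.toNat else G (1 - i).toNat
  have hm1 : ∀ n : ℕ, m n = F n := fun n => by simp [m]
  have hm2 : ∀ n : ℕ, m (1 - n) = G n := by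
    intro n
    rcases n with _ | _ | n
    · simp [m, hG0, hF1]
    · simp [m, hG1, hF0]
    · have e1 : ¬ (0 ≤ 1 - ((n + 1 + 1 : ℕ) : ℤ)) := by push_cast; omega
      have e2 : (1 - (1 - ((n + 1 + 1 : ℕ) : ℤ))).toNat = n + 1 + 1 := by omega
      simp only [m]
      rw [if_neg e1, e2]
  have hcase : ∀ i : ℤ, (∃ n : ℕ, i = n) ∨ ∃ n : ℕ, i = 1 - ((n + 2 : ℕ) : ℤ) := by
    intro i
    rcases le_or_gt 0 i with hi | hi
    · exact Or.inl ⟨i.toNat, by omega⟩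
    · exact Or.inr ⟨(-1 - i).toNat, by omega⟩
  have c1 : ∀ i, h ≤ dist (m i) (m (i + 1)) := by
    intro i
    rcases hcase i with ⟨n, rfl⟩ | ⟨n, rfl⟩
    · rw [hm1, show (n : ℤ) + 1 = (n + 1 : ℕ) by simp, hm1]
      exact hd _ _ (hF n)
    · rw [hm2, show 1 - ((n + 2 : ℕ) : ℤ) + 1 = 1 - ((n + 1 : ℕ) : ℤ) by push_cast; ring, hm2,
        dist_comm]
      exact hd _ _ (hG (n + 1))
  have c2 : ∀ i, Btw (m i) (m (i + 1)) (m (i + 2)) := by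
    intro i
    rcases hcase i with ⟨n, rfl⟩ | ⟨n, rfl⟩
    · rw [hm1, show (n : ℤ) + 1 = (n + 1 : ℕ) by simp, hm1,
        show (n : ℤ) + 2 = (n + 2 : ℕ) by simp, hm1]
      exact hFb n
    · rw [hm2, show 1 - ((n + 2 : ℕ) : ℤ) + 1 = 1 - ((n + 1 : ℕ) : ℤ) by push_cast; ring, hm2,
        show 1 - ((n + 2 : ℕ) : ℤ) + 2 = 1 - (n : ℤ) by push_cast; ring, hm2]
      exact (hGb n).symm
  obtain ⟨f, hf, hf0, hf1⟩ := exists_locGeod_of_chain hX h0 m c1 c2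
  have e0 : m 0 = a := by simpa [hF0] using hm1 0
  have e1 : m 1 = b := by simpa [hF1] using hm1 1
  rw [e0, e1] at hf1
  exact ⟨f, hf, hf0.trans e0, hf1⟩

end Chains

/-! ### The core is closed and convex. -/

section Core

variable {X : Type*} [MetricSpace X] {h : ℝ}

/-- A geodesic through a given point of a metric segment. -/
theorem exists_geodesic_through (hX : IsGeodesicSpace X) {x m y : X} (hm : Btw x m y) :
    ∃ f : ℝ → X, f 0 = x ∧ f (dist x y) = y ∧ f (dist x m) = m ∧
      ∀ s ∈ Icc 0 (dist x y), ∀ t ∈ Icc 0 (dist x y), dist (f s) (f t) = |s - t| := by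
  obtain ⟨g, g0, g1, hg, -, hgs⟩ := exists_geodesic_subset_seg hX x m
  obtain ⟨k, k0, k1, hk, -, hks⟩ := exists_geodesic_subset_seg hX m y
  have hm' : dist x m + dist m y = dist x y := hm
  have n1 := dist_nonneg (x := x) (y := m)
  have n2 := dist_nonneg (x := m) (y := y)
  let f : ℝ → X := fun t => if t ≤ dist x m then g t else k (t - dist x m)
  have f1 : ∀ t, t ≤ dist x m → f t = g t := fun t ht => if_pos ht
  have f2 : ∀ t, dist x m ≤ t → f t = k (t - dist x m) := by
    intro t ht
    rcases eq_or_lt_of_le ht with he | hlt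
    · rw [f1 t he.ge, ← he, g1, sub_self, k0]
    · exact if_neg (not_le.2 hlt)
  have key : ∀ s t, 0 ≤ s → s ≤ t → t ≤ dist x y → dist (f s) (f t) = t - s := by
    intro s t hs hst ht
    have habs : |s - t| = t - s := by rw [abs_sub_comm, abs_of_nonneg (by linarith)]
    rcases le_total t (dist x m) with h1 | h1
    · rw [f1 s (hst.trans h1), f1 t h1, hg s ⟨hs, hst.trans h1⟩ t ⟨hs.trans hst, h1⟩, habs]
    · rcases le_total (dist x m) s with h2 | h2
      · rw [f2 s h2, f2 t h1, hk _ ⟨by linarith, by linarith⟩ _ ⟨by linarith, by linarith⟩]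
        rw [show s - dist x m - (t - dist x m) = s - t by ring, habs]
      · rw [f1 s h2, f2 t h1]
        have b1 : Btw x (g s) m := hgs ⟨s, ⟨hs, h2⟩, rfl⟩
        have b2 : Btw m (k (t - dist x m)) y := hks ⟨_, ⟨by linarith, by linarith⟩, rfl⟩
        have b3 : Btw (g s) m (k (t - dist x m)) := (hm.trans_right' b2).trans_left' b1
        have d1 := hg s ⟨hs, h2⟩ _ ⟨n1, le_rfl⟩
        have d2 := hk 0 ⟨le_rfl, n2⟩ (t - dist x m) ⟨by linarith, by linarith⟩
        rw [g1, abs_sub_comm, abs_of_nonneg (by linarith)] at d1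
        rw [k0, zero_sub, abs_neg, abs_of_nonneg (by linarith)] at d2
        unfold Btw at b3
        linarith
  refine ⟨f, ?_, ?_, ?_, ?_⟩
  · rw [f1 0 n1, g0]
  · rw [f2 _ (by linarith), show dist x y - dist x m = dist m y by linarith, k1]
  · rw [f1 _ le_rfl, g1]
  · intro s hs t ht
    rcases le_total s t with hst | hst
    · rw [key s t hs.1 hst ht.2, abs_sub_comm, abs_of_nonneg (by linarith)]
    · rw [dist_comm, key t s ht.1 hst hs.2, abs_of_nonneg (by linarith)]

namespace TreeScale

/-- The criterion by which points are shown to be in the core without exhibiting a cycle. The step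
`l` is unrelated to `h`, so the local geodesic is taken at scale `min l h`. -/
theorem mem_core_of_pairs [CompactSpace X] (hT : TreeScale X h) {l : ℝ} (hl : 0 < l)
    {S : Set (X × X)} (hd : ∀ a b, (a, b) ∈ S → l ≤ dist a b)
    (hsymm : ∀ a b, (a, b) ∈ S → (b, a) ∈ S)
    (hext : ∀ a b, (a, b) ∈ S → ∃ c, (b, c) ∈ S ∧ Btw a b c) {a b : X} (hab : (a, b) ∈ S) :
    a ∈ core X := by
  have h0 : 0 < min l h := lt_min hl hT.pos
  obtain ⟨f, hf, hf0, -⟩ := exists_locGeod_of_pairs hT.geo h0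
    (fun a b hab => (min_le_left _ _).trans (hd a b hab)) hsymm hext hab
  rw [← hf0]
  exact (hT.mono h0 (min_le_right _ _)).locGeod_mem_core hf 0

theorem exists_locGeod_of_twoSided [CompactSpace X] (hT : TreeScale X h) {Z : Set X}
    (hZ : IsClosed Z) (h2 : ∀ q ∈ Z, TwoSidedAt h Z q) {q : X} (hq : q ∈ Z) :
    ∃ f : ℝ → X, LocGeod h f ∧ f 0 = q := by
  have h0 := hT.pos
  obtain ⟨b, b1, -, b3⟩ := hT.exists_extension hZ h2 hq (a := q) (by simpa using h0.le)
  have hbZ := b3 (right_mem_seg _ _)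
  obtain ⟨f, hf, hf0, -⟩ := exists_locGeod_of_pairs hT.geo h0
    (S := {p | p.1 ∈ Z ∧ p.2 ∈ Z ∧ dist p.1 p.2 = h}) (fun a b hab => hab.2.2.ge)
    (fun a b hab => ⟨hab.2.1, hab.1, by rw [dist_comm]; exact hab.2.2⟩)
    (fun a b hab => by
      obtain ⟨c, c1, c2, c3⟩ := hT.exists_extension hZ h2 hab.2.1 (a := a)
        (by rw [dist_comm]; exact hab.2.2.le)
      exact ⟨c, ⟨hab.2.1, c3 (right_mem_seg _ _), c1⟩, c2⟩)
    (a := q) (b := b) ⟨hq, hbZ, b1⟩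
  exact ⟨f, hf, hf0⟩

theorem subset_core_of_twoSided [CompactSpace X] (hT : TreeScale X h) {Z : Set X}
    (hZ : IsClosed Z) (h2 : ∀ q ∈ Z, TwoSidedAt h Z q) : Z ⊆ core X := by
  intro q hq
  obtain ⟨f, hf, hf0⟩ := hT.exists_locGeod_of_twoSided hZ h2 hq
  rw [← hf0]
  exact hT.locGeod_mem_core hf 0

theorem exists_locGeod_core [CompactSpace X] (hT : TreeScale X h) {q : X} (hq : q ∈ core X) :
    ∃ f : ℝ → X, LocGeod h f ∧ f 0 = q := by
  obtain ⟨Z, hZ, hqZ, -, h2⟩ := hT.exists_twoSided_of_mem_core hq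
  exact hT.exists_locGeod_of_twoSided hZ h2 hqZ

theorem core_extension [CompactSpace X] (hT : TreeScale X h) {q a : X} (hq : q ∈ core X)
    (ha : dist q a ≤ h) : ∃ b ∈ core X, dist q b = h ∧ Btw a q b := by
  obtain ⟨Z, hZ, hqZ, hZc, h2⟩ := hT.exists_twoSided_of_mem_core hq
  obtain ⟨b, b1, b2, b3⟩ := hT.exists_extension hZ h2 hqZ ha
  exact ⟨b, hZc (b3 (right_mem_seg _ _)), b1, b2⟩

/-- Limits of pairs of core points at distance `h` can still be prolonged: the aligned triples form
a compact set, whose projection is closed. So a limit of core points starts a pair to which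
`mem_core_of_pairs` applies. -/
theorem isClosed_core [CompactSpace X] (hT : TreeScale X h) : IsClosed (core X) := by
  have h0 := hT.pos
  let S : Set (X × X) := {p | p.1 ∈ core X ∧ p.2 ∈ core X ∧ dist p.1 p.2 = h}
  let R : Set (X × X × X) := {t | (t.1, t.2.1) ∈ closure S} ∩ {t | (t.2.1, t.2.2) ∈ closure S} ∩
    {t | dist t.1 t.2.1 + dist t.2.1 t.2.2 = dist t.1 t.2.2}
  have hR : IsClosed R := ((isClosed_closure.preimage (by fun_prop)).inter
    (isClosed_closure.preimage (by fun_prop))).inter (isClosed_eq (by fun_prop) (by fun_prop))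
  have hRS : closure S ⊆ (fun t : X × X × X => (t.1, t.2.1)) '' R := by
    apply closure_minimal _ (hR.isCompact.image (by fun_prop)).isClosed
    rintro ⟨a, b⟩ hab
    obtain ⟨c, c1, c2, c3⟩ := hT.core_extension hab.2.1 (a := a)
      (by rw [dist_comm]; exact hab.2.2.le)
    exact ⟨(a, b, c), ⟨⟨subset_closure hab, subset_closure ⟨hab.2.1, c1, c2⟩⟩, c3⟩, rfl⟩
  have hd : ∀ a b, (a, b) ∈ closure S → h ≤ dist a b := by
    intro a b hab
    have hSd : S ⊆ {p : X × X | h ≤ dist p.1 p.2} := fun p hp => hp.2.2.ge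
    exact closure_minimal hSd (isClosed_le continuous_const (by fun_prop)) hab
  have hsymm : ∀ a b, (a, b) ∈ closure S → (b, a) ∈ closure S := by
    intro a b hab
    have hSs : S ⊆ Prod.swap ⁻¹' closure S := fun p hp =>
      subset_closure ⟨hp.2.1, hp.1, by rw [dist_comm]; exact hp.2.2⟩
    exact closure_minimal hSs (isClosed_closure.preimage continuous_swap) hab
  have hfst : closure (core X) ⊆ Prod.fst '' closure S := by
    apply closure_minimal _ (isClosed_closure.isCompact.image continuous_fst).isClosed
    intro q hq
    obtain ⟨b, b1, b2, -⟩ := hT.core_extension hq (a := q) (by simpa using h0.le)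
    exact ⟨(q, b), subset_closure ⟨hq, b1, b2⟩, rfl⟩
  apply isClosed_of_closure_subset
  intro q hq
  obtain ⟨⟨q, b⟩, hb, rfl⟩ := hfst hq
  refine hT.mem_core_of_pairs h0 hd hsymm ?_ hb
  intro a b hab
  obtain ⟨⟨a, b, c⟩, ⟨⟨-, h2⟩, h3⟩, he⟩ := hRS hab
  simp only [Prod.mk.injEq] at he
  obtain ⟨rfl, rfl⟩ := he
  exact ⟨c, h2, h3⟩

/-- The core is geodesically convex. -/
theorem seg_subset_core [CompactSpace X] (hT : TreeScale X h) {p q : X} (hp : p ∈ core X)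
    (hq : q ∈ core X) : seg p q ⊆ core X := by
  intro m hm
  obtain ⟨f, f0, f1, f2, hf⟩ := exists_geodesic_through hT.geo hm
  obtain ⟨Z, hZ, hpZ, -, h2⟩ := hT.exists_twoSided_of_mem_core hp
  obtain ⟨Z', hZ', hqZ, -, h2'⟩ := hT.exists_twoSided_of_mem_core hq
  have hfi : InjOn f (Icc 0 (dist p q)) := by
    intro s hs t ht hst
    have := hf s hs t ht
    rw [hst, dist_self] at this
    linarith [abs_eq_zero.1 this.symm]
  have hfc : ContinuousOn f (Icc 0 (dist p q)) := by
    have : LipschitzOnWith 1 f (Icc 0 (dist p q)) := by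
      apply LipschitzOnWith.of_dist_le_mul
      intro s hs t ht
      rw [hf s hs t ht, Real.dist_eq]
      simp
    exact this.continuousOn
  -- Interior points of the geodesic have their two directions along it; its ends have theirs in
  -- two-sided sets already inside the core.
  refine hT.subset_core_of_twoSided (Z := f '' Icc 0 (dist p q) ∪ (Z ∪ Z')) ?_ ?_
    (Or.inl ⟨_, ⟨dist_nonneg, hm.dist_le_left⟩, f2⟩)
  · exact (isCompact_Icc.image_of_continuousOn hfc).isClosed.union (hZ.union hZ')
  · have k1 : ∀ x ∈ Z, TwoSidedAt h (f '' Icc 0 (dist p q) ∪ (Z ∪ Z')) x := fun x hx =>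
      (h2 x hx).mono (subset_union_left.trans subset_union_right)
    have k2 : ∀ x ∈ Z', TwoSidedAt h (f '' Icc 0 (dist p q) ∪ (Z ∪ Z')) x := fun x hx =>
      (h2' x hx).mono (subset_union_right.trans subset_union_right)
    rintro x (⟨t, ht, rfl⟩ | hx | hx)
    · rcases eq_or_lt_of_le ht.1 with t0 | t0
      · rw [← t0, f0]; exact k1 _ hpZ
      rcases eq_or_lt_of_le ht.2 with t1 | t1
      · rw [t1, f1]; exact k2 _ hqZ
      exact (hT.twoSidedAt_path ⟨t0, t1⟩ hfc hfi).mono subset_union_left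
    · exact k1 x hx
    · exact k2 x hx

theorem isPreconnected_core [CompactSpace X] (hT : TreeScale X h) : IsPreconnected (core X) := by
  apply isPreconnected_of_forall_pair
  intro x hx y hy
  exact ⟨seg x y, hT.seg_subset_core hx hy, left_mem_seg _ _, right_mem_seg _ _,
    isPreconnected_seg hT.geo x y⟩

end TreeScale

end Core

/-! ### Kernel vertices and the local structure of the core. -/

section Vertices

variable {X : Type*} [MetricSpace X] {h : ℝ}

theorem twoSidedAt_seg (hX : IsGeodesicSpace X) (h0 : 0 < h) {x y q : X} (hq : q ∈ seg x y)
    (hqx : q ≠ x) (hqy : q ≠ y) : TwoSidedAt h (seg x y) q := by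
  have p1 := dist_pos.2 hqx
  have p2 := dist_pos.2 hqy
  obtain ⟨a, a1, a2⟩ := exists_btw hX q x (s := min h (dist q x)) (le_min h0.le p1.le)
    (min_le_right _ _)
  obtain ⟨b, b1, b2⟩ := exists_btw hX q y (s := min h (dist q y)) (le_min h0.le p2.le)
    (min_le_right _ _)
  refine ⟨a, b, ?_, ?_, a1.le.trans (min_le_left _ _), b1.le.trans (min_le_left _ _), ?_, ?_, ?_⟩
  · rw [← dist_pos, dist_comm, a1]; exact lt_min h0 p1
  · rw [← dist_pos, dist_comm, b1]; exact lt_min h0 p2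
  · exact (Btw.trans_right' hq b2).trans_left' a2.symm
  · refine (seg_subset_left a2).trans ?_
    rw [seg_comm q x]
    exact seg_subset_left hq
  · exact (seg_subset_left b2).trans (seg_subset_right hq)

namespace TreeScale

variable [CompactSpace X]

/-- A point of the core with three core points in pairwise opposite directions is a vertex. -/
theorem mem_kernelVertices (hT : TreeScale X h) {p a b c : X} (ha : a ∈ core X)
    (hb : b ∈ core X) (hc : c ∈ core X) (hap : a ≠ p) (hbp : b ≠ p) (hcp : c ≠ p)
    (hab : Btw a p b) (hac : Btw a p c) (hbc : Btw b p c) : p ∈ kernelVertices X := by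
  have h0 := hT.pos
  have hp : p ∈ core X := hT.seg_subset_core ha hb hab
  refine ⟨hp, ?_⟩
  have pa := dist_pos.2 hap.symm
  have pb := dist_pos.2 hbp.symm
  have pc := dist_pos.2 hcp.symm
  refine le_liminf_of_le (by isBoundedDefault) ?_
  have hpos : 0 < min h (min (dist p a) (min (dist p b) (dist p c))) :=
    lt_min h0 (lt_min pa (lt_min pb pc))
  filter_upwards [Ioo_mem_nhdsGT hpos] with ε hε
  obtain ⟨e0, e1⟩ := hε
  rw [lt_min_iff, lt_min_iff, lt_min_iff] at e1
  obtain ⟨e1, e2, e3, e4⟩ := e1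
  set Y := (Metric.ball p ε ∩ core X) \ {p} with hY
  have hsmall : ∀ x ∈ core X, ε < dist p x → ∃ y ∈ Y, Btw p y x := by
    intro x hx hlt
    obtain ⟨y, y1, y2⟩ := exists_btw hT.geo p x (s := ε / 2) (by linarith) (by linarith)
    refine ⟨y, ⟨⟨?_, hT.seg_subset_core hp hx y2⟩, ?_⟩, y2⟩
    · rw [Metric.mem_ball, dist_comm]; linarith
    · rintro rfl
      rw [dist_self] at y1; linarith
  obtain ⟨a', ha', a1⟩ := hsmall a ha e2
  obtain ⟨b', hb', b1⟩ := hsmall b hb e3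
  obtain ⟨c', hc', c1⟩ := hsmall c hc e4
  have hne : ∀ x ∈ Y, ∀ y ∈ Y, Btw x p y →
      connectedComponentIn Y x ≠ connectedComponentIn Y y := by
    intro x hx y hy hxy he
    refine hT.not_btw_of_isPreconnected (T := connectedComponentIn Y x)
      isPreconnected_connectedComponentIn ?_ ?_ (mem_connectedComponentIn hx)
      (he ▸ mem_connectedComponentIn hy) hxy
    · exact fun hp => (connectedComponentIn_subset _ _ hp).2 rfl
    · intro z hz
      have := (connectedComponentIn_subset _ _ hz).1.1
      rw [Metric.mem_ball, dist_comm] at this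
      linarith
  have hcut : ∀ {x y x' y' : X}, Btw x p y → Btw p x' x → Btw p y' y → Btw x' p y' :=
    fun hxy hx hy => (hxy.trans_right' hy).trans_left' hx.symm
  have hsub : {connectedComponentIn Y a', connectedComponentIn Y b', connectedComponentIn Y c'} ⊆
      components Y := by
    rintro _ (rfl | rfl | rfl)
    · exact ⟨a', ha', rfl⟩
    · exact ⟨b', hb', rfl⟩
    · exact ⟨c', hc', rfl⟩
  refine le_trans (le_of_eq ?_) (encard_le_encard hsub)
  symm
  rw [encard_eq_three]
  exact ⟨_, _, _, hne _ ha' _ hb' (hcut hab a1 b1), hne _ ha' _ hc' (hcut hac a1 c1),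
    hne _ hb' _ hc' (hcut hbc b1 c1), rfl⟩

/-- Segments in the core can be prolonged to length `h`. -/
theorem core_prolong (hT : TreeScale X h) {p a : X} (ha : a ∈ core X)
    (hne : a ≠ p) (hle : dist p a ≤ h) (hp : p ∈ core X) :
    ∃ a' ∈ core X, dist p a' = h ∧ ∀ b, dist p b ≤ h → Btw b p a → Btw b p a' := by
  have h0 := hT.pos
  obtain ⟨c, c1, c2, c3⟩ := hT.core_extension ha (a := p) (by rwa [dist_comm])
  have c4 : dist p a + dist a c = dist p c := c3
  have n := dist_nonneg (x := p) (y := a)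
  obtain ⟨a', a1, a2⟩ := exists_btw hT.geo p c (s := h) h0.le (by linarith)
  refine ⟨a', hT.seg_subset_core hp c1 a2, a1, fun b hb hbp => ?_⟩
  have := hT.btw_concat (p := p) (by linarith) (by simp; linarith) (by linarith) (by linarith)
    hbp c3 hne.symm
  exact this.trans_right' a2

/-- Points of a small punctured ball whose segment avoids `p` belong to the same component, because
balls and the core are convex. Hence three components give three pairwise opposite directions, which
`core_prolong` brings to length exactly `h`. -/
theorem exists_three_of_mem_kernelVertices (hT : TreeScale X h) {p : X}
    (hp : p ∈ kernelVertices X) : ∃ a ∈ core X, ∃ b ∈ core X, ∃ c ∈ core X,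
      dist p a = h ∧ dist p b = h ∧ dist p c = h ∧ Btw a p b ∧ Btw a p c ∧ Btw b p c := by
  have h0 := hT.pos
  obtain ⟨hpc, hdeg⟩ := hp
  have h2 : (2 : ℕ∞) < degreeIn (core X) p := lt_of_lt_of_le (by norm_num) hdeg
  have hev := eventually_lt_of_lt_liminf h2 (by isBoundedDefault)
  obtain ⟨ε, hε, e0, e1⟩ := (hev.and (Ioo_mem_nhdsGT h0)).exists
  set Y := (Metric.ball p ε ∩ core X) \ {p} with hY
  have h3 : (3 : ℕ∞) ≤ (components Y).encard := by
    have := Order.add_one_le_of_lt hε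
    exact le_trans (by norm_num) this
  obtain ⟨t, ht, htc⟩ := exists_subset_encard_eq h3
  rw [encard_eq_three] at htc
  obtain ⟨x, y, z, hxy, hxz, hyz, rfl⟩ := htc
  obtain ⟨a, ha, rfl⟩ := ht (by simp : x ∈ _)
  obtain ⟨b, hb, rfl⟩ := ht (by simp : y ∈ _)
  obtain ⟨c, hc, rfl⟩ := ht (by simp : z ∈ _)
  have hnear : ∀ x ∈ Y, dist p x < ε := by
    intro x hx
    rw [dist_comm]; exact hx.1.1
  have hbtw : ∀ x ∈ Y, ∀ y ∈ Y, connectedComponentIn Y x ≠ connectedComponentIn Y y →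
      Btw x p y := by
    intro x hx y hy hne
    by_contra hcon
    apply hne
    have hsub : seg x y ⊆ Y := by
      intro m hm
      refine ⟨⟨?_, hT.seg_subset_core hx.1.2 hy.1.2 hm⟩, ?_⟩
      · rw [Metric.mem_ball, dist_comm]
        exact (hT.dist_le_max (by linarith [hnear x hx]) (by linarith [hnear y hy]) hm).trans_lt
          (max_lt (hnear x hx) (hnear y hy))
      · rintro rfl
        exact hcon hm
    apply connectedComponentIn_eq
    exact (isPreconnected_seg hT.geo x y).subset_connectedComponentIn (left_mem_seg _ _) hsub
      (right_mem_seg _ _)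
  have hab := hbtw a ha b hb hxy
  have hac := hbtw a ha c hc hxz
  have hbc := hbtw b hb c hc hyz
  have hle : ∀ x ∈ Y, dist p x ≤ h := fun x hx => by linarith [hnear x hx]
  obtain ⟨a', a1, a2, a3⟩ := hT.core_prolong ha.1.2 ha.2 (hle a ha) hpc
  obtain ⟨b', b1, b2, b3⟩ := hT.core_prolong hb.1.2 hb.2 (hle b hb) hpc
  obtain ⟨c', c1, c2, c3⟩ := hT.core_prolong hc.1.2 hc.2 (hle c hc) hpc
  exact ⟨a', a1, b', b1, c', c1, a2, b2, c2, b3 _ a2.le (a3 _ (hle b hb) hab.symm).symm,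
    c3 _ a2.le (a3 _ (hle c hc) hac.symm).symm, c3 _ b2.le (b3 _ (hle c hc) hbc.symm).symm⟩

/-- A vertex is determined by the tips of a tripod with legs `h` around it, even when these are
known only up to `h / 2`. A finite cover of the space of triples by small balls therefore separates
the vertices. -/
theorem finite_kernelVertices (hT : TreeScale X h) : (kernelVertices X).Finite := by
  have h0 := hT.pos
  choose! A hA B hB C hC hpA hpB hpC hAB hAC hBC using
    fun (p : X) (hp : p ∈ kernelVertices X) => hT.exists_three_of_mem_kernelVertices hp
  obtain ⟨t, -, ht, hcov⟩ := finite_cover_balls_of_compact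
    (isCompact_univ (X := X × X × X)) (e := h / 4) (by linarith)
  have hidx : ∀ p, ∃ i ∈ t, (A p, B p, C p) ∈ Metric.ball i (h / 4) := fun p => by
    simpa using hcov (mem_univ (A p, B p, C p))
  choose idx hidx1 hidx2 using hidx
  refine Finite.of_injOn (f := idx) (fun p _ => hidx1 p) ?_ ht
  intro p hp q hq hpq
  have hd : dist (A p, B p, C p) (A q, B q, C q) < h / 2 := by
    have e1 := hidx2 p
    have e2 := hidx2 q
    rw [hpq] at e1
    rw [Metric.mem_ball] at e1 e2
    linarith [dist_triangle_right (A p, B p, C p) (A q, B q, C q) (idx q)]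
  simp only [Prod.dist_eq, max_lt_iff] at hd
  obtain ⟨dA, dB, dC⟩ := hd
  have hdir : ∀ a a', dist p a = h → dist a a' < h / 2 → ¬ Btw a p a' := by
    intro a a' h1 h2 h3
    unfold Btw at h3
    linarith [dist_comm a p, dist_nonneg (x := p) (y := a')]
  have hnear : ∀ a a', dist p a = h → dist a a' < h / 2 → dist p a' ≤ 8 * h := by
    intro a a' h1 h2
    linarith [dist_triangle p a a']
  have hp0 : dist p p ≤ 8 * h := by simp; linarith
  have hmove : ∀ a a' b b', dist p a = h → dist p b = h → dist a a' < h / 2 →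
      dist b b' < h / 2 → Btw a p b → Btw a' p b' := by
    intro a a' b b' ha hb haa hbb hab
    have n1 := hnear a a' ha haa
    have n2 := hnear b b' hb hbb
    have k1 : Btw a' p b := (hT.btw_or_btw hp0 (by linarith) n1 (by linarith) hab).resolve_left
      (hdir a a' ha haa)
    exact ((hT.btw_or_btw hp0 (by linarith) n2 n1 k1.symm).resolve_left
      (hdir b b' hb hbb)).symm
  have kAB := hmove _ _ _ _ (hpA p hp) (hpB p hp) dA dB (hAB p hp)
  have kAC := hmove _ _ _ _ (hpA p hp) (hpC p hp) dA dC (hAC p hp)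
  have kBC := hmove _ _ _ _ (hpB p hp) (hpC p hp) dB dC (hBC p hp)
  have qAB := hAB q hq
  have qAC := hAC q hq
  have qBC := hBC q hq
  have qlen : dist (A q) (B q) ≤ 8 * h := by
    linarith [dist_triangle_left (A q) (B q) q, hpA q hq, hpB q hq]
  -- Both `p` and `q` are medians of the three tips around `q`, and the median is unique.
  refine hT.btw_unique qlen kAB qAB ?_
  unfold Btw at kAB kAC kBC qAB qAC qBC
  linarith [dist_comm p (B q), dist_comm q (B q)]

/-- Two core segments starting in the same direction branch at a vertex. -/
theorem branch (hT : TreeScale X h) {q a z : X} (hq : q ∈ core X) (ha : a ∈ core X)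
    (hz : z ∈ core X) (hqa : dist q a ≤ 4 * h) (hqz : dist q z ≤ 4 * h) (hb : ¬ Btw a q z) :
    Btw q z a ∨ Btw q a z ∨ ∃ m ∈ kernelVertices X, m ≠ q ∧ Btw q m a ∧ Btw q m z := by
  have h0 := hT.pos
  obtain ⟨m, m1, m2, m3, -⟩ := hT.exists_median (x := q) (y := a) (z := z) (by linarith)
    (by linarith)
  by_cases hmq : m = q
  · subst hmq; exact absurd m3 hb
  by_cases hma : m = a
  · subst hma; exact Or.inr (Or.inl m2)
  by_cases hmz : m = z
  · subst hmz; exact Or.inl m1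
  exact Or.inr (Or.inr ⟨m, hT.mem_kernelVertices hq ha hz (Ne.symm hmq) (Ne.symm hma)
    (Ne.symm hmz) m1 m2 m3, hmq, m1, m2⟩)

/-- The core around an interior point of a segment of the core. -/
theorem local_structure (hT : TreeScale X h) {q a b z : X} (ha : a ∈ core X) (hb : b ∈ core X)
    (hz : z ∈ core X) (haq : a ≠ q) (hbq : b ≠ q) (hqa : dist q a ≤ h) (hqb : dist q b ≤ h)
    (hab : Btw a q b) (hza : dist q z < dist q a) (hzb : dist q z < dist q b) :
    z ∈ seg q a ∪ seg q b ∨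
      ∃ m ∈ kernelVertices X, Btw q m z ∧ m ∈ seg q a ∪ seg q b := by
  have h0 := hT.pos
  have hq : q ∈ core X := hT.seg_subset_core ha hb hab
  by_cases hzq : z = q
  · subst hzq; exact Or.inl (Or.inl (left_mem_seg _ _))
  by_cases h1 : Btw a q z
  · by_cases h2 : Btw b q z
    · exact Or.inr ⟨q, hT.mem_kernelVertices ha hb hz haq hbq hzq hab h1 h2, btw_left _ _,
        Or.inl (left_mem_seg _ _)⟩
    · rcases hT.branch hq hb hz (by linarith) (by linarith) h2 with h3 | h3 | ⟨m, m1, -, m2, m3⟩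
      · exact Or.inl (Or.inr h3)
      · linarith [h3.dist_le_left]
      · exact Or.inr ⟨m, m1, m3, Or.inr m2⟩
  · rcases hT.branch hq ha hz (by linarith) (by linarith) h1 with h3 | h3 | ⟨m, m1, -, m2, m3⟩
    · exact Or.inl (Or.inl h3)
    · linarith [h3.dist_le_left]
    · exact Or.inr ⟨m, m1, m3, Or.inl m2⟩

/-- Any third direction of the core at `q` would make `q` a vertex, and any branching along the two
known segments occurs at a vertex, which is at a positive distance from `q` by finiteness. So `S`
fills the core near `q`. -/
theorem exists_core_ball_subset (hT : TreeScale X h) {S : Set X} (hS : S ⊆ core X) {q : X}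
    (hq : TwoSidedAt h S q) (hqV : q ∉ kernelVertices X) :
    ∃ ε > 0, ∀ z ∈ core X, dist z q < ε → z ∈ S := by
  obtain ⟨a, b, h1, h2, h3, h4, h5, h6, h7⟩ := hq
  have ha := hS (h6 (right_mem_seg _ _))
  have hb := hS (h7 (right_mem_seg _ _))
  obtain ⟨ε, e0, e1⟩ := Metric.isOpen_iff.1 hT.finite_kernelVertices.isClosed.isOpen_compl q hqV
  refine ⟨min ε (min (dist q a) (dist q b)), lt_min e0 (lt_min (dist_pos.2 h1.symm)
    (dist_pos.2 h2.symm)), fun z hz hzq => ?_⟩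
  rw [dist_comm, lt_min_iff, lt_min_iff] at hzq
  obtain ⟨z1, z2, z3⟩ := hzq
  rcases hT.local_structure ha hb hz h1 h2 h3 h4 h5 z2 z3 with (h | h) | ⟨m, m1, m2, -⟩
  · exact h6 h
  · exact h7 h
  · refine absurd m1 (e1 ?_)
    rw [Metric.mem_ball, dist_comm]
    exact m2.dist_le_left.trans_lt z1

/-- Closed subsets of the core that are two-sided off the vertices absorb connected sets. -/
theorem subset_of_isPreconnected (hT : TreeScale X h) {S T : Set X} (hS : S ⊆ core X)
    (hSc : IsClosed S) (hTp : IsPreconnected T) (hTc : T ⊆ core X \ kernelVertices X)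
    (h2 : ∀ q ∈ S, q ∉ kernelVertices X → TwoSidedAt h S q) (hne : (T ∩ S).Nonempty) :
    T ⊆ S := by
  choose! ε ε0 hε using fun q (hq : q ∈ T ∩ S) =>
    hT.exists_core_ball_subset hS (h2 q hq.2 (hTc hq.1).2) (hTc hq.1).2
  intro z hz
  by_contra hzS
  obtain ⟨w, w1, w2, w3⟩ := hTp Sᶜ (⋃ q ∈ T ∩ S, Metric.ball q (ε q)) hSc.isOpen_compl
    (isOpen_biUnion fun q _ => Metric.isOpen_ball)
    (fun x hx => by
      by_cases hxS : x ∈ S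
      · exact Or.inr (mem_biUnion (x := x) ⟨hx, hxS⟩ (Metric.mem_ball_self (ε0 x ⟨hx, hxS⟩)))
      · exact Or.inl hxS) ⟨z, hz, hzS⟩
    (by
      obtain ⟨q, hq⟩ := hne
      exact ⟨q, hq.1, mem_biUnion (x := q) hq (Metric.mem_ball_self (ε0 q hq))⟩)
  obtain ⟨q, hq, hwq⟩ := mem_iUnion₂.1 w3
  exact w2 (hε q hq w (hTc w1).1 hwq)

theorem component_subset (hT : TreeScale X h) {S : Set X} (hS : S ⊆ core X)
    (hSc : IsClosed S) (h2 : ∀ q ∈ S, q ∉ kernelVertices X → TwoSidedAt h S q) {q : X}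
    (hq : q ∈ S) (hqV : q ∉ kernelVertices X) :
    connectedComponentIn (core X \ kernelVertices X) q ⊆ S :=
  hT.subset_of_isPreconnected hS hSc isPreconnected_connectedComponentIn
    (connectedComponentIn_subset _ _) h2 ⟨q, mem_connectedComponentIn ⟨hS hq, hqV⟩, hq⟩

theorem exists_edge_subset (hT : TreeScale X h) {S : Set X} (hS : S ⊆ core X)
    (hSc : IsClosed S) (h2 : ∀ q ∈ S, q ∉ kernelVertices X → TwoSidedAt h S q) {q : X}
    (hq : q ∈ S) (hqV : q ∉ kernelVertices X) : ∃ e ∈ kernelEdges X, e ⊆ S :=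
  ⟨_, ⟨_, ⟨q, ⟨hS hq, hqV⟩, rfl⟩, rfl⟩, closure_minimal (hT.component_subset hS hSc h2 hq hqV) hSc⟩

/-- Every cycle contains an edge of the kernel. -/
theorem exists_edge_subset_cycle (hT : TreeScale X h) {c : Set X} (hc : IsEmbeddedCycle c) :
    ∃ e ∈ kernelEdges X, e ⊆ c := by
  obtain ⟨q, hq, hqV⟩ := hc.infinite.exists_notMem_finite hT.finite_kernelVertices
  exact hT.exists_edge_subset hc.subset_core hc.isCompact.isClosed
    (fun q hq _ => hT.twoSidedAt_cycle hc hq) hq hqV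

/-- A cycle without vertices is the whole core. -/
theorem core_eq_cycle (hT : TreeScale X h) {c : Set X} (hc : IsEmbeddedCycle c)
    (hV : ∀ q ∈ c, q ∉ kernelVertices X) : core X = c := by
  refine Subset.antisymm ?_ hc.subset_core
  choose! ε ε0 hε using fun q (hq : q ∈ c) =>
    hT.exists_core_ball_subset hc.subset_core (hT.twoSidedAt_cycle hc hq) (hV q hq)
  obtain ⟨q, hq⟩ := hc.infinite.nonempty
  intro z hz
  by_contra hzc
  obtain ⟨w, w1, w2, w3⟩ := hT.isPreconnected_core cᶜ (⋃ q ∈ c, Metric.ball q (ε q))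
    hc.isCompact.isClosed.isOpen_compl (isOpen_biUnion fun q _ => Metric.isOpen_ball)
    (fun x hx => by
      by_cases hxc : x ∈ c
      · exact Or.inr (mem_biUnion (x := x) hxc (Metric.mem_ball_self (ε0 x hxc)))
      · exact Or.inl hxc) ⟨z, hz, hzc⟩
    ⟨q, hc.subset_core hq, mem_biUnion (x := q) hq (Metric.mem_ball_self (ε0 q hq))⟩
  obtain ⟨q', hq', hwq⟩ := mem_iUnion₂.1 w3
  exact w2 (hε q' hq' w w1 hwq)

/-- Two close vertices would be joined by a short segment. Up to the first vertex met after `u`,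
this segment has no vertex inside and so contains a whole edge, which is too long for it. -/
theorem lt_dist_of_mem_kernelVertices [MeasurableSpace X] [BorelSpace X] (hT : TreeScale X h)
    {r : ℝ} (hr : 8 * h < r) (hE : ∀ e ∈ kernelEdges X, ENNReal.ofReal r ≤ length e) {u v : X}
    (hu : u ∈ kernelVertices X) (hv : v ∈ kernelVertices X) (hne : u ≠ v) :
    8 * h < dist u v := by
  by_contra! hle
  have h0 := hT.pos
  obtain ⟨w, ⟨⟨hwV, hw⟩, hwu⟩, hmin⟩ := exists_min_image
    ((kernelVertices X ∩ seg u v) \ {u}) (fun w => dist u w)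
    ((hT.finite_kernelVertices.subset inter_subset_left).subset sdiff_subset)
    ⟨v, ⟨hv, right_mem_seg _ _⟩, hne.symm⟩
  have hwu' : u ≠ w := Ne.symm hwu
  have hpos := dist_pos.2 hwu'
  have hlen : dist u w ≤ 8 * h := (Btw.dist_le_left hw).trans hle
  have hV : ∀ q ∈ seg u w, q ∈ kernelVertices X → q = u ∨ q = w := by
    intro q hq hqV
    by_contra! hcon
    have h1 : dist u w ≤ dist u q := hmin q ⟨⟨hqV, Btw.trans_left hw hq⟩, hcon.1⟩
    exact hcon.2 (hT.btw_unique hlen hq (btw_right u w)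
      (le_antisymm (Btw.dist_le_left hq) h1))
  obtain ⟨q, q1, q2⟩ := exists_btw hT.geo u w (s := dist u w / 2) (by linarith) (by linarith)
  have hqV : q ∉ kernelVertices X := by
    intro hqV
    rcases hV q q2 hqV with rfl | rfl
    · rw [dist_self] at q1; linarith
    · linarith
  obtain ⟨e, he, hes⟩ := hT.exists_edge_subset (hT.seg_subset_core hu.1 hwV.1) (isClosed_seg u w)
    (fun q hq hqV => twoSidedAt_seg hT.geo h0 hq (fun h => hqV (h ▸ hu)) (fun h => hqV (h ▸ hwV)))
    q2 hqV
  have := ((hE e he).trans (measure_mono hes)).trans (hT.length_seg_le hlen)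
  rw [ENNReal.ofReal_le_ofReal_iff hpos.le] at this
  linarith

end TreeScale

end Vertices

/-! ### Cycles formed by two simple paths. -/

section Theta

variable {X : Type*} [MetricSpace X]

/-- Two simple paths with the same ends and otherwise disjoint form a cycle. -/
theorem isEmbeddedCycle_union {α β : ℝ → X} {a b a' b' : ℝ} (hab : a < b) (hab' : a' < b')
    (hα : ContinuousOn α (Icc a b)) (hβ : ContinuousOn β (Icc a' b'))
    (hαi : InjOn α (Icc a b)) (hβi : InjOn β (Icc a' b')) (h0 : α a = β a') (h1 : α b = β b')
    (hd : ∀ t ∈ Ioo a b, α t ∉ β '' Icc a' b') :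
    IsEmbeddedCycle (α '' Icc a b ∪ β '' Icc a' b') := by
  let F : ℝ → X := fun t => if t ≤ b then α t else β (b' - (t - b))
  set T := b + (b' - a') with hT
  have F1 : ∀ t, t ≤ b → F t = α t := fun t ht => if_pos ht
  have F2 : ∀ t, b ≤ t → F t = β (b' - (t - b)) := by
    intro t ht
    rcases eq_or_lt_of_le ht with he | hlt
    · rw [F1 t he.ge, ← he, h1, sub_self, sub_zero]
    · exact if_neg (not_le.2 hlt)
  have hin : ∀ t ∈ Icc b T, b' - (t - b) ∈ Icc a' b' := fun t ht =>
    ⟨by linarith [ht.2], by linarith [ht.1]⟩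
  have hunion : Icc a b ∪ Icc b T = Icc a T :=
    Icc_union_Icc_eq_Icc hab.le (by linarith)
  have hFc : ContinuousOn F (Icc a T) := by
    rw [← hunion]
    refine ContinuousOn.union_of_isClosed ?_ ?_ isClosed_Icc isClosed_Icc
    · exact hα.congr fun t ht => F1 t ht.2
    · exact (hβ.comp (by fun_prop) hin).congr fun t ht => F2 t ht.1
  have himg : F '' Icc a T = α '' Icc a b ∪ β '' Icc a' b' := by
    rw [← hunion, image_union]
    congr 1
    · exact image_congr fun t ht => F1 t ht.2
    · rw [image_congr fun t ht => F2 t ht.1]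
      ext x
      constructor
      · rintro ⟨t, ht, rfl⟩
        exact ⟨_, hin t ht, rfl⟩
      · rintro ⟨t, ht, rfl⟩
        refine ⟨b + (b' - t), ⟨by linarith [ht.2], by linarith [ht.1]⟩, ?_⟩
        beta_reduce
        congr 1
        ring
  rw [← himg]
  refine isEmbeddedCycle_image (by linarith) hFc ?_ ?_
  · have key : ∀ s t, a ≤ s → s < t → t < T → F s ≠ F t := by
      intro s t hs hst ht he
      rcases le_total t b with htb | htb
      · rw [F1 s (hst.le.trans htb), F1 t htb] at he
        exact hst.ne (hαi ⟨hs, hst.le.trans htb⟩ ⟨hs.trans hst.le, htb⟩ he)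
      · rcases le_or_gt b s with hsb | hsb
        · rw [F2 s hsb, F2 t htb] at he
          have := hβi (hin s ⟨hsb, by linarith⟩) (hin t ⟨htb, ht.le⟩) he
          linarith
        · rw [F1 s hsb.le, F2 t htb] at he
          rcases eq_or_lt_of_le hs with hs' | hs'
          · rw [← hs', h0] at he
            have := hβi ⟨le_rfl, hab'.le⟩ (hin t ⟨htb, ht.le⟩) he
            linarith
          · exact hd s ⟨hs', hsb⟩ ⟨_, hin t ⟨htb, ht.le⟩, he.symm⟩
    intro s hs t ht he
    by_contra hne
    rcases lt_or_gt_of_ne hne with hlt | hlt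
    · exact key s t hs.1 hlt ht.2 he
    · exact key t s ht.1 hlt hs.2 he.symm
  · rw [F1 a hab.le, F2 T (by linarith), h0]
    congr 1
    rw [hT]; ring

/-- A simple path leaving another one and coming back to it creates a cycle. -/
theorem exists_cycle_of_paths {α β : ℝ → X} {a b a' b' t : ℝ}
    (hα : ContinuousOn α (Icc a b)) (hβ : ContinuousOn β (Icc a' b'))
    (hαi : InjOn α (Icc a b)) (hβi : InjOn β (Icc a' b')) (h0 : α a ∈ β '' Icc a' b')
    (h1 : α b ∈ β '' Icc a' b') (ht : t ∈ Icc a b) (htβ : α t ∉ β '' Icc a' b') :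
    ∃ c, IsEmbeddedCycle c ∧ c ⊆ α '' Icc a b ∪ β '' Icc a' b' := by
  have hK : IsCompact (β '' Icc a' b') := isCompact_Icc.image_of_continuousOn hβ
  have hcl : IsClosed (Icc a b ∩ α ⁻¹' (β '' Icc a' b')) :=
    hα.preimage_isClosed_of_isClosed isClosed_Icc hK.isClosed
  have hab : a ≤ b := ht.1.trans ht.2
  -- The last time before `t` and the first time after `t` at which `α` is on `β`; in between the
  -- two paths are disjoint.
  obtain ⟨s, ⟨⟨hs, hsβ⟩, hst⟩, hsmax⟩ := ((isCompact_Icc.of_isClosed_subset hcl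
    inter_subset_left).inter_right (isClosed_Iic (a := t))).exists_isGreatest
    ⟨a, ⟨⟨le_rfl, hab⟩, h0⟩, ht.1⟩
  obtain ⟨u, ⟨⟨hu, huβ⟩, htu⟩, humin⟩ := ((isCompact_Icc.of_isClosed_subset hcl
    inter_subset_left).inter_right (isClosed_Ici (a := t))).exists_isLeast
    ⟨b, ⟨⟨hab, le_rfl⟩, h1⟩, ht.2⟩
  have hst' : s < t := lt_of_le_of_ne hst fun h => htβ (h ▸ hsβ)
  have htu' : t < u := lt_of_le_of_ne htu fun h => htβ (h.symm ▸ huβ)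
  obtain ⟨s', hs', hss⟩ := hsβ
  obtain ⟨u', hu', huu⟩ := huβ
  have hsub : Icc s u ⊆ Icc a b := Icc_subset_Icc hs.1 hu.2
  have hd : ∀ x ∈ Ioo s u, α x ∉ β '' Icc a' b' := by
    intro x hx hxβ
    have hxab := hsub (Ioo_subset_Icc_self hx)
    rcases le_total x t with h | h
    · have : x ≤ s := hsmax ⟨⟨hxab, hxβ⟩, h⟩
      linarith [hx.1]
    · have : u ≤ x := humin ⟨⟨hxab, hxβ⟩, h⟩
      linarith [hx.2]
  have hne : s' ≠ u' := by
    rintro rfl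
    have := hαi hs hu (hss.symm.trans huu)
    linarith
  rcases lt_or_gt_of_ne hne with hlt | hlt
  · have hsub' : Icc s' u' ⊆ Icc a' b' := Icc_subset_Icc hs'.1 hu'.2
    refine ⟨_, isEmbeddedCycle_union (hst'.trans htu') hlt (hα.mono hsub) (hβ.mono hsub')
      (hαi.mono hsub) (hβi.mono hsub') hss.symm huu.symm
      fun x hx hxβ => hd x hx (image_mono hsub' hxβ), ?_⟩
    exact union_subset_union (image_mono hsub) (image_mono hsub')
  · have hsub' : Icc u' s' ⊆ Icc a' b' := Icc_subset_Icc hu'.1 hs'.2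
    have hmaps : MapsTo (fun x : ℝ => -x) (Icc (-s') (-u')) (Icc u' s') := fun x hx =>
      ⟨by linarith [hx.2], by linarith [hx.1]⟩
    have himg : (fun x => β (-x)) '' Icc (-s') (-u') ⊆ β '' Icc u' s' := by
      rintro _ ⟨x, hx, rfl⟩
      exact ⟨_, hmaps hx, rfl⟩
    refine ⟨_, isEmbeddedCycle_union (β := fun x => β (-x)) (hst'.trans htu')
      (neg_lt_neg hlt) (hα.mono hsub)
      ((hβ.mono hsub').comp (by fun_prop) hmaps) (hαi.mono hsub)
      ?_ (by simpa using hss.symm) (by simpa using huu.symm)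
      fun x hx hxβ => hd x hx (image_mono hsub' (himg hxβ)), ?_⟩
    · intro x hx y hy hxy
      have := hβi (hsub' (hmaps hx)) (hsub' (hmaps hy)) hxy
      linarith
    · exact union_subset_union (image_mono hsub) (himg.trans (image_mono hsub'))

end Theta

/-! ### From a lower bound on the lengths of cycles to the four-point condition. -/

section FourPoint

variable {X : Type*} [MetricSpace X]

/-- A map is isometric on an interval. -/
def IsoOn (g : ℝ → X) (l : ℝ) : Prop :=
  ∀ s ∈ Icc 0 l, ∀ t ∈ Icc 0 l, dist (g s) (g t) = |s - t|

theorem IsoOn.lipschitzOnWith {g : ℝ → X} {l : ℝ} (hg : IsoOn g l) :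
    LipschitzOnWith 1 g (Icc 0 l) := by
  apply LipschitzOnWith.of_dist_le_mul
  intro s hs t ht
  rw [hg s hs t ht, Real.dist_eq]
  simp

theorem IsoOn.injOn {g : ℝ → X} {l : ℝ} (hg : IsoOn g l) : InjOn g (Icc 0 l) := by
  intro s hs t ht hst
  have := hg s hs t ht
  rw [hst, dist_self] at this
  linarith [abs_eq_zero.1 this.symm]

theorem length_image_le [MeasurableSpace X] [BorelSpace X] {g : ℝ → X} {a b : ℝ}
    (hg : LipschitzOnWith 1 g (Icc a b)) : length (g '' Icc a b) ≤ ENNReal.ofReal (b - a) := by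
  have := hg.hausdorffMeasure_image_le (d := 1) zero_le_one
  simpa [length, hausdorffMeasure_real] using this

variable [MeasurableSpace X] [BorelSpace X]

/-- Without short cycles, two short geodesics from the same point agree up to the Gromov product
of their ends. -/
theorem eq_of_le_gromov {r : ℝ} (hX : IsGeodesicSpace X)
    (hc : ∀ c : Set X, IsEmbeddedCycle c → ENNReal.ofReal r ≤ length c) {w x y : X}
    (hr : dist w x + dist w y + dist x y < r) {g k : ℝ → X} (hg : IsoOn g (dist w x))
    (hk : IsoOn k (dist w y)) (g0 : g 0 = w) (k0 : k 0 = w) (g1 : g (dist w x) = x)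
    (k1 : k (dist w y) = y) {t : ℝ} (ht0 : 0 ≤ t)
    (ht : 2 * t ≤ dist w x + dist w y - dist x y) : g t = k t := by
  have nx := dist_nonneg (x := w) (y := x)
  have ny := dist_nonneg (x := w) (y := y)
  have nxy := dist_nonneg (x := x) (y := y)
  have gd : ∀ s ∈ Icc 0 (dist w x), dist w (g s) = s := by
    intro s hs
    have := hg 0 ⟨le_rfl, nx⟩ s hs
    rwa [g0, zero_sub, abs_neg, abs_of_nonneg hs.1] at this
  have kd : ∀ s ∈ Icc 0 (dist w y), dist w (k s) = s := by
    intro s hs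
    have := hk 0 ⟨le_rfl, ny⟩ s hs
    rwa [k0, zero_sub, abs_neg, abs_of_nonneg hs.1] at this
  have hpar : ∀ s ∈ Icc 0 (dist w x), ∀ s' ∈ Icc 0 (dist w y), g s = k s' → s = s' := by
    intro s hs s' hs' he
    rw [← gd s hs, ← kd s' hs', he]
  have hmeas : ∀ (α β : ℝ → X) (a b a' b' : ℝ), LipschitzOnWith 1 α (Icc a b) →
      LipschitzOnWith 1 β (Icc a' b') → a ≤ b → a' ≤ b' → b - a + (b' - a') < r →
      ∀ c, IsEmbeddedCycle c → ¬ c ⊆ α '' Icc a b ∪ β '' Icc a' b' := by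
    intro α β a b a' b' hα hβ hab hab' hlt c hcyc hsub
    have h1 := (hc c hcyc).trans ((measure_mono hsub).trans ((measure_union_le _ _).trans
      (add_le_add (length_image_le hα) (length_image_le hβ))))
    rw [← ENNReal.ofReal_add (by linarith) (by linarith),
      ENNReal.ofReal_le_ofReal_iff (by linarith)] at h1
    linarith
  set l := min (dist w x) (dist w y) with hl
  have l0 : 0 ≤ l := le_min nx ny
  have lx : l ≤ dist w x := min_le_left _ _
  have ly : l ≤ dist w y := min_le_right _ _
  have sx : Icc 0 l ⊆ Icc 0 (dist w x) := Icc_subset_Icc_right lx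
  have sy : Icc 0 l ⊆ Icc 0 (dist w y) := Icc_subset_Icc_right ly
  -- Equal points have equal parameters, namely their distance to `w`. So a disagreement before a
  -- common point would make `g` leave `k` and come back, creating a cycle that is too short.
  have hdown : ∀ s ∈ Icc 0 l, g s = k s → ∀ u ∈ Icc 0 s, g u = k u := by
    intro s hs he u hu
    by_contra hne
    have s1 : Icc 0 s ⊆ Icc 0 (dist w x) := Icc_subset_Icc_right (hs.2.trans lx)
    have s2 : Icc 0 s ⊆ Icc 0 (dist w y) := Icc_subset_Icc_right (hs.2.trans ly)
    have L1 := hg.lipschitzOnWith.mono s1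
    have L2 := hk.lipschitzOnWith.mono s2
    obtain ⟨c, c1, c2⟩ := exists_cycle_of_paths (α := g) (β := k) (t := u) L1.continuousOn
      L2.continuousOn (hg.injOn.mono s1) (hk.injOn.mono s2)
      ⟨0, ⟨le_rfl, hs.1⟩, by rw [g0, k0]⟩ ⟨s, ⟨hs.1, le_rfl⟩, he.symm⟩ hu (by
        rintro ⟨u', hu', he'⟩
        have := hpar u (s1 hu) u' (s2 hu') he'.symm
        subst this
        exact hne he'.symm)
    exact hmeas _ _ _ _ _ _ L1 L2 hs.1 hs.1 (by linarith [hs.2]) c c1 c2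
  have hcl : IsCompact (Icc 0 l ∩ {s | g s = k s}) := by
    have h1 : ContinuousOn (fun s => (g s, k s)) (Icc 0 l) :=
      (hg.lipschitzOnWith.mono sx).continuousOn.prodMk (hk.lipschitzOnWith.mono sy).continuousOn
    exact isCompact_Icc.of_isClosed_subset
      (h1.preimage_isClosed_of_isClosed isClosed_Icc isClosed_diagonal) inter_subset_left
  obtain ⟨τ, ⟨hτ, hτe⟩, hmax⟩ := hcl.exists_isGreatest ⟨0, ⟨le_rfl, l0⟩, by
    rw [mem_ofPred_eq, g0, k0]⟩
  have hτe : g τ = k τ := hτe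
  have hτx := sx hτ
  have hτy := sy hτ
  have d1 : dist (g τ) x = dist w x - τ := by
    have := hg τ hτx _ ⟨nx, le_rfl⟩
    rwa [g1, abs_sub_comm, abs_of_nonneg (by linarith [hτx.2])] at this
  have d2 : dist (g τ) y = dist w y - τ := by
    have := hk τ hτy _ ⟨ny, le_rfl⟩
    rwa [k1, ← hτe, abs_sub_comm, abs_of_nonneg (by linarith [hτy.2])] at this
  suffices hfin : dist w x - τ + (dist w y - τ) ≤ dist x y from
    hdown τ hτ hτe t ⟨ht0, by linarith⟩
  rcases eq_or_lt_of_le hτx.2 with ex | ex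
  · rw [ex, g1] at d2
    linarith
  rcases eq_or_lt_of_le hτy.2 with ey | ey
  · rw [hτe, ey, k1, dist_comm] at d1
    linarith
  obtain ⟨σ, σ0, σ1, hσ⟩ := hX x y
  change IsoOn σ (dist x y) at hσ
  -- After the last common time `τ` the two geodesics are disjoint, so their tails form a simple
  -- path from `x` to `y` through `g τ`.
  let β : ℝ → X := fun t => if t ≤ 0 then g (τ - t) else k (τ + t)
  have β1 : ∀ t, t ≤ 0 → β t = g (τ - t) := fun t ht => if_pos ht
  have β2 : ∀ t, 0 ≤ t → β t = k (τ + t) := by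
    intro t ht
    rcases eq_or_lt_of_le ht with he | hlt
    · rw [β1 t he.ge, ← he, sub_zero, add_zero, hτe]
    · exact if_neg (not_le.2 hlt)
  set p := -(dist w x - τ) with hp
  set q := dist w y - τ with hq
  have in1 : ∀ t, p ≤ t → t ≤ 0 → τ - t ∈ Icc 0 (dist w x) := fun t h1 h2 =>
    ⟨by linarith [hτ.1], by linarith⟩
  have in2 : ∀ t, 0 ≤ t → t ≤ q → τ + t ∈ Icc 0 (dist w y) := fun t h1 h2 =>
    ⟨by linarith [hτ.1], by linarith⟩
  have hβL : LipschitzOnWith 1 β (Icc p q) := by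
    have key : ∀ s t, p ≤ s → s ≤ t → t ≤ q → dist (β s) (β t) ≤ t - s := by
      intro s t h1 h2 h3
      rcases le_total t 0 with h4 | h4
      · rw [β1 s (h2.trans h4), β1 t h4, hg _ (in1 s h1 (h2.trans h4)) _
          (in1 t (h1.trans h2) h4), abs_of_nonneg (by linarith)]
        linarith
      rcases le_total 0 s with h5 | h5
      · rw [β2 s h5, β2 t h4, hk _ (in2 s h5 (h2.trans h3)) _ (in2 t h4 h3), abs_sub_comm,
          abs_of_nonneg (by linarith)]
        linarith
      · rw [β1 s h5, β2 t h4]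
        have e1 := hg _ (in1 s h1 h5) τ hτx
        have e2 := hk τ hτy _ (in2 t h4 h3)
        rw [abs_of_nonneg (by linarith)] at e1
        rw [abs_sub_comm, abs_of_nonneg (by linarith), ← hτe] at e2
        linarith [dist_triangle (g (τ - s)) (g τ) (k (τ + t))]
    apply LipschitzOnWith.of_dist_le_mul
    intro s hs t ht
    rw [NNReal.coe_one, one_mul, Real.dist_eq]
    rcases le_total s t with h | h
    · rw [abs_sub_comm, abs_of_nonneg (by linarith)]
      exact key s t hs.1 h ht.2
    · rw [abs_of_nonneg (by linarith), dist_comm]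
      exact key t s ht.1 h hs.2
  have hβi : InjOn β (Icc p q) := by
    have key : ∀ s t, p ≤ s → s < t → t ≤ q → β s ≠ β t := by
      intro s t h1 h2 h3 he
      rcases le_total t 0 with h4 | h4
      · rw [β1 s (h2.le.trans h4), β1 t h4] at he
        have := hg.injOn (in1 s h1 (h2.le.trans h4)) (in1 t (h1.trans h2.le) h4) he
        linarith
      rcases le_total 0 s with h5 | h5
      · rw [β2 s h5, β2 t h4] at he
        have := hk.injOn (in2 s h5 (h2.le.trans h3)) (in2 t h4 h3) he
        linarith
      · rw [β1 s h5, β2 t h4] at he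
        have e1 := hpar _ (in1 s h1 h5) _ (in2 t h4 h3) he
        have m1 := (in1 s h1 h5).2
        have m2 := (in2 t h4 h3).2
        have : τ - s ≤ τ := hmax ⟨⟨(in1 s h1 h5).1, le_min m1 (by linarith)⟩, by
          rw [mem_ofPred_eq, he, e1]⟩
        have : τ + t ≤ τ := by linarith
        linarith
    intro s hs t ht he
    by_contra hne
    rcases lt_or_gt_of_ne hne with hlt | hlt
    · exact key s t hs.1 hlt ht.2 he
    · exact key t s ht.1 hlt hs.2 he.symm
  -- If the geodesic from `x` to `y` missed `g τ`, it would form a short cycle with `β`. Hence `g τ`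
  -- lies between `x` and `y`, which means that `τ` is at least the Gromov product.
  have hmem : β 0 ∈ σ '' Icc 0 (dist x y) := by
    by_contra hcon
    obtain ⟨c, c1, c2⟩ := exists_cycle_of_paths (α := β) (β := σ) (t := 0) hβL.continuousOn
      hσ.lipschitzOnWith.continuousOn hβi hσ.injOn
      ⟨0, ⟨le_rfl, nxy⟩, by
        rw [β1 p (by linarith), σ0, show τ - p = dist w x by rw [hp]; ring, g1]⟩
      ⟨dist x y, ⟨nxy, le_rfl⟩, by
        rw [β2 q (by linarith), σ1, show τ + q = dist w y by rw [hq]; ring, k1]⟩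
      ⟨by linarith, by linarith⟩ hcon
    exact hmeas _ _ _ _ _ _ hβL hσ.lipschitzOnWith (by linarith) nxy
      (by linarith [hτ.1]) c c1 c2
  obtain ⟨s, hs, hse⟩ := hmem
  rw [β1 0 le_rfl, sub_zero] at hse
  have e1 := hσ 0 ⟨le_rfl, nxy⟩ s hs
  have e2 := hσ s hs _ ⟨nxy, le_rfl⟩
  rw [σ0, hse, zero_sub, abs_neg, abs_of_nonneg hs.1, dist_comm, d1] at e1
  rw [σ1, hse, abs_sub_comm, abs_of_nonneg (by linarith [hs.2]), d2] at e2
  linarith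

/-- The geodesics from `w` to `y` and to `z` follow the one to `x` up to the Gromov products `a` and
`b`. They agree with each other up to `min a b`, which bounds `dist y z`; the two alternatives are
the two values of the minimum. -/
theorem four_point_of_length_cycle {r : ℝ} (hX : IsGeodesicSpace X)
    (hc : ∀ c : Set X, IsEmbeddedCycle c → ENNReal.ofReal r ≤ length c) {w x y z : X}
    (hxy : dist w x + dist w y + dist x y < r) (hxz : dist w x + dist w z + dist x z < r) :
    dist w x + dist y z ≤ dist w y + dist x z ∨ dist w x + dist y z ≤ dist w z + dist x y := by
  obtain ⟨f, f0, f1, hf⟩ := hX w x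
  obtain ⟨g, g0, g1, hg⟩ := hX w y
  obtain ⟨k, k0, k1, hk⟩ := hX w z
  set a := (dist w x + dist w y - dist x y) / 2 with ha
  set b := (dist w x + dist w z - dist x z) / 2 with hb
  have a0 : 0 ≤ a := by linarith [dist_triangle_left x y w]
  have b0 : 0 ≤ b := by linarith [dist_triangle_left x z w]
  have a1 : a ≤ dist w y := by linarith [dist_triangle w y x, dist_comm x y]
  have b1 : b ≤ dist w z := by linarith [dist_triangle w z x, dist_comm x z]
  set t := min a b with ht
  have t0 : 0 ≤ t := le_min a0 b0
  have ta : t ≤ a := min_le_left _ _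
  have tb : t ≤ b := min_le_right _ _
  have e1 := eq_of_le_gromov hX hc hxy hf hg f0 g0 f1 g1 t0 (by linarith)
  have e2 := eq_of_le_gromov hX hc hxz hf hk f0 k0 f1 k1 t0 (by linarith)
  have d1 := hg t ⟨t0, by linarith⟩ _ ⟨dist_nonneg, le_rfl⟩
  have d2 := hk t ⟨t0, by linarith⟩ _ ⟨dist_nonneg, le_rfl⟩
  rw [g1, abs_sub_comm, abs_of_nonneg (by linarith), ← e1, dist_comm] at d1
  rw [k1, abs_sub_comm, abs_of_nonneg (by linarith), ← e2] at d2
  have := dist_triangle y (f t) z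
  rcases min_choice a b with h | h
  · right; rw [← ht] at h; linarith
  · left; rw [← ht] at h; linarith

/-- Points in a ball of radius `8 * h` are at distance at most `16 * h`, so the triangles involved
have perimeter at most `48 * h`. -/
theorem treeScale_of_length_cycle {r h : ℝ} (h0 : 0 < h) (hr : 48 * h < r)
    (hX : IsGeodesicSpace X)
    (hc : ∀ c : Set X, IsEmbeddedCycle c → ENNReal.ofReal r ≤ length c) : TreeScale X h := by
  refine ⟨h0, hX, fun p w x y z hw hx hy hz => four_point_of_length_cycle hX hc ?_ ?_⟩
  · linarith [dist_triangle_left w x p, dist_triangle_left w y p, dist_triangle_left x y p]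
  · linarith [dist_triangle_left w x p, dist_triangle_left w z p, dist_triangle_left x z p]

end FourPoint

/-! ### Uniform tree scale of graphs with long edges. -/

section Graphs

variable {X : Type*} [MetricSpace X]

theorem IsRTree.four_point (hX : IsRTree X) (w x y z : X) :
    dist w x + dist y z ≤ dist w y + dist x z ∨ dist w x + dist y z ≤ dist w z + dist x y := by
  borelize X
  set R := dist w x + dist w y + dist x y + (dist w x + dist w z + dist x z) + 1
  have := dist_nonneg (x := w) (y := x)
  have := dist_nonneg (x := w) (y := y)
  have := dist_nonneg (x := x) (y := y)
  have := dist_nonneg (x := w) (y := z)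
  have := dist_nonneg (x := x) (y := z)
  exact four_point_of_length_cycle (r := R) hX.1 (fun c hc => absurd hc (hX.2 c))
    (by linarith) (by linarith)

/-- The Lebesgue number of the cover by tree balls gives a scale, but one depending on the space. It
serves only to start the theory and reach `IsRGraph.treeScale`. -/
theorem IsRGraph.exists_treeScale (hX : IsRGraph X) : ∃ h, TreeScale X h := by
  obtain ⟨hcomp, hgeo, hloc⟩ := hX
  choose ε ε0 hε using hloc
  obtain ⟨δ, δ0, hδ⟩ := lebesgue_number_lemma_of_metric (isCompact_univ (X := X))
    (c := fun x => Metric.ball x (ε x)) (fun x => Metric.isOpen_ball)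
    (fun x _ => mem_iUnion.2 ⟨x, Metric.mem_ball_self (ε0 x)⟩)
  refine ⟨δ / 16, by linarith, hgeo, fun p w x y z hw hx hy hz => ?_⟩
  obtain ⟨i, hi⟩ := hδ p (mem_univ p)
  have hmem : ∀ a, dist p a ≤ 8 * (δ / 16) → a ∈ Metric.ball i (ε i) := by
    intro a ha
    apply hi
    rw [Metric.mem_ball, dist_comm]
    linarith
  exact (hε i).four_point ⟨w, hmem w hw⟩ ⟨x, hmem x hx⟩ ⟨y, hmem y hy⟩ ⟨z, hmem z hz⟩

/-- Graphs whose kernel has no short edge are trees at a scale that depends only on the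
lower bound on the lengths of the edges. -/
theorem IsRGraph.treeScale [MeasurableSpace X] [BorelSpace X] (hX : IsRGraph X) {r h : ℝ}
    (h0 : 0 < h) (hr : 48 * h < r) (hE : ∀ e ∈ kernelEdges X, ENNReal.ofReal r ≤ length e) :
    TreeScale X h := by
  -- The uncontrolled scale `h'` is enough to find an edge inside every cycle. Cycles then have
  -- length at least `r`, and this yields the controlled scale `h`.
  obtain ⟨h', hT⟩ := hX.exists_treeScale
  have := hX.1
  refine treeScale_of_length_cycle h0 hr hX.2.1 fun c hc => ?_
  obtain ⟨e, he, hec⟩ := hT.exists_edge_subset_cycle hc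
  exact (hE e he).trans (measure_mono hec)

end Graphs

/-! ### Arc-length parametrization of edges and the handshake inequality. -/

section Edges

variable {X : Type*} [MetricSpace X] {h : ℝ}

theorem LocGeod.lipschitzWith {f : ℝ → X} (hf : LocGeod h f) (h0 : 0 < h) :
    ∀ s t, dist (f s) (f t) ≤ |s - t| := by
  have key : ∀ n : ℕ, ∀ s t, s ≤ t → t - s ≤ n * h → dist (f s) (f t) ≤ t - s := by
    intro n
    induction n with
    | zero =>
      intro s t h1 h2
      have : s = t := by
        simp at h2
        linarith
      simp [this]
    | succ n ih =>
      intro s t h1 h2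
      push_cast at h2
      rcases le_total (t - s) h with h3 | h3
      · exact (hf.dist_eq h1 h3).le
      · have e1 := ih s (t - h) (by linarith) (by linarith)
        have e2 := hf.dist_eq (s := t - h) (t := t) (by linarith) (by linarith)
        linarith [dist_triangle (f s) (f (t - h)) (f t)]
  have key' : ∀ s t, s ≤ t → dist (f s) (f t) ≤ t - s := by
    intro s t hst
    obtain ⟨n, hn⟩ := exists_nat_ge ((t - s) / h)
    exact key n s t hst ((div_le_iff₀ h0).1 hn)
  intro s t
  rcases le_total s t with hst | hst
  · rw [abs_sub_comm, abs_of_nonneg (by linarith)]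
    exact key' s t hst
  · rw [abs_of_nonneg (by linarith), dist_comm]
    exact key' t s hst

theorem LocGeod.length_image_Icc_le [MeasurableSpace X] [BorelSpace X] {f : ℝ → X}
    (hf : LocGeod h f) (h0 : 0 < h) (a b : ℝ) :
    length (f '' Icc a b) ≤ ENNReal.ofReal (b - a) := by
  apply length_image_le
  apply LipschitzOnWith.of_dist_le_mul
  intro s _ t _
  rw [NNReal.coe_one, one_mul, Real.dist_eq]
  exact hf.lipschitzWith h0 s t

/-- On a piece of length at most `h`, the distance to the initial point is 1-Lipschitz and reaches
every value in the interval. Longer pieces are cut, and injectivity makes their measures add up. The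
interval is open because the ends of a loop coincide. -/
theorem LocGeod.le_length_image_Ioo [MeasurableSpace X] [BorelSpace X] {f : ℝ → X}
    (hf : LocGeod h f) (h0 : 0 < h) {a b : ℝ} (hi : InjOn f (Ioo a b)) :
    ENNReal.ofReal (b - a) ≤ length (f '' Ioo a b) := by
  have hshort : ∀ a b, a ≤ b → b - a ≤ h → ENNReal.ofReal (b - a) ≤ length (f '' Ioo a b) := by
    intro a b hab hle
    have hL : LipschitzOnWith 1 (fun z => dist (f a) z) (f '' Ioo a b) :=
      (LipschitzWith.dist_right (f a)).lipschitzOnWith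
    have h1 := hL.hausdorffMeasure_image_le (d := 1) zero_le_one
    have h2 : Ioo 0 (b - a) ⊆ (fun z => dist (f a) z) '' (f '' Ioo a b) := by
      intro t ht
      refine ⟨f (a + t), ⟨a + t, ⟨by linarith [ht.1], by linarith [ht.2]⟩, rfl⟩, ?_⟩
      change dist (f a) (f (a + t)) = t
      rw [hf.dist_eq (by linarith [ht.1]) (by linarith [ht.2])]
      ring
    have h3 := (measure_mono (μ := Measure.hausdorffMeasure 1) h2).trans h1
    simpa [length, hausdorffMeasure_real] using h3
  have key : ∀ n : ℕ, ∀ a b, b - a ≤ n * h → InjOn f (Ioo a b) →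
      ENNReal.ofReal (b - a) ≤ length (f '' Ioo a b) := by
    intro n
    induction n with
    | zero =>
      intro a b h1 _
      rw [ENNReal.ofReal_of_nonpos (by simpa using h1)]
      exact zero_le
    | succ n ih =>
      intro a b h1 hi
      push_cast at h1
      rcases le_total b a with hba | hab
      · rw [ENNReal.ofReal_of_nonpos (by linarith)]
        exact zero_le
      rcases le_total (b - a) h with h3 | h3
      · exact hshort a b hab h3
      have s1 : Ioo a (b - h) ⊆ Ioo a b := Ioo_subset_Ioo_right (by linarith)
      have s2 : Ioo (b - h) b ⊆ Ioo a b := Ioo_subset_Ioo_left (by linarith)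
      have e1 := ih a (b - h) (by linarith) (hi.mono s1)
      have e2 := hshort (b - h) b (by linarith) (by linarith)
      have hd : Disjoint (f '' Ioo a (b - h)) (f '' Ioo (b - h) b) := by
        rw [disjoint_left]
        rintro _ ⟨s, hs, rfl⟩ ⟨t, ht, he⟩
        have := hi (s2 ht) (s1 hs) he
        linarith [hs.2, ht.1]
      have hm : MeasurableSet (f '' Ioo (b - h) b) :=
        measurableSet_Ioo.image_of_continuousOn_injOn (hf.continuous h0).continuousOn (hi.mono s2)
      calc ENNReal.ofReal (b - a) = ENNReal.ofReal (b - h - a) + ENNReal.ofReal (b - (b - h)) := by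
            rw [← ENNReal.ofReal_add (by linarith) (by linarith)]
            congr 1; ring
        _ ≤ length (f '' Ioo a (b - h)) + length (f '' Ioo (b - h) b) := add_le_add e1 e2
        _ = length (f '' Ioo a (b - h) ∪ f '' Ioo (b - h) b) := (measure_union hd hm).symm
        _ ≤ length (f '' Ioo a b) :=
            measure_mono (union_subset (image_mono s1) (image_mono s2))
  obtain ⟨n, hn⟩ := exists_nat_ge ((b - a) / h)
  exact key n a b ((div_le_iff₀ h0).1 hn) hi

theorem TreeScale.twoSidedAt_locGeod (hT : TreeScale X h) {f : ℝ → X} (hf : LocGeod h f)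
    {a b t : ℝ} (ht : t ∈ Ioo a b) : TwoSidedAt h (f '' Icc a b) (f t) := by
  have h0 := hT.pos
  set τ := min (h / 2) (min (t - a) (b - t)) with hτ
  have τ1 : τ ≤ h / 2 := min_le_left _ _
  have τ2 : τ ≤ t - a := (min_le_right _ _).trans (min_le_left _ _)
  have τ3 : τ ≤ b - t := (min_le_right _ _).trans (min_le_right _ _)
  have τ0 : 0 < τ := lt_min (by linarith) (lt_min (by linarith [ht.1]) (by linarith [ht.2]))
  have d1 := hf.dist_eq (s := t - τ) (t := t) (by linarith) (by linarith)
  have d2 := hf.dist_eq (s := t) (t := t + τ) (by linarith) (by linarith)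
  refine ⟨f (t - τ), f (t + τ), ?_, ?_, ?_, ?_, hf.btw (by linarith) (by linarith)
    (by linarith), ?_, ?_⟩
  · rw [← dist_pos, d1]; linarith
  · rw [← dist_pos, dist_comm, d2]; linarith
  · rw [dist_comm, d1]; linarith
  · rw [d2]; linarith
  · rw [seg_comm, hT.seg_eq_image_locGeod hf (by linarith) (by linarith)]
    exact image_mono (Icc_subset_Icc (by linarith) (by linarith))
  · rw [hT.seg_eq_image_locGeod hf (by linarith) (by linarith)]
    exact image_mono (Icc_subset_Icc (by linarith) (by linarith))

/-- The map `f` parametrizes the edge `e` by arc length on `[0, L]`. -/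
structure EdgeParam (h : ℝ) (e : Set X) (f : ℝ → X) (L : ℝ) : Prop where
  pos : 0 < L
  geod : LocGeod h f
  image : f '' Icc 0 L = e
  injOn : InjOn f (Ioo 0 L)
  avoid : ∀ t ∈ Ioo 0 L, f t ∉ kernelVertices X
  -- The second alternative is a core reduced to a cycle, parametrized from an arbitrary base point.
  ends : (f 0 ∈ kernelVertices X ∧ f L ∈ kernelVertices X) ∨
    (kernelVertices X = ∅ ∧ f 0 = f L ∧ InjOn f (Ico 0 L))

namespace TreeScale

variable [CompactSpace X]

/-- A component stays connected when one of its limit points is added. If that point is not a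
vertex, it was already in the component, so it may serve as its representative. -/
theorem edge_eq_closure (hT : TreeScale X h) {e : Set X} (he : e ∈ kernelEdges X) {q : X}
    (hq : q ∈ e) (hqV : q ∉ kernelVertices X) :
    q ∈ core X ∧ e = closure (connectedComponentIn (core X \ kernelVertices X) q) := by
  obtain ⟨_, ⟨p, hp, rfl⟩, rfl⟩ := he
  set D := connectedComponentIn (core X \ kernelVertices X) p with hD
  have hDc : D ⊆ core X \ kernelVertices X := connectedComponentIn_subset _ _
  have hqc : q ∈ core X := closure_minimal (hDc.trans sdiff_subset) hT.isClosed_core hq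
  refine ⟨hqc, ?_⟩
  have h1 : IsPreconnected (insert q D) :=
    isPreconnected_connectedComponentIn.subset_closure (subset_insert _ _)
      (insert_subset hq subset_closure)
  have h2 : insert q D ⊆ D := h1.subset_connectedComponentIn
    (mem_insert_of_mem _ (mem_connectedComponentIn hp)) (insert_subset ⟨hqc, hqV⟩ hDc)
  rw [hD, connectedComponentIn_eq (h2 (mem_insert _ _))]

/-- A return without meeting a vertex closes up a cycle without vertices, which is then the whole
core. -/
theorem kernelVertices_empty_of_return (hT : TreeScale X h) {f : ℝ → X} (hf : LocGeod h f)
    {a b : ℝ} (hne : ¬ InjOn f (Icc a b)) (hV : ∀ t ∈ Icc a b, f t ∉ kernelVertices X) :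
    kernelVertices X = ∅ := by
  have h0 := hT.pos
  obtain ⟨s, t, h1, h2, h3, h4, h5⟩ := hf.exists_first_return h0 hne
  have hc := hf.isEmbeddedCycle h0 h2 h4 (h5.mono (Ico_subset_Ico_left h1))
  have hVc : ∀ q ∈ f '' Icc s t, q ∉ kernelVertices X := by
    rintro _ ⟨u, hu, rfl⟩
    exact hV u ⟨h1.trans hu.1, hu.2.trans h3⟩
  have := hT.core_eq_cycle hc hVc
  rw [eq_empty_iff_forall_notMem]
  intro v hv
  exact hVc v (this ▸ hv.1) hv

theorem exists_hit (hT : TreeScale X h) (hV : (kernelVertices X).Nonempty) {f : ℝ → X}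
    (hf : LocGeod h f) (hf0 : f 0 ∉ kernelVertices X) :
    ∃ b, 0 < b ∧ f b ∈ kernelVertices X ∧ ∀ t, 0 ≤ t → t < b → f t ∉ kernelVertices X := by
  have h0 := hT.pos
  have hex : ∃ t, 0 ≤ t ∧ f t ∈ kernelVertices X := by
    by_contra! hcon
    obtain ⟨s, t, h1, h2, h3⟩ := hT.exists_return hf
    refine hV.ne_empty (hT.kernelVertices_empty_of_return hf (a := s) (b := t) ?_ ?_)
    · intro hi
      exact h2.ne (hi ⟨le_rfl, h2.le⟩ ⟨h2.le, le_rfl⟩ h3)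
    · intro u hu
      exact hcon u (h1.trans hu.1)
  obtain ⟨t, ht0, ht⟩ := hex
  have hcl : IsCompact (Icc 0 t ∩ f ⁻¹' kernelVertices X) :=
    isCompact_Icc.inter_right (hT.finite_kernelVertices.isClosed.preimage (hf.continuous h0))
  obtain ⟨b, ⟨hb, hbV⟩, hmin⟩ := hcl.exists_isLeast ⟨t, ⟨ht0, le_rfl⟩, ht⟩
  refine ⟨b, lt_of_le_of_ne hb.1 ?_, hbV, ?_⟩
  · rintro rfl
    exact hf0 hbV
  · intro u hu hub huV
    have : b ≤ u := hmin ⟨⟨hu, by linarith [hb.2]⟩, huV⟩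
    linarith

/-- If there are vertices, a local geodesic through a point of the edge is followed in both
directions to the first vertex; it cannot return before. Its image is closed and two-sided off the
vertices, so it absorbs the component. Without vertices, a first return gives the whole cycle. -/
theorem exists_edgeParam (hT : TreeScale X h) {e : Set X} (he : e ∈ kernelEdges X) :
    ∃ f L, EdgeParam h e f L := by
  have h0 := hT.pos
  obtain ⟨_, ⟨p, hp, rfl⟩, rfl⟩ := he
  obtain ⟨f, hf, hf0⟩ := hT.exists_locGeod_core hp.1
  have hcore := hT.locGeod_mem_core hf
  have hc := hf.continuous h0
  rcases (kernelVertices X).eq_empty_or_nonempty with hV | hV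
  · obtain ⟨s', t', h1, h2, h3⟩ := hT.exists_return hf
    obtain ⟨s, t, h4, h5, h6, h7, h8⟩ := hf.exists_first_return h0 (u := s') (v := t')
      fun hi => h2.ne (hi ⟨le_rfl, h2.le⟩ ⟨h2.le, le_rfl⟩ h3)
    have h9 := h8.mono (Ico_subset_Ico_left h4)
    have hcyc := hf.isEmbeddedCycle h0 h5 h7 h9
    have hVe : ∀ x, x ∉ kernelVertices X := fun x => by rw [hV]; exact notMem_empty _
    have hce := hT.core_eq_cycle hcyc fun q _ => hVe q
    have hinj : InjOn (fun x => f (s + x)) (Ico 0 (t - s)) := by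
      intro x hx y hy hxy
      have := h9 (x₁ := s + x) ⟨by linarith [hx.1], by linarith [hx.2]⟩ (by
        exact ⟨by linarith [hy.1], by linarith [hy.2]⟩) hxy
      linarith
    refine ⟨fun x => f (s + x), t - s, by linarith, hf.shift s, ?_,
      hinj.mono Ioo_subset_Ico_self, fun u _ => hVe _, Or.inr ⟨hV, by simpa using h7, hinj⟩⟩
    rw [hV, sdiff_empty] at hp ⊢
    rw [hT.isPreconnected_core.connectedComponentIn hp, hT.isClosed_core.closure_eq, hce]
    ext x
    constructor
    · rintro ⟨u, hu, rfl⟩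
      exact ⟨s + u, ⟨by linarith [hu.1], by linarith [hu.2]⟩, rfl⟩
    · rintro ⟨u, hu, rfl⟩
      exact ⟨u - s, ⟨by linarith [hu.1], by linarith [hu.2]⟩, by simp⟩
  · have hpV : f 0 ∉ kernelVertices X := by rw [hf0]; exact hp.2
    obtain ⟨b, b0, b1, b2⟩ := hT.exists_hit hV hf hpV
    obtain ⟨a, a0, a1, a2⟩ := hT.exists_hit hV hf.reflect (by simpa using hpV)
    have havoid : ∀ t ∈ Ioo (-a) b, f t ∉ kernelVertices X := by
      intro t ht
      rcases le_total 0 t with h1 | h1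
      · exact b2 t h1 ht.2
      · simpa using a2 (-t) (by linarith) (by linarith [ht.1])
    have hinj : InjOn f (Ioo (-a) b) := by
      intro s hs t ht hst
      by_contra hne
      wlog hlt : s < t generalizing s t
      · exact this ht hs hst.symm (Ne.symm hne) (lt_of_le_of_ne (not_lt.1 hlt) (Ne.symm hne))
      refine hV.ne_empty (hT.kernelVertices_empty_of_return hf (a := s) (b := t) ?_ ?_)
      · intro hi
        exact hne (hi ⟨le_rfl, hlt.le⟩ ⟨hlt.le, le_rfl⟩ hst)
      · intro u hu
        exact havoid u ⟨hs.1.trans_le hu.1, hu.2.trans_lt ht.2⟩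
    have himg : f '' Icc (-a) b =
        closure (connectedComponentIn (core X \ kernelVertices X) p) := by
      have hSc : IsClosed (f '' Icc (-a) b) := (isCompact_Icc.image hc).isClosed
      apply Subset.antisymm
      · have h1 : f '' Ioo (-a) b ⊆ connectedComponentIn (core X \ kernelVertices X) p := by
          refine (isPreconnected_Ioo.image f hc.continuousOn).subset_connectedComponentIn
            ⟨0, ⟨by linarith, b0⟩, hf0⟩ ?_
          rintro _ ⟨t, ht, rfl⟩
          exact ⟨hcore t, havoid t ht⟩
        rw [← closure_Ioo (by linarith : -a ≠ b)]
        exact (image_closure_subset_closure_image hc).trans (closure_mono h1)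
      · refine closure_minimal (hT.component_subset ?_ hSc ?_
          ⟨0, ⟨by linarith, b0.le⟩, hf0⟩ hp.2) hSc
        · rintro _ ⟨t, -, rfl⟩
          exact hcore t
        · rintro _ ⟨t, ht, rfl⟩ htV
          refine hT.twoSidedAt_locGeod hf ⟨lt_of_le_of_ne ht.1 ?_, lt_of_le_of_ne ht.2 ?_⟩
          · rintro rfl; exact htV a1
          · rintro rfl; exact htV b1
    refine ⟨fun x => f (-a + x), b + a, by linarith, hf.shift _, ?_, ?_, ?_,
      Or.inl ⟨by simpa using a1, by simpa using b1⟩⟩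
    · rw [← himg]
      ext x
      constructor
      · rintro ⟨u, hu, rfl⟩
        exact ⟨-a + u, ⟨by linarith [hu.1], by linarith [hu.2]⟩, rfl⟩
      · rintro ⟨u, hu, rfl⟩
        exact ⟨u + a, ⟨by linarith [hu.1], by linarith [hu.2]⟩, by simp⟩
    · intro x hx y hy hxy
      have := hinj (x₁ := -a + x) ⟨by linarith [hx.1], by linarith [hx.2]⟩ (by
        exact ⟨by linarith [hy.1], by linarith [hy.2]⟩) hxy
      linarith
    · intro t ht
      exact havoid _ ⟨by linarith [ht.1], by linarith [ht.2]⟩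

end TreeScale

theorem EdgeParam.length_eq [MeasurableSpace X] [BorelSpace X] {e : Set X} {f : ℝ → X} {L : ℝ}
    (hf : EdgeParam h e f L) (h0 : 0 < h) : length e = ENNReal.ofReal L := by
  have h1 := hf.geod.length_image_Icc_le h0 0 L
  have h2 := hf.geod.le_length_image_Ioo h0 hf.injOn
  have h3 : length (f '' Ioo 0 L) ≤ length (f '' Icc 0 L) :=
    measure_mono (image_mono Ioo_subset_Icc_self)
  rw [sub_zero] at h1 h2
  rw [← hf.image]
  exact le_antisymm h1 (h2.trans h3)

/-- The points of an edge are far from the vertices, except near its ends. -/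
theorem EdgeParam.le_dist [CompactSpace X] {e : Set X} {f : ℝ → X} {L : ℝ}
    (hf : EdgeParam h e f L) (hT : TreeScale X h) {t : ℝ} {v : X}
    (hv : v ∈ kernelVertices X) : min t (min (L - t) (h / 2)) ≤ dist (f t) v := by
  by_contra! hlt
  have h0 := hT.pos
  set τ := min t (min (L - t) (h / 2)) with hτ
  have τ1 : τ ≤ t := min_le_left _ _
  have τ2 : τ ≤ L - t := (min_le_right _ _).trans (min_le_left _ _)
  have τ3 : τ ≤ h / 2 := (min_le_right _ _).trans (min_le_right _ _)
  have τ0 : 0 < τ := dist_nonneg.trans_lt hlt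
  have d1 := hf.geod.dist_eq (s := t - τ) (t := t) (by linarith) (by linarith)
  have d2 := hf.geod.dist_eq (s := t) (t := t + τ) (by linarith) (by linarith)
  have d1' := dist_comm (f t) (f (t - τ))
  have hcore := hT.locGeod_mem_core hf.geod
  -- Either `v` lies on the edge near `f t`, or the segment from `f t` to `v` leaves the edge at a
  -- vertex. Both put a vertex inside the edge.
  have key : ∃ m ∈ kernelVertices X, dist (f t) m ≤ dist (f t) v ∧
      m ∈ seg (f t) (f (t - τ)) ∪ seg (f t) (f (t + τ)) := by
    rcases hT.local_structure (hcore (t - τ)) (hcore (t + τ)) hv.1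
      (dist_pos.1 (by rw [d1]; linarith)) (dist_pos.1 (by rw [dist_comm, d2]; linarith))
      (by linarith) (by linarith) (hf.geod.btw (by linarith) (by linarith) (by linarith))
      (by linarith) (by linarith) with hm | ⟨m, m1, m2, m3⟩
    · exact ⟨v, hv, le_rfl, hm⟩
    · exact ⟨m, m1, m2.dist_le_left, m3⟩
  obtain ⟨m, m1, m2, m3⟩ := key
  rw [seg_comm (f t) (f (t - τ)), hT.seg_eq_image_locGeod hf.geod (by linarith) (by linarith),
    hT.seg_eq_image_locGeod hf.geod (by linarith) (by linarith)] at m3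
  rcases m3 with ⟨u, hu, rfl⟩ | ⟨u, hu, rfl⟩
  · rw [dist_comm, hf.geod.dist_eq hu.2 (by linarith [hu.1])] at m2
    exact hf.avoid u ⟨by linarith, by linarith [hu.2]⟩ m1
  · rw [hf.geod.dist_eq hu.1 (by linarith [hu.2])] at m2
    exact hf.avoid u ⟨by linarith [hu.1], by linarith⟩ m1

theorem EdgeParam.mem_or_mem_of_nonempty {e : Set X} {f : ℝ → X} {L : ℝ}
    (hf : EdgeParam h e f L) (hV : (kernelVertices X).Nonempty) :
    f 0 ∈ kernelVertices X ∧ f L ∈ kernelVertices X := by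
  rcases hf.ends with h | h
  · exact h
  · exact absurd h.1 hV.ne_empty

/-- Every direction at a vertex is the beginning of an edge. -/
theorem TreeScale.exists_edge_direction [CompactSpace X] (hT : TreeScale X h)
    (hsep : ∀ u ∈ kernelVertices X, ∀ v ∈ kernelVertices X, u ≠ v → 8 * h < dist u v)
    {F : Set X → ℝ → X} {L : Set X → ℝ}
    (hF : ∀ e ∈ kernelEdges X, EdgeParam h e (F e) (L e)) {v a : X}
    (hv : v ∈ kernelVertices X) (ha : a ∈ core X) (hva : dist v a = h) :
    ∃ e ∈ kernelEdges X, (F e 0 = v ∧ ¬ Btw (F e h) v a) ∨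
      (F e (L e) = v ∧ ¬ Btw (F e (L e - h)) v a) := by
  have h0 := hT.pos
  -- The point `z` is too close to `v` to be a vertex, and `h / 4 < h / 2` lets `EdgeParam.le_dist`
  -- place it near an end of its edge. That end must be `v` by separation.
  obtain ⟨z, z1, z2⟩ := exists_btw hT.geo v a (s := h / 4) (by linarith) (by linarith)
  have hzc : z ∈ core X := hT.seg_subset_core hv.1 ha z2
  have hzV : z ∉ kernelVertices X := by
    intro hzV
    have hne : v ≠ z := by
      rintro rfl
      rw [dist_self] at z1; linarith
    linarith [hsep v hv z hzV hne]
  have z2' : dist v z + dist z a = dist v a := z2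
  have he : closure (connectedComponentIn (core X \ kernelVertices X) z) ∈ kernelEdges X :=
    ⟨_, ⟨z, ⟨hzc, hzV⟩, rfl⟩, rfl⟩
  have hze : z ∈ closure (connectedComponentIn (core X \ kernelVertices X) z) :=
    subset_closure (mem_connectedComponentIn ⟨hzc, hzV⟩)
  set e := closure (connectedComponentIn (core X \ kernelVertices X) z)
  have hP := hF e he
  rw [← hP.image] at hze
  obtain ⟨t, ht, htz⟩ := hze
  obtain ⟨e0, e1⟩ := hP.mem_or_mem_of_nonempty ⟨v, hv⟩
  have hd := hP.le_dist hT (t := t) hv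
  rw [htz, dist_comm, z1] at hd
  have hclose : ∀ u ∈ kernelVertices X, dist u z ≤ h / 4 → u = v := by
    intro u hu huz
    by_contra hne
    have := hsep u hu v hv hne
    have := dist_triangle_right u v z
    linarith
  have hdir : ∀ x, Btw v z x → dist v x = h → ¬ Btw x v a := by
    intro x hx hxd hcon
    unfold Btw at hx hcon
    have := dist_triangle_left x a z
    have := dist_comm x v
    linarith
  have l := hP.geod.lipschitzWith h0
  rcases min_le_iff.1 hd with hd | hd
  · have hu : F e 0 = v := hclose _ e0 (by
      rw [← htz]
      have := l 0 t
      rw [zero_sub, abs_neg, abs_of_nonneg ht.1] at this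
      linarith)
    refine ⟨e, he, Or.inl ⟨hu, hdir _ ?_ ?_⟩⟩
    · rw [← hu, ← htz]
      exact hP.geod.btw ht.1 (by linarith) (by linarith)
    · rw [← hu, hP.geod.dist_eq h0.le (by linarith)]; ring
  · rcases min_le_iff.1 hd with hd | hd
    · have hu : F e (L e) = v := hclose _ e1 (by
        rw [← htz]
        have := l (L e) t
        rw [abs_of_nonneg (by linarith [ht.2])] at this
        linarith)
      refine ⟨e, he, Or.inr ⟨hu, hdir _ ?_ ?_⟩⟩
      · rw [← hu, ← htz]
        exact (hP.geod.btw (by linarith) ht.2 (by linarith)).symm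
      · rw [← hu, dist_comm, hP.geod.dist_eq (by linarith) (by linarith)]; ring
    · linarith

/-- The handshake inequality. -/
theorem TreeScale.three_mul_ncard_le [CompactSpace X] (hT : TreeScale X h)
    (hsep : ∀ u ∈ kernelVertices X, ∀ v ∈ kernelVertices X, u ≠ v → 8 * h < dist u v)
    (hE : (kernelEdges X).Finite) : 3 * (kernelVertices X).ncard ≤ 2 * (kernelEdges X).ncard := by
  have h0 := hT.pos
  rcases isEmpty_or_nonempty X with hX | hX
  · simp [eq_empty_of_isEmpty (kernelVertices X)]
  choose! F L hF using fun (e : Set X) (he : e ∈ kernelEdges X) => hT.exists_edgeParam he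
  choose! A hA B hB C hC hpA hpB hpC hAB hAC hBC using
    fun (p : X) (hp : p ∈ kernelVertices X) => hT.exists_three_of_mem_kernelVertices hp
  let D : X → Fin 3 → X := fun p => ![A p, B p, C p]
  have hD : ∀ p ∈ kernelVertices X, ∀ i, D p i ∈ core X ∧ dist p (D p i) = h := by
    intro p hp i
    fin_cases i
    · exact ⟨hA p hp, hpA p hp⟩
    · exact ⟨hB p hp, hpB p hp⟩
    · exact ⟨hC p hp, hpC p hp⟩
  have hDD : ∀ p ∈ kernelVertices X, ∀ i j, i ≠ j → Btw (D p i) p (D p j) := by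
    intro p hp i j hij
    fin_cases i <;> fin_cases j
    · exact absurd rfl hij
    · exact hAB p hp
    · exact hAC p hp
    · exact (hAB p hp).symm
    · exact absurd rfl hij
    · exact hBC p hp
    · exact (hAC p hp).symm
    · exact (hBC p hp).symm
    · exact absurd rfl hij
  let P : Set X → Bool → X := fun e s => if s then F e 0 else F e (L e)
  let Q : Set X → Bool → X := fun e s => if s then F e h else F e (L e - h)
  -- Each of the three directions at a vertex is assigned an edge with a choice of end.
  have hex : ∀ x : kernelVertices X × Fin 3, ∃ y : kernelEdges X × Bool,
      P y.1 y.2 = x.1 ∧ ¬ Btw (Q y.1 y.2) x.1 (D x.1 x.2) := by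
    rintro ⟨⟨v, hv⟩, i⟩
    obtain ⟨e, he, h1 | h1⟩ := hT.exists_edge_direction hsep hF hv (hD v hv i).1 (hD v hv i).2
    · exact ⟨(⟨e, he⟩, true), h1⟩
    · exact ⟨(⟨e, he⟩, false), h1⟩
  choose Ψ hΨ1 hΨ2 using hex
  have hQ : ∀ e ∈ kernelEdges X, ∀ s, dist (P e s) (Q e s) ≤ h := by
    intro e he s
    have l := (hF e he).geod.lipschitzWith h0
    cases s
    · have := l (L e) (L e - h)
      rw [abs_of_nonneg (by linarith)] at this
      simp only [P, Q]
      simp only [Bool.false_eq_true, if_false]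
      linarith
    · have := l 0 h
      rw [zero_sub, abs_neg, abs_of_nonneg h0.le] at this
      simpa only [P, Q, if_true] using this
  have hinj : Function.Injective Ψ := by
    rintro ⟨⟨v, hv⟩, i⟩ ⟨⟨w, hw⟩, j⟩ he
    have hvw : v = w := by
      have e1 := hΨ1 (⟨v, hv⟩, i)
      have e2 := hΨ1 (⟨w, hw⟩, j)
      rw [he] at e1
      exact e1.symm.trans e2
    subst hvw
    have e1 := hΨ2 (⟨v, hv⟩, i)
    have e2 := hΨ2 (⟨v, hw⟩, j)
    have e3 := hΨ1 (⟨v, hw⟩, j)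
    rw [he] at e1
    have e4 := hQ _ (Ψ (⟨v, hw⟩, j)).1.2 (Ψ (⟨v, hw⟩, j)).2
    rw [e3] at e4
    simp only at e1 e2 e4
    by_contra hne
    have hij : i ≠ j := by
      rintro rfl
      exact hne rfl
    -- Two opposite directions cannot both agree with the initial direction of the same edge end.
    rcases hT.btw_or_btw (q := v) (by simp; linarith) (by rw [(hD v hv i).2]; linarith)
      (by linarith) (by rw [(hD v hv j).2]; linarith) (hDD v hv i j hij) with k | k
    · exact e1 k.symm
    · exact e2 k
  have := hE.to_subtype
  have hcard := Nat.card_le_card_of_injective Ψ hinj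
  rw [Nat.card_prod, Nat.card_prod, Nat.card_eq_fintype_card (α := Fin 3),
    Nat.card_eq_fintype_card (α := Bool), Fintype.card_fin, Fintype.card_bool,
    Nat.card_coe_set_eq, Nat.card_coe_set_eq] at hcard
  linarith

/-- From `3 * |V| ≤ 2 * |E|` and `|V| > 0` one gets `|E| > |V|`. Thus the mere existence of a vertex
decides the first alternative of an overlay. -/
theorem TreeScale.two_le_surplus [CompactSpace X] (hT : TreeScale X h)
    (hsep : ∀ u ∈ kernelVertices X, ∀ v ∈ kernelVertices X, u ≠ v → 8 * h < dist u v)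
    (hE : (kernelEdges X).Finite) (hV : (kernelVertices X).Nonempty) : 2 ≤ surplus X := by
  have h1 := hT.three_mul_ncard_le hsep hE
  have h2 := (ncard_pos hT.finite_kernelVertices).2 hV
  rw [surplus, if_pos hV]
  omega

end Edges

/-! ### Transfer of the core and of the vertices through an approximate isometry. -/

section Approximation

variable {X X' : Type*} [MetricSpace X] [MetricSpace X'] {h δ η κ : ℝ} {N : X → X' → Prop}

/-- A relation with full projections which almost preserves distances. -/
structure Approx (N : X → X' → Prop) (δ : ℝ) : Prop where
  left : ∀ x, ∃ x', N x x'
  right : ∀ x', ∃ x, N x x'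
  close : ∀ {x y x' y'}, N x x' → N y y' → |dist x y - dist x' y'| ≤ δ

/-- The thickening of a relation. -/
def Thick (N : X → X' → Prop) (κ : ℝ) (x : X) (x' : X') : Prop :=
  ∃ y y', N y y' ∧ dist x y ≤ κ ∧ dist x' y' ≤ κ

theorem Thick.swap {x : X} {x' : X'} (hx : Thick N κ x x') : Thick (fun a b => N b a) κ x' x := by
  obtain ⟨y, y', h1, h2, h3⟩ := hx
  exact ⟨y', y, h1, h3, h2⟩

theorem Thick.mono {κ' : ℝ} (hκ : κ ≤ κ') {x : X} {x' : X'} (hx : Thick N κ x x') :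
    Thick N κ' x x' := by
  obtain ⟨y, y', h1, h2, h3⟩ := hx
  exact ⟨y, y', h1, h2.trans hκ, h3.trans hκ⟩

theorem Thick.of_dist {κ' : ℝ} {x : X} {x' y' : X'} (hx : Thick N κ x y') (hκ : 0 ≤ κ')
    (hd : dist x' y' ≤ κ') : Thick N (κ + κ') x x' := by
  obtain ⟨z, z', h1, h2, h3⟩ := hx
  exact ⟨z, z', h1, by linarith, by linarith [dist_triangle x' y' z']⟩

theorem thick_of_rel (hκ : 0 ≤ κ) {x : X} {x' : X'} (hx : N x x') : Thick N κ x x' :=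
  ⟨x, x', hx, by simpa using hκ, by simpa using hκ⟩

theorem Thick.thick {κ' : ℝ} {x : X} {x' : X'} (hx : Thick (Thick N κ) κ' x x') :
    Thick N (κ + κ') x x' := by
  obtain ⟨y, y', ⟨z, z', h1, h2, h3⟩, h4, h5⟩ := hx
  exact ⟨z, z', h1, by linarith [dist_triangle x y z], by linarith [dist_triangle x' y' z']⟩

namespace Approx

theorem symm (hN : Approx N δ) : Approx (fun a b => N b a) δ :=
  ⟨hN.right, hN.left, fun h1 h2 => by rw [abs_sub_comm]; exact hN.close h1 h2⟩

theorem nonneg (hN : Approx N δ) {x : X} {x' : X'} (hx : N x x') : 0 ≤ δ := by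
  simpa using hN.close hx hx

theorem dist_le (hN : Approx N δ) {x y : X} {x' y' : X'} (hx : N x x') (hy : N y y') :
    dist x' y' ≤ dist x y + δ := by
  linarith [(abs_le.1 (hN.close hx hy)).1]

theorem le_dist (hN : Approx N δ) {x y : X} {x' y' : X'} (hx : N x x') (hy : N y y') :
    dist x y ≤ dist x' y' + δ := by
  linarith [(abs_le.1 (hN.close hx hy)).2]

theorem thick (hN : Approx N δ) (hκ : 0 ≤ κ) : Approx (Thick N κ) (δ + 4 * κ) := by
  refine ⟨fun x => ?_, fun x' => ?_, ?_⟩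
  · obtain ⟨x', hx⟩ := hN.left x
    exact ⟨x', thick_of_rel hκ hx⟩
  · obtain ⟨x, hx⟩ := hN.right x'
    exact ⟨x, thick_of_rel hκ hx⟩
  · rintro x y x' y' ⟨z, z', h1, h2, h3⟩ ⟨w, w', h4, h5, h6⟩
    have h7 := abs_le.1 (hN.close h1 h4)
    have t1 := dist_triangle4 x z w y
    have t2 := dist_triangle4 z x y w
    have t3 := dist_triangle4 x' z' w' y'
    have t4 := dist_triangle4 z' x' y' w'
    rw [dist_comm w y] at t1
    rw [dist_comm z x] at t2
    rw [dist_comm w' y'] at t3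
    rw [dist_comm z' x'] at t4
    rw [abs_le]
    constructor <;> linarith [h7.1, h7.2]

variable [CompactSpace X] [CompactSpace X']

/-- Core points correspond to points near the core. -/
theorem exists_core (hN : Approx N δ) (hT : TreeScale X h) (hT' : TreeScale X' h)
    (hδ : 100 * δ ≤ h) {x : X} (hx : x ∈ core X) : ∃ x' ∈ core X', Thick N (2 * δ) x x' := by
  have h0 := hT.pos
  have δ0 : 0 ≤ δ := by
    obtain ⟨x', hx'⟩ := hN.left x
    exact hN.nonneg hx'
  choose φ hφ using hN.left
  have up : ∀ a b, dist (φ a) (φ b) ≤ dist a b + δ := fun a b => hN.dist_le (hφ a) (hφ b)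
  have low : ∀ a b, dist a b ≤ dist (φ a) (φ b) + δ := fun a b => hN.le_dist (hφ a) (hφ b)
  -- The images of three aligned points are aligned only up to the error; their median is a nearby
  -- substitute for the middle one.
  let Med : X → X → X → X' → Prop := fun a b c m =>
    Btw (φ a) m (φ b) ∧ Btw (φ b) m (φ c) ∧ Btw (φ a) m (φ c)
  have hMed : ∀ a b c m, dist a b = h → dist b c = h → Btw a b c → Med a b c m →
      2 * dist (φ b) m ≤ 3 * δ := by
    intro a b c m h1 h2 h3 h4
    obtain ⟨h5, h6, h7⟩ := h4
    unfold Btw at h3 h5 h6 h7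
    have := up a b
    have := up b c
    have := low a c
    have := dist_comm (φ b) m
    linarith
  have hex : ∀ a b c, dist a b = h → dist b c = h → ∃ m, Med a b c m := by
    intro a b c h1 h2
    have := up a b
    have := up b c
    obtain ⟨m, m1, m2, m3, -⟩ := hT'.exists_median (x := φ b) (y := φ a) (z := φ c)
      (by rw [dist_comm]; linarith) (by linarith)
    exact ⟨m, m1.symm, m2, m3⟩
  -- Pairs of consecutive medians along a chain of the core of `X`. They can be prolonged because
  -- the chain can, so their entries are in the core of `X'`.
  let S : Set (X' × X') := {p | ∃ a b c d, a ∈ core X ∧ b ∈ core X ∧ c ∈ core X ∧ d ∈ core X ∧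
    dist a b = h ∧ dist b c = h ∧ dist c d = h ∧ Btw a b c ∧ Btw b c d ∧ Med a b c p.1 ∧
    Med b c d p.2}
  have hd : ∀ m n, (m, n) ∈ S → h / 2 ≤ dist m n := by
    rintro m n ⟨a, b, c, d, -, -, -, -, e1, e2, e3, b1, b2, m1, m2⟩
    have k1 := hMed a b c m e1 e2 b1 m1
    have k2 := hMed b c d n e2 e3 b2 m2
    have := low b c
    have := dist_triangle4 (φ b) m n (φ c)
    have := dist_comm n (φ c)
    linarith
  have hsymm : ∀ m n, (m, n) ∈ S → (n, m) ∈ S := by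
    rintro m n ⟨a, b, c, d, ha, hb, hc, hd, e1, e2, e3, b1, b2, ⟨m1, m2, m3⟩, ⟨n1, n2, n3⟩⟩
    exact ⟨d, c, b, a, hd, hc, hb, ha, by rwa [dist_comm], by rwa [dist_comm],
      by rwa [dist_comm], b2.symm, b1.symm, ⟨n2.symm, n1.symm, n3.symm⟩,
      ⟨m2.symm, m1.symm, m3.symm⟩⟩
  have hext : ∀ m n, (m, n) ∈ S → ∃ p, (n, p) ∈ S ∧ Btw m n p := by
    rintro m n ⟨a, b, c, d, -, hb, hc, hd, e1, e2, e3, b1, b2, m1, m2⟩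
    obtain ⟨e, he, e4, b3⟩ := hT.core_extension hd (a := c) (by rw [dist_comm]; exact e3.le)
    obtain ⟨p, hp⟩ := hex c d e e3 e4
    refine ⟨p, ⟨b, c, d, e, hb, hc, hd, he, e2, e3, e4, b2, b3, m2, hp⟩, ?_⟩
    have k1 := hMed a b c m e1 e2 b1 m1
    have k2 := hMed b c d n e2 e3 b2 m2
    have k3 := hMed c d e p e3 e4 b3 hp
    have u1 := up b c
    have u2 := up c d
    have l1 := low b c
    have l2 := low c d
    -- Consecutive medians lie on a common segment: `m` and `n` on that of `φ b` and `φ c`, then `n`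
    -- and `p` on that of `φ c` and `φ d`. This turns approximate alignment into exact alignment.
    have s1 : Btw (φ b) m n := by
      refine hT'.btw_of_le (by linarith) m1.2.1 m2.1 ?_
      have : dist (φ b) n + dist n (φ c) = dist (φ b) (φ c) := m2.1
      have := dist_comm n (φ c)
      linarith
    have s2 : Btw m n (φ d) := m2.2.2.trans_left' s1
    have s3 : Btw (φ d) p n := by
      refine hT'.btw_of_le (by rw [dist_comm]; linarith) hp.1.symm m2.2.1.symm ?_
      have : dist (φ c) n + dist n (φ d) = dist (φ c) (φ d) := m2.2.1
      have := dist_comm n (φ d)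
      linarith
    exact s2.trans_right' s3.symm
  obtain ⟨c, hc, c1, -⟩ := hT.core_extension hx (a := x) (by simpa using h0.le)
  obtain ⟨a, ha, a1, a2⟩ := hT.core_extension hx (a := c) c1.le
  obtain ⟨d, hd', d1, d2⟩ := hT.core_extension hc (a := x) (by rw [dist_comm]; exact c1.le)
  have a1' : dist a x = h := by rwa [dist_comm]
  obtain ⟨m, hm⟩ := hex a x c a1' c1
  obtain ⟨n, hn⟩ := hex x c d c1 d1
  have hmS : (m, n) ∈ S := ⟨a, x, c, d, ha, hx, hc, hd', a1', c1, d1, a2.symm, d2, hm, hn⟩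
  refine ⟨m, hT'.mem_core_of_pairs (by linarith) hd hsymm hext hmS, x, φ x, hφ x, by simpa, ?_⟩
  have := hMed a x c m a1' c1 a2.symm hm
  rw [dist_comm]
  linarith

/-- Kernel vertices correspond to points near kernel vertices. -/
theorem exists_vertex (hN : Approx N δ) (hT : TreeScale X h) (hT' : TreeScale X' h)
    (hδ : 100 * δ ≤ h) {v : X} (hv : v ∈ kernelVertices X) :
    ∃ v' ∈ kernelVertices X', Thick N (40 * δ) v v' := by
  have h0 := hT.pos
  have δ0 : 0 ≤ δ := by
    obtain ⟨x', hx'⟩ := hN.left v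
    exact hN.nonneg hx'
  have hM := hN.thick (κ := 2 * δ) (by linarith)
  obtain ⟨a, ha, b, hb, c, hc, da, db, dc, ab, ac, bc⟩ :=
    hT.exists_three_of_mem_kernelVertices hv
  obtain ⟨v', hv', nv⟩ := hN.exists_core hT hT' hδ hv.1
  obtain ⟨a', ha', na⟩ := hN.exists_core hT hT' hδ ha
  obtain ⟨b', hb', nb⟩ := hN.exists_core hT hT' hδ hb
  obtain ⟨c', hc', nc⟩ := hN.exists_core hT hT' hδ hc
  unfold Btw at ab ac bc
  have ca := dist_comm a v
  have cb := dist_comm b v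
  have ab1 := hM.dist_le na nb
  have ab2 := hM.le_dist na nb
  have ac1 := hM.dist_le na nc
  have ac2 := hM.le_dist na nc
  have bc1 := hM.dist_le nb nc
  have bc2 := hM.le_dist nb nc
  have va := hM.dist_le nv na
  have vb := hM.dist_le nv nb
  have vc := hM.dist_le nv nc
  obtain ⟨m, m1, m2, m3, -⟩ := hT'.exists_median (x := a') (y := b') (z := c')
    (by linarith) (by linarith)
  have mc : m ∈ core X' := hT'.seg_subset_core ha' hb' m1
  have m1' : dist a' m + dist m b' = dist a' b' := m1
  have m2' : dist a' m + dist m c' = dist a' c' := m2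
  have m3' : dist b' m + dist m c' = dist b' c' := m3
  have e1 := dist_comm m b'
  have pa : 0 < dist a' m := by linarith
  have pb : 0 < dist b' m := by linarith
  have pc : 0 < dist c' m := by rw [dist_comm]; linarith
  refine ⟨m, hT'.mem_kernelVertices ha' hb' hc' (dist_pos.1 pa) (dist_pos.1 pb)
    (dist_pos.1 pc) m1 m2 m3, ?_⟩
  -- The relation between core points has distortion `9 * δ`. So `dist a' b'` is at least `2 * h - 9
  -- * δ`, the legs at `m` are at most `h + 13.5 * δ`, those at `v'` at most `h + 9 * δ`, and the
  -- four-point condition concludes.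
  have hfar : dist m v' ≤ 32 * δ := by
    have e2 := dist_comm a' m
    have key := hT'.hyp v' m v' a' b' (by linarith [dist_triangle v' a' m]) (by simp; linarith)
      (by linarith) (by linarith)
    rcases key with key | key <;> linarith
  exact (nv.of_dist (by linarith) hfar).mono (by linarith)

end Approx

/-- A relation which almost preserves distances and relates the cores and the kernel vertices
of two spaces. -/
structure CoreApprox (M : X → X' → Prop) (h η : ℝ) : Prop where
  approx : Approx M η
  scale : TreeScale X h
  scale' : TreeScale X' h
  small : 100 * η ≤ h
  core : ∀ x ∈ core X, ∃ x' ∈ core X', M x x'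
  core' : ∀ x' ∈ RGraph.core X', ∃ x ∈ RGraph.core X, M x x'
  vert : ∀ v ∈ kernelVertices X, ∃ v' ∈ kernelVertices X', M v v'
  vert' : ∀ v' ∈ kernelVertices X', ∃ v ∈ kernelVertices X, M v v'
  sep : ∀ u ∈ kernelVertices X, ∀ v ∈ kernelVertices X, u ≠ v → 8 * h < dist u v
  sep' : ∀ u ∈ kernelVertices X', ∀ v ∈ kernelVertices X', u ≠ v → 8 * h < dist u v

theorem CoreApprox.symm {M : X → X' → Prop} (hM : CoreApprox M h η) :
    CoreApprox (fun a b => M b a) h η :=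
  ⟨hM.approx.symm, hM.scale', hM.scale, hM.small, hM.core', hM.core, hM.vert', hM.vert,
    hM.sep', hM.sep⟩

/-- Thickening by `40 * δ` adds four times as much to the distortion, whence `161 = 1 + 4 * 40`; the
hypothesis on `δ` is `100 * (161 * δ) ≤ h`. -/
theorem Approx.coreApprox [CompactSpace X] [CompactSpace X'] (hN : Approx N δ)
    (hT : TreeScale X h) (hT' : TreeScale X' h) (δ0 : 0 ≤ δ) (hδ : 16100 * δ ≤ h)
    (hsep : ∀ u ∈ kernelVertices X, ∀ v ∈ kernelVertices X, u ≠ v → 8 * h < dist u v)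
    (hsep' : ∀ u ∈ kernelVertices X', ∀ v ∈ kernelVertices X', u ≠ v → 8 * h < dist u v) :
    CoreApprox (Thick N (40 * δ)) h (161 * δ) := by
  have h1 : 100 * δ ≤ h := by linarith
  refine ⟨?_, hT, hT', by linarith, fun x hx => ?_, fun x' hx' => ?_,
    fun v hv => hN.exists_vertex hT hT' h1 hv, fun v' hv' => ?_, hsep, hsep'⟩
  · convert hN.thick (κ := 40 * δ) (by linarith) using 1
    ring
  · obtain ⟨x', h2, h3⟩ := hN.exists_core hT hT' h1 hx
    exact ⟨x', h2, h3.mono (by linarith)⟩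
  · obtain ⟨x, h2, h3⟩ := hN.symm.exists_core hT' hT h1 hx'
    exact ⟨x, h2, h3.swap.mono (by linarith)⟩
  · obtain ⟨v, h2, h3⟩ := hN.symm.exists_vertex hT' hT h1 hv'
    exact ⟨v, h2, h3.swap⟩

/-- Two vertices related to the same point are within `η` of each other, far below the separation `8
* h`. This makes the relation between vertices a bijection. -/
theorem CoreApprox.vertex_unique {M : X → X' → Prop} (hM : CoreApprox M h η) {x : X}
    {v' w' : X'} (hv' : v' ∈ kernelVertices X') (hw' : w' ∈ kernelVertices X') (hv : M x v')
    (hw : M x w') : v' = w' := by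
  by_contra hne
  have h1 := hM.approx.dist_le hv hw
  have h2 := hM.sep' v' hv' w' hw' hne
  have h3 := hM.small
  have h4 := hM.scale.pos
  rw [dist_self] at h1
  linarith

theorem CoreApprox.vertices_empty {M : X → X' → Prop} (hM : CoreApprox M h η)
    (hV : kernelVertices X = ∅) : kernelVertices X' = ∅ := by
  rw [eq_empty_iff_forall_notMem] at hV ⊢
  intro v' hv'
  obtain ⟨v, hv, -⟩ := hM.vert' v' hv'
  exact hV v hv

end Approximation

/-! ### Transfer of the edges by chains of core points. -/

section EdgeTransfer

variable {X X' : Type*} [MetricSpace X] [MetricSpace X'] {h η : ℝ}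

theorem TreeScale.component_eq [CompactSpace X] (hT : TreeScale X h) {y z : X}
    (hy : y ∈ core X) (hz : z ∈ core X) (hV : ∀ q ∈ seg y z, q ∉ kernelVertices X) :
    connectedComponentIn (core X \ kernelVertices X) y =
      connectedComponentIn (core X \ kernelVertices X) z := by
  apply connectedComponentIn_eq
  exact (isPreconnected_seg hT.geo y z).subset_connectedComponentIn (left_mem_seg _ _)
    (fun q hq => (⟨hT.seg_subset_core hy hz hq, hV q hq⟩ : _ ∧ _)) (right_mem_seg _ _)

theorem mem_closure_of_seg (hX : IsGeodesicSpace X) {v y : X} {D : Set X} (hne : v ≠ y)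
    (hD : ∀ q ∈ seg v y, q ≠ v → q ∈ D) : v ∈ closure D := by
  rw [Metric.mem_closure_iff]
  intro ε hε
  have hpos := dist_pos.2 hne
  obtain ⟨q, q1, q2⟩ := exists_btw hX v y (s := min (ε / 2) (dist v y))
    (le_min (by linarith) hpos.le) (min_le_right _ _)
  refine ⟨q, hD q q2 ?_, ?_⟩
  · rw [← dist_pos, dist_comm, q1]
    exact lt_min (by linarith) hpos
  · rw [q1]
    exact (min_le_left _ _).trans_lt (by linarith)

/-- A closed edge without vertices is smooth at its base point. -/
theorem EdgeParam.btw_base [CompactSpace X] {e : Set X} {f : ℝ → X} {L τ : ℝ}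
    (hf : EdgeParam h e f L) (hT : TreeScale X h) (hV : kernelVertices X = ∅)
    (τ0 : 0 < τ) (τh : τ ≤ h) (τL : 2 * τ < L) : Btw (f (L - τ)) (f 0) (f τ) := by
  have h0 := hT.pos
  rcases hf.ends with he | ⟨-, he, hi⟩
  · exact absurd hV (nonempty_iff_ne_empty.1 ⟨_, he.1⟩)
  have hcore := hT.locGeod_mem_core hf.geod
  have d1 : dist (f 0) (f τ) = τ := by
    rw [hf.geod.dist_eq τ0.le (by linarith), sub_zero]
  have d2 : dist (f (L - τ)) (f 0) = τ := by
    rw [he, hf.geod.dist_eq (by linarith) (by linarith)]; ring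
  by_contra hcon
  rcases hT.branch (hcore 0) (hcore _) (hcore _) (by rw [dist_comm]; linarith)
    (by linarith) hcon with k | k | ⟨m, m1, -⟩
  · have : f τ ∈ seg (f (L - τ)) (f L) := by rw [← he]; exact k.symm
    rw [hT.seg_eq_image_locGeod hf.geod (by linarith) (by linarith)] at this
    obtain ⟨u, hu, hut⟩ := this
    rcases eq_or_lt_of_le hu.2 with h1 | h1
    · rw [h1, ← he] at hut
      rw [hut, dist_self] at d1
      linarith
    · have := hi ⟨by linarith [hu.1], h1⟩ ⟨τ0.le, by linarith⟩ hut
      linarith [hu.1]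
  · have : f (L - τ) ∈ seg (f 0) (f τ) := k
    rw [hT.seg_eq_image_locGeod hf.geod τ0.le (by linarith)] at this
    obtain ⟨u, hu, hut⟩ := this
    have := hi ⟨hu.1, by linarith [hu.2]⟩ ⟨by linarith, by linarith⟩ hut
    linarith [hu.2]
  · rw [hV] at m1
    exact m1

/-- A chain of core points following a parametrized edge. -/
structure EdgeChain (M : X → X' → Prop) (h η : ℝ) (e : Set X) (f : ℝ → X) (L τ : ℝ) (n : ℕ)
    (x' : ℕ → X') : Prop where
  approx : CoreApprox M h η
  param : EdgeParam h e f L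
  two_le : 2 < n
  mul_eq : n * τ = L
  le_step : h / 5 ≤ τ
  step_le : τ ≤ h / 4
  core : ∀ i ≤ n, x' i ∈ core X'
  near : ∀ i ≤ n, M (f (i * τ)) (x' i)
  ends : (x' 0 ∈ kernelVertices X' ∧ x' n ∈ kernelVertices X') ∨
    (kernelVertices X = ∅ ∧ kernelVertices X' = ∅ ∧ x' 0 = x' n)

theorem exists_edgeChain [CompactSpace X] {M : X → X' → Prop} (hM : CoreApprox M h η)
    {e : Set X} {f : ℝ → X} {L : ℝ} (hf : EdgeParam h e f L) (hL : h ≤ L) :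
    ∃ τ n x', EdgeChain M h η e f L τ n x' ∧ n * h ≤ 5 * L := by
  have h0 := hM.scale.pos
  have hcore := hM.scale.locGeod_mem_core hf.geod
  -- Rounding up gives steps of at most `h / 4`. Since `h ≤ L`, also `n ≤ 5 * L / h`, so the steps
  -- are at least `h / 5`.
  set n := ⌈4 * L / h⌉₊ with hn
  have n1 : 4 * L / h ≤ n := Nat.le_ceil _
  have n2 : (n : ℝ) < 4 * L / h + 1 := Nat.ceil_lt_add_one (div_nonneg (by linarith) h0.le)
  rw [div_le_iff₀ h0] at n1
  have n3 : n * h < 4 * L + h := by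
    have := mul_lt_mul_of_pos_right n2 h0
    rwa [add_mul, div_mul_cancel₀ _ h0.ne', one_mul] at this
  have n4 : (4 : ℝ) ≤ n := by
    by_contra! hcon
    nlinarith
  have n5 : 4 ≤ n := by exact_mod_cast n4
  have npos : (0 : ℝ) < n := by linarith
  have hmul : n * (L / n) = L := mul_div_cancel₀ _ npos.ne'
  have s1 : h / 5 ≤ L / n := by
    rw [le_div_iff₀ npos]; linarith
  have s2 : L / n ≤ h / 4 := by
    rw [div_le_iff₀ npos]; linarith
  choose y hy1 hy2 using fun i : ℕ => hM.core _ (hcore (i * (L / n)))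
  rcases hf.ends with ⟨e0, e1⟩ | ⟨hV, he, -⟩
  · obtain ⟨v, hv, hv2⟩ := hM.vert _ e0
    obtain ⟨w, hw, hw2⟩ := hM.vert _ e1
    refine ⟨L / n, n, fun i => if i = 0 then v else if i = n then w else y i,
      ⟨hM, hf, by omega, hmul, s1, s2, fun i hi => ?_, fun i hi => ?_, Or.inl ⟨?_, ?_⟩⟩,
      by linarith⟩
    · split_ifs
      · exact hv.1
      · exact hw.1
      · exact hy1 i
    · split_ifs with c1 c2
      · rw [c1]; simpa using hv2
      · rw [c2, hmul]; exact hw2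
      · exact hy2 i
    · simpa using hv
    · have : n ≠ 0 := by omega
      simpa [this] using hw
  -- For a closed edge the last node is set equal to the first, so that the chain closes exactly.
  · refine ⟨L / n, n, fun i => if i = n then y 0 else y i,
      ⟨hM, hf, by omega, hmul, s1, s2, fun i hi => ?_, fun i hi => ?_,
        Or.inr ⟨hV, hM.vertices_empty hV, ?_⟩⟩, by linarith⟩
    · split_ifs
      · exact hy1 0
      · exact hy1 i
    · split_ifs with c1
      · rw [c1, hmul, ← he]
        simpa using hy2 0
      · exact hy2 i
    · have : 0 ≠ n := by omega
      simp [this]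

namespace EdgeChain

variable {M : X → X' → Prop} {e : Set X} {f : ℝ → X} {L τ : ℝ} {n : ℕ}
  {x' : ℕ → X'}

theorem eta_nonneg (hc : EdgeChain M h η e f L τ n x') : 0 ≤ η :=
  hc.approx.approx.nonneg (hc.near 0 (Nat.zero_le _))

theorem dist_succ (hc : EdgeChain M h η e f L τ n x') {i : ℕ} (hi : i < n) :
    |τ - dist (x' i) (x' (i + 1))| ≤ η := by
  have h0 := hc.approx.scale.pos
  have := hc.approx.approx.close (hc.near i hi.le) (hc.near (i + 1) hi)
  rwa [hc.param.geod.dist_eq (by push_cast; nlinarith [hc.le_step])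
    (by push_cast; linarith [hc.step_le]), show ((i + 1 : ℕ) : ℝ) * τ - i * τ = τ by
      push_cast; ring] at this

/-- The union of the segments of the chain. -/
def trace (n : ℕ) (x' : ℕ → X') : Set X' := ⋃ i ∈ Finset.range n, seg (x' i) (x' (i + 1))

theorem mem_trace {q : X'} : q ∈ trace n x' ↔ ∃ i < n, q ∈ seg (x' i) (x' (i + 1)) := by
  simp [trace]

theorem isClosed_trace : IsClosed (trace n x') :=
  isClosed_biUnion_finset fun _ _ => isClosed_seg _ _

theorem seg_subset_trace {i : ℕ} (hi : i < n) : seg (x' i) (x' (i + 1)) ⊆ trace n x' :=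
  fun _ hq => mem_trace.2 ⟨i, hi, hq⟩

theorem trace_subset_core [CompactSpace X'] (hc : EdgeChain M h η e f L τ n x') :
    trace n x' ⊆ RGraph.core X' := by
  intro q hq
  obtain ⟨i, hi, hq⟩ := mem_trace.1 hq
  exact hc.approx.scale'.seg_subset_core (hc.core i hi.le) (hc.core (i + 1) hi) hq

theorem step_pos (hc : EdgeChain M h η e f L τ n x') : 20 * η ≤ τ ∧ 0 < τ := by
  have := hc.le_step
  have := hc.approx.small
  have := hc.approx.scale.pos
  constructor <;> linarith

theorem mul_mem (hc : EdgeChain M h η e f L τ n x') {j : ℕ} (hj : j < n) :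
    0 ≤ j * τ ∧ j * τ + τ ≤ L := by
  have h1 := hc.step_pos.2
  have h2 : (j : ℝ) + 1 ≤ n := by exact_mod_cast hj
  constructor
  · positivity
  · rw [← hc.mul_eq]
    nlinarith

theorem le_mul (hc : EdgeChain M h η e f L τ n x') {j : ℕ} (hj : 0 < j) : τ ≤ j * τ := by
  have h1 := hc.step_pos.2
  have h2 : (1 : ℝ) ≤ j := by exact_mod_cast hj
  nlinarith

variable [CompactSpace X]

/-- Points of the edge corresponding to vertices are close to its ends. -/
theorem close_end (hc : EdgeChain M h η e f L τ n x') {t a : ℝ} (ht : t ∈ Icc 0 L) {q : X'}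
    (hq : q ∈ kernelVertices X') (ha : a < h / 10) {v : X} (hv : v ∈ kernelVertices X)
    (hvq : M v q) (hd : dist (f t) v ≤ a) : (t ≤ a ∧ q = x' 0) ∨ (L - t ≤ a ∧ q = x' n) := by
  have h0 := hc.approx.scale.pos
  have hle := (hc.param.le_dist hc.approx.scale (t := t) hv).trans hd
  have l := hc.param.geod.lipschitzWith h0
  obtain ⟨e0, e1⟩ := hc.param.mem_or_mem_of_nonempty ⟨v, hv⟩
  have hE : x' 0 ∈ kernelVertices X' ∧ x' n ∈ kernelVertices X' := by
    rcases hc.ends with h | h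
    · exact h
    · exact absurd h.1 (nonempty_iff_ne_empty.1 ⟨v, hv⟩)
  have hclose : ∀ u ∈ kernelVertices X, dist u (f t) ≤ a → u = v := by
    intro u hu hd'
    by_contra hne
    have := hc.approx.sep u hu v hv hne
    linarith [dist_triangle u (f t) v]
  rcases min_le_iff.1 hle with h1 | h1
  · left
    have := l 0 t
    rw [zero_sub, abs_neg, abs_of_nonneg ht.1] at this
    have hu := hclose _ e0 (this.trans h1)
    refine ⟨h1, hc.approx.vertex_unique hq hE.1 hvq ?_⟩
    rw [← hu]
    simpa using hc.near 0 (Nat.zero_le _)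
  rcases min_le_iff.1 h1 with h2 | h2
  · right
    have := l L t
    rw [abs_of_nonneg (by linarith [ht.2])] at this
    have hu := hclose _ e1 (this.trans h2)
    refine ⟨h2, hc.approx.vertex_unique hq hE.2 hvq ?_⟩
    rw [← hu, ← hc.mul_eq]
    exact hc.near n le_rfl
  · linarith

/-- A vertex of `X` related to `q` is within `2 * η` of a point `f t` of the sampled piece. By
`close_end` the time `t` is near `0` or `L`, so the piece is the first or the last one and `q` is
the end node. -/
theorem vertex_mem_seg (hc : EdgeChain M h η e f L τ n x') {i : ℕ} (hi : i < n) {q : X'}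
    (hq : q ∈ kernelVertices X') (hqi : q ∈ seg (x' i) (x' (i + 1))) :
    (i = 0 ∧ q = x' 0) ∨ (i + 1 = n ∧ q = x' n) := by
  have h0 := hc.approx.scale.pos
  have hη := hc.eta_nonneg
  have hs := hc.approx.small
  obtain ⟨s1, s2⟩ := hc.step_pos
  have s3 := hc.step_le
  obtain ⟨m1, m2⟩ := hc.mul_mem hi
  obtain ⟨v, hv, hvq⟩ := hc.approx.vert' q hq
  have near1 := hc.near i hi.le
  have near2 := hc.near (i + 1) hi
  have cast : ((i + 1 : ℕ) : ℝ) * τ = i * τ + τ := by push_cast; ring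
  rw [cast] at near2
  have d1 := hc.approx.approx.le_dist near1 hvq
  have d2 := hc.approx.approx.le_dist hvq near2
  have d3 := hc.approx.approx.dist_le near1 near2
  have d3' := hc.approx.approx.le_dist near1 near2
  have d4 := hc.param.geod.dist_eq (s := i * τ) (t := i * τ + τ) (by linarith) (by linarith)
  have hqi' : dist (x' i) q + dist q (x' (i + 1)) = dist (x' i) (x' (i + 1)) := hqi
  have n1 := dist_nonneg (x := q) (y := x' (i + 1))
  obtain ⟨z, z1, z2, z3, -⟩ := hc.approx.scale.exists_median (x := f (i * τ))
    (y := f (i * τ + τ)) (z := v) (by linarith) (by linarith)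
  have z1' : z ∈ seg (f (i * τ)) (f (i * τ + τ)) := z1
  rw [hc.approx.scale.seg_eq_image_locGeod hc.param.geod (by linarith) (by linarith)] at z1'
  obtain ⟨t, ht, rfl⟩ := z1'
  have hd : dist (f t) v ≤ 2 * η := by
    unfold Btw at z1 z2 z3
    linarith [dist_comm (f t) (f (i * τ + τ)), dist_comm v (f (i * τ + τ))]
  rcases hc.close_end (t := t) ⟨by linarith [ht.1], by linarith [ht.2]⟩ hq (by linarith) hv hvq hd
    with ⟨k1, k2⟩ | ⟨k1, k2⟩
  · refine Or.inl ⟨?_, k2⟩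
    by_contra hne
    have := hc.le_mul (Nat.pos_of_ne_zero hne)
    linarith [ht.1]
  · refine Or.inr ⟨?_, k2⟩
    by_contra hne
    have := (hc.mul_mem (j := i + 1) (by omega)).2
    push_cast at this
    linarith [ht.2]

theorem lt_dist_node (hc : EdgeChain M h η e f L τ n x') {j : ℕ} (h0 : 0 < j) (hn : j < n)
    {q : X'} (hq : q ∈ kernelVertices X') : 2 * η < dist (x' j) q := by
  by_contra! hle
  have hη := hc.eta_nonneg
  have hs := hc.approx.small
  have hp := hc.approx.scale.pos
  obtain ⟨s1, s2⟩ := hc.step_pos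
  obtain ⟨m1, m2⟩ := hc.mul_mem hn
  have m3 := hc.le_mul h0
  obtain ⟨v, hv, hvq⟩ := hc.approx.vert' q hq
  have d1 := hc.approx.approx.le_dist (hc.near j hn.le) hvq
  rcases hc.close_end (t := j * τ) (a := 3 * η) ⟨m1, by linarith⟩ hq (by linarith) hv hvq
    (by linarith) with ⟨k1, -⟩ | ⟨k1, -⟩ <;> linarith

theorem node_notMem (hc : EdgeChain M h η e f L τ n x') {j : ℕ} (h0 : 0 < j) (hn : j < n) :
    x' j ∉ kernelVertices X' := by
  intro hv
  have := hc.lt_dist_node h0 hn hv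
  rw [dist_self] at this
  linarith [hc.eta_nonneg]

variable [CompactSpace X']

omit [CompactSpace X] in
-- If `a` and `b` were not opposite from `q`, their segments would separate at a vertex within `3 /
-- 2 * η` of `q`, which the margin `2 * η` excludes.
theorem btw_of_approx (hc : EdgeChain M h η e f L τ n x') {a q b : X'}
    (ha : a ∈ RGraph.core X') (hq : q ∈ RGraph.core X') (hb : b ∈ RGraph.core X')
    (hqa : |τ - dist q a| ≤ η) (hqb : |τ - dist q b| ≤ η) (hab : 2 * τ - η ≤ dist a b)
    (hV : ∀ m ∈ kernelVertices X', 2 * η < dist q m) : Btw a q b := by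
  by_contra hcon
  have h0 := hc.approx.scale.pos
  have hη := hc.eta_nonneg
  obtain ⟨s1, s2⟩ := hc.step_pos
  have s3 := hc.step_le
  obtain ⟨a1, a2⟩ := abs_le.1 hqa
  obtain ⟨b1, b2⟩ := abs_le.1 hqb
  have hs := hc.approx.small
  rcases hc.approx.scale'.branch hq ha hb (by linarith) (by linarith) hcon with
    k | k | ⟨m, m1, -, m2, m3⟩
  · unfold Btw at k
    linarith [dist_comm b a]
  · unfold Btw at k
    linarith
  · have := hV m m1
    unfold Btw at m2 m3
    linarith [dist_triangle a m b, dist_comm a m]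

theorem twoSidedAt_node (hc : EdgeChain M h η e f L τ n x') {j : ℕ} (hj : j ≤ n)
    (hV : x' j ∉ kernelVertices X') : TwoSidedAt h (trace n x') (x' j) := by
  have h0 := hc.approx.scale.pos
  have hη := hc.eta_nonneg
  have hs := hc.approx.small
  obtain ⟨s1, s2⟩ := hc.step_pos
  have s3 := hc.step_le
  have htwo := hc.two_le
  have key : ∀ i k, i < n → k < n → x' (i + 1) = x' j → x' k = x' j →
      2 * τ - η ≤ dist (x' i) (x' (k + 1)) → (∀ m ∈ kernelVertices X', 2 * η < dist (x' j) m) →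
      TwoSidedAt h (trace n x') (x' j) := by
    intro i k hi hk ei ek hd hm
    have d1 := hc.dist_succ hi
    have d2 := hc.dist_succ hk
    rw [ei, dist_comm] at d1
    rw [ek] at d2
    have a1 := abs_le.1 d1
    have a2 := abs_le.1 d2
    refine ⟨x' i, x' (k + 1), ?_, ?_, by linarith, by linarith,
      hc.btw_of_approx (hc.core i hi.le) (hc.core j hj) (hc.core (k + 1) hk) d1 d2 hd hm, ?_, ?_⟩
    · rw [← dist_pos, dist_comm]; linarith
    · rw [← dist_pos, dist_comm]; linarith
    · rw [seg_comm, ← ei]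
      exact seg_subset_trace hi
    · rw [← ek]
      exact seg_subset_trace hk
  by_cases hmid : 0 < j ∧ j < n
  · obtain ⟨j0, jn⟩ := hmid
    obtain ⟨i, rfl⟩ : ∃ i, j = i + 1 := ⟨j - 1, by omega⟩
    refine key i (i + 1) (by omega) jn rfl rfl ?_ fun m hm => hc.lt_dist_node j0 jn hm
    have d := hc.approx.approx.dist_le (hc.near i (by omega)) (hc.near (i + 1 + 1) (by omega))
    have d' := hc.approx.approx.le_dist (hc.near i (by omega)) (hc.near (i + 1 + 1) (by omega))
    rw [hc.param.geod.dist_eq (by push_cast; linarith) (by push_cast; linarith)] at d'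
    push_cast at d'
    linarith
  · have hend : j = 0 ∨ j = n := by omega
    rcases hc.ends with ⟨e0, e1⟩ | ⟨hV0, hV1, he⟩
    · rcases hend with rfl | rfl
      · exact absurd e0 hV
      · exact absurd e1 hV
    · have hj0 : x' j = x' 0 := by
        rcases hend with rfl | rfl
        · rfl
        · exact he.symm
      have hn1 : n - 1 + 1 = n := by omega
      -- At the base point of a closed chain the two neighbours are the nodes `n - 1` and `1`. They
      -- are nearly opposite because the edge is smooth there, by `btw_base`.
      refine key (n - 1) 0 (by omega) (by omega) (by rw [hn1, hj0, he]) hj0.symm ?_ ?_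
      · have hbase := hc.param.btw_base hc.approx.scale hV0 s2 (by linarith) (by
          have : (2 : ℝ) < n := by exact_mod_cast htwo
          rw [← hc.mul_eq]
          exact mul_lt_mul_of_pos_right this s2)
        have near1 := hc.near (n - 1) (by omega)
        have near2 := hc.near (0 + 1) (by omega)
        rw [Nat.cast_sub (by omega), sub_mul, hc.mul_eq, Nat.cast_one, one_mul] at near1
        rw [zero_add, Nat.cast_one, one_mul] at near2
        have d' := hc.approx.approx.le_dist near1 near2
        have f0 : f 0 = f L := by
          rcases hc.param.ends with h | h
          · rw [hV0] at h
            exact absurd h.1 (notMem_empty _)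
          · exact h.2.1
        have e1 := hc.param.geod.dist_eq (s := L - τ) (t := L) (by linarith) (by linarith)
        have e2 := hc.param.geod.dist_eq (s := 0) (t := τ) (by linarith) (by linarith)
        rw [← f0] at e1
        unfold Btw at hbase
        rw [zero_add]
        linarith
      · intro m hm
        rw [hV1] at hm
        exact absurd hm (notMem_empty _)

theorem twoSidedAt_trace (hc : EdgeChain M h η e f L τ n x') {q : X'} (hq : q ∈ trace n x')
    (hqV : q ∉ kernelVertices X') : TwoSidedAt h (trace n x') q := by
  obtain ⟨i, hi, hqi⟩ := mem_trace.1 hq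
  by_cases h1 : q = x' i
  · subst h1
    exact hc.twoSidedAt_node hi.le hqV
  by_cases h2 : q = x' (i + 1)
  · subst h2
    exact hc.twoSidedAt_node hi hqV
  exact (twoSidedAt_seg hc.approx.scale'.geo hc.approx.scale.pos hqi h1 h2).mono
    (seg_subset_trace hi)

theorem component_node (hc : EdgeChain M h η e f L τ n x') {j : ℕ} (hj : j + 1 < n) :
    connectedComponentIn (RGraph.core X' \ kernelVertices X') (x' (j + 1)) =
      connectedComponentIn (RGraph.core X' \ kernelVertices X') (x' 1) := by
  induction j with
  | zero => rfl
  | succ j ih =>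
    rw [← ih (by omega)]
    symm
    refine hc.approx.scale'.component_eq (hc.core _ (by omega)) (hc.core _ (by omega)) ?_
    intro q hq hqV
    rcases hc.vertex_mem_seg (i := j + 1) (by omega) hqV hq with h | h <;> omega

theorem mem_component (hc : EdgeChain M h η e f L τ n x') {q : X'} (hq : q ∈ trace n x')
    (hqV : q ∉ kernelVertices X') :
    q ∈ connectedComponentIn (RGraph.core X' \ kernelVertices X') (x' 1) := by
  have hqc := hc.trace_subset_core hq
  have htwo := hc.two_le
  obtain ⟨i, hi, hqi⟩ := mem_trace.1 hq
  suffices h : ∃ j, j + 1 < n ∧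
      connectedComponentIn (RGraph.core X' \ kernelVertices X') q =
        connectedComponentIn (RGraph.core X' \ kernelVertices X') (x' (j + 1)) by
    obtain ⟨j, hj, he⟩ := h
    rw [← hc.component_node hj, ← he]
    exact mem_connectedComponentIn ⟨hqc, hqV⟩
  have hflat : ∀ {a b : X'}, Btw a q b → Btw q a b → q = a := by
    intro a b h1 h2
    unfold Btw at h1 h2
    have := dist_comm a q
    have := dist_nonneg (x := a) (y := q)
    exact dist_eq_zero.1 (by linarith)
  have hqi' : Btw (x' i) q (x' (i + 1)) := hqi
  rcases Nat.eq_zero_or_pos i with rfl | h0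
  · refine ⟨0, by omega, hc.approx.scale'.component_eq hqc (hc.core _ (by omega)) ?_⟩
    intro w hw hwV
    rcases hc.vertex_mem_seg hi hwV (hqi'.trans_right hw) with ⟨-, h⟩ | h
    · subst h
      exact hqV (hflat hqi' hw ▸ hwV)
    · omega
  · obtain ⟨j, rfl⟩ : ∃ j, i = j + 1 := ⟨i - 1, by omega⟩
    refine ⟨j, hi, hc.approx.scale'.component_eq hqc (hc.core _ hi.le) ?_⟩
    intro w hw hwV
    rcases hc.vertex_mem_seg hi hwV (hqi'.trans_left (Btw.symm hw)) with h | ⟨h, hwn⟩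
    · omega
    · rw [← h] at hwn
      subst hwn
      exact hqV (hflat hqi'.symm hw ▸ hwV)

/-- The trace is closed and two-sided off the vertices, so it contains the component of `x' 1`.
Conversely its points other than vertices are linked to `x' 1` along the chain, and a vertex on it
is an end node, a limit of such points. -/
theorem closure_component (hc : EdgeChain M h η e f L τ n x') :
    closure (connectedComponentIn (RGraph.core X' \ kernelVertices X') (x' 1)) =
      trace n x' := by
  have htwo := hc.two_le
  have hη := hc.eta_nonneg
  obtain ⟨s1, s2⟩ := hc.step_pos
  have h1 : x' 1 ∉ kernelVertices X' := hc.node_notMem one_pos (by omega)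
  apply Subset.antisymm
  · exact closure_minimal (hc.approx.scale'.component_subset hc.trace_subset_core isClosed_trace
      (fun q hq hqV => hc.twoSidedAt_trace hq hqV)
      (seg_subset_trace (i := 0) (by omega) (right_mem_seg _ _)) h1) isClosed_trace
  · intro q hq
    by_cases hqV : q ∈ kernelVertices X'
    · obtain ⟨i, hi, hqi⟩ := mem_trace.1 hq
      have hd := (abs_le.1 (hc.dist_succ hi)).2
      have hne : x' i ≠ x' (i + 1) := dist_pos.1 (by linarith)
      rcases hc.vertex_mem_seg hi hqV hqi with ⟨rfl, rfl⟩ | ⟨h, rfl⟩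
      · refine mem_closure_of_seg hc.approx.scale'.geo hne fun w hw hne' => ?_
        refine hc.mem_component (seg_subset_trace hi hw) fun hwV => ?_
        rcases hc.vertex_mem_seg hi hwV hw with h | h
        · exact hne' h.2
        · omega
      · rw [← h] at hqV ⊢
        refine mem_closure_of_seg hc.approx.scale'.geo hne.symm fun w hw hne' => ?_
        rw [seg_comm] at hw
        refine hc.mem_component (seg_subset_trace hi hw) fun hwV => ?_
        rcases hc.vertex_mem_seg hi hwV hw with h' | h'
        · omega
        · rw [← h] at h'
          exact hne' h'.2
    · exact subset_closure (hc.mem_component hq hqV)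

theorem trace_mem_kernelEdges (hc : EdgeChain M h η e f L τ n x') :
    trace n x' ∈ kernelEdges X' := by
  have htwo := hc.two_le
  rw [← hc.closure_component]
  exact ⟨_, ⟨x' 1, ⟨hc.core 1 (by omega), hc.node_notMem one_pos (by omega)⟩, rfl⟩, rfl⟩

omit [CompactSpace X] [CompactSpace X'] in
-- A point related to `f (i * τ + s)` has almost the same distances to both nodes as `w`, which lies
-- between them. The four-point condition brings the two within `3 * η`.
theorem thick_of_seg (hc : EdgeChain M h η e f L τ n x') {i : ℕ} (hi : i < n) {s : ℝ}
    (hs : s ∈ Icc 0 τ) {w : X'} (hw : w ∈ seg (x' i) (x' (i + 1)))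
    (hd : |s - dist (x' i) w| ≤ η) : Thick M (3 * η) (f (i * τ + s)) w := by
  have h0 := hc.approx.scale.pos
  have hη := hc.eta_nonneg
  have hsm := hc.approx.small
  obtain ⟨s1, s2⟩ := hc.step_pos
  have s3 := hc.step_le
  have hD := abs_le.1 (hc.dist_succ hi)
  have hd' := abs_le.1 hd
  obtain ⟨y, hy⟩ := hc.approx.approx.left (f (i * τ + s))
  refine ⟨_, y, hy, by simpa using hη, ?_⟩
  have near2 := hc.near (i + 1) hi
  rw [show ((i + 1 : ℕ) : ℝ) * τ = i * τ + τ by push_cast; ring] at near2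
  have d1 := hc.approx.approx.dist_le (hc.near i hi.le) hy
  have d2 := hc.approx.approx.dist_le hy near2
  rw [hc.param.geod.dist_eq (by linarith [hs.1]) (by linarith [hs.2])] at d1
  rw [hc.param.geod.dist_eq (by linarith [hs.2]) (by linarith [hs.1])] at d2
  have hw' : dist (x' i) w + dist w (x' (i + 1)) = dist (x' i) (x' (i + 1)) := hw
  have n1 := dist_nonneg (x := w) (y := x' (i + 1))
  have key := hc.approx.scale'.hyp (x' i) w y (x' i) (x' (i + 1)) (by linarith)
    (by linarith [hs.1, hs.2]) (by simp; linarith) (by linarith)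
  have c1 := dist_comm w (x' i)
  have c2 := dist_comm y (x' i)
  rcases key with key | key <;> linarith [hs.1, hs.2]

omit [CompactSpace X] [CompactSpace X'] in
theorem exists_mem_trace (hc : EdgeChain M h η e f L τ n x') {x : X} (hx : x ∈ e) :
    ∃ w ∈ trace n x', Thick M (3 * η) x w := by
  obtain ⟨s1, s2⟩ := hc.step_pos
  have htwo := hc.two_le
  rw [← hc.param.image] at hx
  obtain ⟨t, ht, rfl⟩ := hx
  have hidx : ∃ i < n, i * τ ≤ t ∧ t ≤ i * τ + τ := by
    rcases eq_or_lt_of_le ht.2 with h | h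
    · refine ⟨n - 1, by omega, ?_, ?_⟩
      · rw [Nat.cast_sub (by omega), sub_mul, hc.mul_eq, h]; simp [s2.le]
      · rw [Nat.cast_sub (by omega), sub_mul, hc.mul_eq, h]; simp
    · have f1 := Nat.floor_le (div_nonneg ht.1 s2.le)
      have f2 := Nat.lt_floor_add_one (t / τ)
      rw [le_div_iff₀ s2] at f1
      rw [div_lt_iff₀ s2] at f2
      refine ⟨⌊t / τ⌋₊, ?_, f1, by linarith⟩
      rw [Nat.floor_lt (div_nonneg ht.1 s2.le), div_lt_iff₀ s2, hc.mul_eq]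
      exact h
  obtain ⟨i, hi, h1, h2⟩ := hidx
  have hD := abs_le.1 (hc.dist_succ hi)
  have hη := hc.eta_nonneg
  have hn := dist_nonneg (x := x' i) (y := x' (i + 1))
  obtain ⟨w, w1, w2⟩ := exists_btw hc.approx.scale'.geo (x' i) (x' (i + 1))
    (s := min (t - i * τ) (dist (x' i) (x' (i + 1)))) (le_min (by linarith) hn)
    (min_le_right _ _)
  refine ⟨w, mem_trace.2 ⟨i, hi, w2⟩, ?_⟩
  have := hc.thick_of_seg hi (s := t - i * τ) ⟨by linarith, by linarith⟩ w2 (by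
    rw [w1, abs_le]
    constructor
    · linarith [min_le_left (t - i * τ) (dist (x' i) (x' (i + 1)))]
    · rcases min_choice (t - i * τ) (dist (x' i) (x' (i + 1))) with h | h <;> rw [h] <;> linarith)
  rwa [add_sub_cancel] at this

omit [CompactSpace X] [CompactSpace X'] in
theorem exists_mem_edge (hc : EdgeChain M h η e f L τ n x') {w : X'} (hw : w ∈ trace n x') :
    ∃ x ∈ e, Thick M (3 * η) x w := by
  obtain ⟨s1, s2⟩ := hc.step_pos
  obtain ⟨i, hi, hwi⟩ := mem_trace.1 hw
  have hD := abs_le.1 (hc.dist_succ hi)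
  have hη := hc.eta_nonneg
  have hn := dist_nonneg (x := x' i) (y := w)
  have hle := Btw.dist_le_left hwi
  obtain ⟨m1, m2⟩ := hc.mul_mem hi
  set s := min (dist (x' i) w) τ with hs
  have s3 : 0 ≤ s := le_min hn s2.le
  have s4 : s ≤ τ := min_le_right _ _
  refine ⟨f (i * τ + s), ?_, hc.thick_of_seg hi ⟨s3, s4⟩ hwi ?_⟩
  · rw [← hc.param.image]
    exact ⟨_, ⟨by linarith, by linarith⟩, rfl⟩
  · rw [abs_le]
    rcases min_choice (dist (x' i) w) τ with h | h
    · rw [hs, h]; constructor <;> linarith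
    · have : τ ≤ dist (x' i) w := by
        rw [← h]; exact min_le_left _ _
      rw [hs, h]; constructor <;> linarith

omit [CompactSpace X'] in
theorem vertex_mem_iff (hc : EdgeChain M h η e f L τ n x') {v : X} {v' : X'}
    (hv : v ∈ kernelVertices X) (hv' : v' ∈ kernelVertices X') (hM : M v v') :
    v ∈ e ↔ v' ∈ trace n x' := by
  have htwo := hc.two_le
  have hn1 : n - 1 + 1 = n := by omega
  obtain ⟨e0, e1⟩ := hc.param.mem_or_mem_of_nonempty ⟨v, hv⟩
  have hE : x' 0 ∈ kernelVertices X' ∧ x' n ∈ kernelVertices X' := by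
    rcases hc.ends with h | h
    · exact h
    · exact absurd h.1 (nonempty_iff_ne_empty.1 ⟨v, hv⟩)
  have near0 : M (f 0) (x' 0) := by simpa using hc.near 0 (Nat.zero_le _)
  have near1 : M (f L) (x' n) := by
    rw [← hc.mul_eq]
    exact hc.near n le_rfl
  constructor
  · intro hve
    rw [← hc.param.image] at hve
    obtain ⟨t, ht, rfl⟩ := hve
    rcases eq_or_lt_of_le ht.1 with h | h
    · subst h
      rw [hc.approx.vertex_unique hv' hE.1 hM near0]
      exact seg_subset_trace (i := 0) (by omega) (left_mem_seg _ _)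
    rcases eq_or_lt_of_le ht.2 with h' | h'
    · subst h'
      rw [hc.approx.vertex_unique hv' hE.2 hM near1]
      refine seg_subset_trace (i := n - 1) (by omega) ?_
      rw [hn1]
      exact right_mem_seg _ _
    · exact absurd hv (hc.param.avoid t ⟨h, h'⟩)
  · intro hvt
    obtain ⟨i, hi, hvi⟩ := mem_trace.1 hvt
    rw [← hc.param.image]
    rcases hc.vertex_mem_seg hi hv' hvi with ⟨-, rfl⟩ | ⟨-, rfl⟩
    · exact ⟨0, ⟨le_rfl, hc.param.pos.le⟩, hc.approx.symm.vertex_unique e0 hv near0 hM⟩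
    · exact ⟨L, ⟨hc.param.pos.le, le_rfl⟩, hc.approx.symm.vertex_unique e1 hv near1 hM⟩

omit [CompactSpace X] [CompactSpace X'] in
theorem length_trace_le [MeasurableSpace X'] [BorelSpace X']
    (hc : EdgeChain M h η e f L τ n x') :
    length (trace n x') ≤ ENNReal.ofReal (L + n * η) := by
  have h0 := hc.approx.scale.pos
  have hη := hc.eta_nonneg
  obtain ⟨s1, s2⟩ := hc.step_pos
  have s3 := hc.step_le
  calc length (trace n x') ≤ ∑ i ∈ Finset.range n, length (seg (x' i) (x' (i + 1))) :=
        measure_biUnion_finset_le _ _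
    _ ≤ ∑ _i ∈ Finset.range n, ENNReal.ofReal (τ + η) := by
        refine Finset.sum_le_sum fun i hi => ?_
        have hd := abs_le.1 (hc.dist_succ (Finset.mem_range.1 hi))
        exact (hc.approx.scale'.length_seg_le (by linarith)).trans
          (ENNReal.ofReal_le_ofReal (by linarith))
    _ = ENNReal.ofReal (L + n * η) := by
        rw [Finset.sum_const, Finset.card_range, nsmul_eq_mul, ← hc.mul_eq, ← mul_add,
          ENNReal.ofReal_mul (by positivity), ENNReal.ofReal_natCast]

end EdgeChain

end EdgeTransfer

/-! ### Isomorphism of the kernels and the overlay. -/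

section Overlay

variable {X X' : Type*} [MetricSpace X] [MetricSpace X'] {h η κ : ℝ} {M : X → X' → Prop}

/-- Edges are determined by their points away from the vertices. -/
theorem TreeScale.edge_eq_of_dist_le [CompactSpace X] (hT : TreeScale X h) {e e' : Set X}
    (he : e ∈ kernelEdges X) (he' : e' ∈ kernelEdges X) {b y : X} {d : ℝ} (hb : b ∈ e)
    (hy : y ∈ e') (hd : dist b y ≤ d) (hV : ∀ v ∈ kernelVertices X, d < dist b v) : e = e' := by
  have hseg : ∀ q ∈ seg b y, q ∉ kernelVertices X := fun q hq hqV =>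
    absurd (hV q hqV) (not_lt.2 ((Btw.dist_le_left hq).trans hd))
  obtain ⟨b1, b2⟩ := hT.edge_eq_closure he hb (hseg b (left_mem_seg _ _))
  obtain ⟨y1, y2⟩ := hT.edge_eq_closure he' hy (hseg y (right_mem_seg _ _))
  rw [b2, y2, hT.component_eq b1 y1 hseg]

theorem EdgeParam.exists_le_dist [CompactSpace X] {e : Set X} {f : ℝ → X} {L : ℝ}
    (hf : EdgeParam h e f L) (hT : TreeScale X h) (hL : h ≤ L) :
    ∃ b ∈ e, ∀ v ∈ kernelVertices X, h / 2 ≤ dist b v := by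
  have h0 := hT.pos
  refine ⟨f (L / 2), ?_, fun v hv => ?_⟩
  · rw [← hf.image]
    exact ⟨_, ⟨by linarith, by linarith⟩, rfl⟩
  · refine le_trans ?_ (hf.le_dist hT hv)
    exact le_min (by linarith) (le_min (by linarith) le_rfl)

theorem EdgeParam.le_of_le_length [MeasurableSpace X] [BorelSpace X] {e : Set X} {f : ℝ → X}
    {L : ℝ} (hf : EdgeParam h e f L) (h0 : 0 < h) (hL : ENNReal.ofReal h ≤ length e) : h ≤ L := by
  rw [hf.length_eq h0] at hL
  exact (ENNReal.ofReal_le_ofReal_iff hf.pos.le).1 hL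

/-- Two edges correspond to each other up to a thickening, with the same vertices. -/
structure EdgeRel (M : X → X' → Prop) (κ : ℝ) (e : Set X) (e' : Set X') : Prop where
  left : ∀ x ∈ e, ∃ x' ∈ e', Thick M κ x x'
  right : ∀ x' ∈ e', ∃ x ∈ e, Thick M κ x x'
  vert : ∀ v ∈ kernelVertices X, ∀ v' ∈ kernelVertices X', M v v' → (v ∈ e ↔ v' ∈ e')

theorem EdgeRel.symm {e : Set X} {e' : Set X'} (he : EdgeRel M κ e e') :
    EdgeRel (fun a b => M b a) κ e' e := by
  refine ⟨fun x' hx' => ?_, fun x hx => ?_, fun v' hv' v hv hM => (he.vert v hv v' hv' hM).symm⟩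
  · obtain ⟨x, h1, h2⟩ := he.right x' hx'
    exact ⟨x, h1, h2.swap⟩
  · obtain ⟨x', h1, h2⟩ := he.left x hx
    exact ⟨x', h1, h2.swap⟩

namespace CoreApprox

theorem eta_nonneg (hM : CoreApprox M h η) {x : X} : 0 ≤ η := by
  obtain ⟨x', hx'⟩ := hM.approx.left x
  exact hM.approx.nonneg hx'

variable [CompactSpace X] [CompactSpace X'] [MeasurableSpace X] [BorelSpace X]
  [MeasurableSpace X'] [BorelSpace X']

theorem exists_edge (hM : CoreApprox M h η) {e : Set X} (he : e ∈ kernelEdges X)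
    (hL : ENNReal.ofReal h ≤ length e) : ∃ e' ∈ kernelEdges X', EdgeRel M (3 * η) e e' ∧
      (length e').toReal ≤ (length e).toReal + 5 * (length e).toReal / h * η := by
  have h0 := hM.scale.pos
  obtain ⟨f, L, hf⟩ := hM.scale.exists_edgeParam he
  have hη := hM.eta_nonneg (x := f 0)
  obtain ⟨τ, n, x', hc, hn⟩ := exists_edgeChain hM hf (hf.le_of_le_length h0 hL)
  refine ⟨_, hc.trace_mem_kernelEdges, ⟨fun x hx => hc.exists_mem_trace hx,
    fun x' hx' => hc.exists_mem_edge hx', fun v hv v' hv' hvv => hc.vertex_mem_iff hv hv' hvv⟩, ?_⟩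
  have hpos := hf.pos
  rw [hf.length_eq h0, ENNReal.toReal_ofReal hpos.le]
  refine (ENNReal.toReal_le_of_le_ofReal (by positivity) hc.length_trace_le).trans ?_
  have : (n : ℝ) ≤ 5 * L / h := (le_div_iff₀ h0).2 hn
  gcongr

omit [CompactSpace X] [MeasurableSpace X] [BorelSpace X] in
-- A point of `e₁` at distance at least `h / 2` from all vertices is within `13 * η` of a point of
-- `e₂`, where `13 = 1 + 4 * 3`. No vertex fits in between, so the edges coincide.
theorem edge_unique (hM : CoreApprox M h η)
    (hE' : ∀ e ∈ kernelEdges X', ENNReal.ofReal h ≤ length e) {e : Set X} {e₁ e₂ : Set X'}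
    (h1 : e₁ ∈ kernelEdges X') (h2 : e₂ ∈ kernelEdges X') (r1 : EdgeRel M (3 * η) e e₁)
    (r2 : EdgeRel M (3 * η) e e₂) : e₁ = e₂ := by
  have h0 := hM.scale.pos
  have hs := hM.small
  obtain ⟨f, L, hf⟩ := hM.scale'.exists_edgeParam h1
  obtain ⟨b, hb, hbV⟩ := hf.exists_le_dist hM.scale' (hf.le_of_le_length h0 (hE' _ h1))
  obtain ⟨x, hx, hxb⟩ := r1.right b hb
  obtain ⟨y, hy, hxy⟩ := r2.left x hx
  have hη := hM.eta_nonneg (x := x)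
  have hd := (hM.approx.thick (κ := 3 * η) (by linarith)).dist_le hxb hxy
  rw [dist_self] at hd
  exact hM.scale'.edge_eq_of_dist_le h1 h2 hb hy hd fun v hv => by linarith [hbV v hv]

omit [CompactSpace X] [CompactSpace X'] [MeasurableSpace X] [BorelSpace X]
  [MeasurableSpace X'] [BorelSpace X'] in
theorem exists_vertexEquiv (hM : CoreApprox M h η) :
    ∃ Ψ : kernelVertices X ≃ kernelVertices X', ∀ v : kernelVertices X, M v (Ψ v) := by
  choose φ hφ hφM using hM.vert
  choose ψ hψ hψM using hM.vert'
  exact ⟨⟨fun v => ⟨φ v v.2, hφ v v.2⟩, fun v' => ⟨ψ v' v'.2, hψ v' v'.2⟩,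
    fun v => Subtype.ext (hM.symm.vertex_unique (hψ _ (hφ v v.2)) v.2 (hψM _ (hφ v v.2))
      (hφM v v.2)),
    fun v' => Subtype.ext (hM.vertex_unique (hφ _ (hψ v' v'.2)) v'.2 (hφM _ (hψ v' v'.2))
      (hψM v' v'.2))⟩, fun v => hφM v v.2⟩

/-- The edge maps in both directions are mutually inverse by uniqueness, and each contributes one
side of the length estimate. -/
theorem exists_edgeEquiv (hM : CoreApprox M h η)
    (hE : ∀ e ∈ kernelEdges X, ENNReal.ofReal h ≤ length e)
    (hE' : ∀ e ∈ kernelEdges X', ENNReal.ofReal h ≤ length e) {l : ℝ}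
    (hl : ∀ e ∈ kernelEdges X, (length e).toReal ≤ l)
    (hl' : ∀ e ∈ kernelEdges X', (length e).toReal ≤ l) :
    ∃ Φ : kernelEdges X ≃ kernelEdges X', ∀ e : kernelEdges X, EdgeRel M (3 * η) e (Φ e) ∧
      |(length (e : Set X)).toReal - (length (Φ e : Set X')).toReal| ≤ 5 * l / h * η := by
  have h0 := hM.scale.pos
  choose! φ hφ hφr hφl using fun e he => hM.exists_edge (e := e) he (hE e he)
  choose! ψ hψ hψr hψl using fun e he => hM.symm.exists_edge (e := e) he (hE' e he)
  have hψφ : ∀ e ∈ kernelEdges X, ψ (φ e) = e := fun e he =>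
    hM.symm.edge_unique hE (hψ _ (hφ e he)) he (hψr _ (hφ e he)) (hφr e he).symm
  have hφψ : ∀ e ∈ kernelEdges X', φ (ψ e) = e := fun e he =>
    hM.edge_unique hE' (hφ _ (hψ e he)) he (hφr _ (hψ e he)) (hψr e he).symm
  refine ⟨⟨fun e => ⟨φ e, hφ e e.2⟩, fun e' => ⟨ψ e', hψ e' e'.2⟩,
    fun e => Subtype.ext (hψφ e e.2), fun e' => Subtype.ext (hφψ e' e'.2)⟩,
    fun e => ⟨hφr e e.2, ?_⟩⟩
  obtain ⟨f, -, -⟩ := hM.scale.exists_edgeParam e.2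
  have hη := hM.eta_nonneg (x := f 0)
  have k1 := hφl e e.2
  have k2 := hψl _ (hφ e e.2)
  rw [hψφ e e.2] at k2
  have m1 : 5 * (length (e : Set X)).toReal / h * η ≤ 5 * l / h * η := by
    gcongr
    exact hl e e.2
  have m2 : 5 * (length (φ e)).toReal / h * η ≤ 5 * l / h * η := by
    gcongr
    exact hl' _ (hφ e e.2)
  rw [abs_le]
  constructor <;> dsimp only [Equiv.coe_fn_mk] <;> linarith

end CoreApprox

/-- Expresses ends by incidence alone, which is what the relation between edges preserves. -/
theorem isKernelLink_iff {e : kernelEdges X} {x y : kernelVertices X} :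
    IsKernelLink e x y ↔ ∀ w : kernelVertices X, (w : X) ∈ (e : Set X) ↔ w = x ∨ w = y := by
  rw [IsKernelLink, Set.ext_iff]
  constructor
  · intro hw w
    have := hw w
    simpa [w.2, Subtype.ext_iff] using this
  · intro hw w
    constructor
    · rintro ⟨h1, h2⟩
      have := (hw ⟨w, h2⟩).1 h1
      simpa [Subtype.ext_iff] using this
    · rintro (rfl | rfl)
      · exact ⟨(hw x).2 (Or.inl rfl), x.2⟩
      · exact ⟨(hw y).2 (Or.inr rfl), y.2⟩

/-- The isomorphism of kernels made of two bijections which preserve incidence. -/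
def kernelIsoOfEquiv (Ψ : kernelVertices X ≃ kernelVertices X')
    (Φ : kernelEdges X ≃ kernelEdges X')
    (hΦ : ∀ (e : kernelEdges X) (v : kernelVertices X), (v : X) ∈ (e : Set X) ↔ (Ψ v : X') ∈ (Φ e : Set X')) : KernelIso X X' where
  onVertices := Ψ
  onEdges := Φ
  isLink_iff e x y := by
    rw [isKernelLink_iff, isKernelLink_iff, Ψ.surjective.forall]
    simp only [← hΦ, Ψ.injective.eq_iff]

/-- Taking the closure does not increase the distortion, and it makes the later thickening closed,
hence measurable. -/
theorem approx_closure {C : Set (X × X')} {δ : ℝ} (hδ : 0 ≤ δ) (hl : ∀ x, ∃ x', (x, x') ∈ C)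
    (hr : ∀ x', ∃ x, (x, x') ∈ C) (hC : dis C ≤ ENNReal.ofReal δ) :
    Approx (fun x x' => (x, x') ∈ closure C) δ := by
  refine ⟨fun x => ?_, fun x' => ?_, fun {x y x' y'} hx hy => ?_⟩
  · obtain ⟨x', hx⟩ := hl x
    exact ⟨x', subset_closure hx⟩
  · obtain ⟨x, hx⟩ := hr x'
    exact ⟨x, subset_closure hx⟩
  · have hcl : IsClosed {p : (X × X') × (X × X') |
        |dist p.1.1 p.2.1 - dist p.1.2 p.2.2| ≤ δ} :=
      isClosed_le (by fun_prop) continuous_const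
    have hsub : C ×ˢ C ⊆ {p : (X × X') × (X × X') |
        |dist p.1.1 p.2.1 - dist p.1.2 p.2.2| ≤ δ} := by
      rintro ⟨p, q⟩ ⟨hp, hq⟩
      have h2 : ENNReal.ofReal |dist p.1 q.1 - dist p.2 q.2| ≤ dis C :=
        (le_iSup₂ (f := fun q (_ : q ∈ C) => ENNReal.ofReal |dist p.1 q.1 - dist p.2 q.2|)
          q hq).trans (le_iSup₂ (f := fun p (_ : p ∈ C) => ⨆ q ∈ C,
            ENNReal.ofReal |dist p.1 q.1 - dist p.2 q.2|) p hp)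
      exact (ENNReal.ofReal_le_ofReal_iff hδ).1 (h2.trans hC)
    have h1 := closure_minimal hsub hcl
    rw [closure_prod_eq] at h1
    exact h1 (mk_mem_prod hx hy)

theorem isClosed_thick [CompactSpace X] [CompactSpace X'] {K : Set (X × X')} (hK : IsClosed K) :
    IsClosed {p : X × X' | Thick (fun x x' => (x, x') ∈ K) κ p.1 p.2} := by
  have h1 : IsClosed {p : (X × X') × (X × X') |
      p.2 ∈ K ∧ dist p.1.1 p.2.1 ≤ κ ∧ dist p.1.2 p.2.2 ≤ κ} :=
    (hK.preimage continuous_snd).inter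
      ((isClosed_le (continuous_fst.fst.dist continuous_snd.fst) continuous_const).inter
        (isClosed_le (continuous_fst.snd.dist continuous_snd.snd) continuous_const))
  convert (h1.isCompact.image continuous_fst).isClosed using 1
  ext ⟨x, x'⟩
  constructor
  · rintro ⟨y, y', h2, h3, h4⟩
    exact ⟨⟨(x, x'), (y, y')⟩, ⟨h2, h3, h4⟩, rfl⟩
  · rintro ⟨⟨p, q⟩, ⟨h2, h3, h4⟩, rfl⟩
    exact ⟨q.1, q.2, h2, h3, h4⟩

theorem Approx.dis_le {N : X → X' → Prop} {δ : ℝ} (hN : Approx N δ) :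
    dis {p : X × X' | N p.1 p.2} ≤ ENNReal.ofReal δ :=
  iSup₂_le fun _ hp => iSup₂_le fun _ hq => ENNReal.ofReal_le_ofReal (hN.close hp hq)

omit [MetricSpace X] [MetricSpace X'] in
theorem inCorrespondenceVia [MeasurableSpace X] [MeasurableSpace X'] {C : Set (X × X')}
    (hC : MeasurableSet C) {A : Set X} {A' : Set X'} (hl : ∀ x ∈ A, ∃ x' ∈ A', (x, x') ∈ C)
    (hr : ∀ x' ∈ A', ∃ x ∈ A, (x, x') ∈ C) : InCorrespondenceVia C A A' := by
  refine ⟨?_, fun x => ?_, fun x' => ?_⟩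
  · exact ((measurable_subtype_coe.comp measurable_fst).prodMk
      (measurable_subtype_coe.comp measurable_snd)) hC
  · obtain ⟨x', h1, h2⟩ := hl x x.2
    exact ⟨⟨x', h1⟩, h2⟩
  · obtain ⟨x, h1, h2⟩ := hr x' x'.2
    exact ⟨⟨x, h1⟩, h2⟩

theorem TreeScale.isEmbeddedCycle_iff_eq_core [CompactSpace X] (hT : TreeScale X h)
    (hV : kernelVertices X = ∅) (hc : (core X).Nonempty) (b : Set X) :
    IsEmbeddedCycle b ↔ b = core X := by
  have key : ∀ c : Set X, IsEmbeddedCycle c → core X = c := fun c hc =>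
    hT.core_eq_cycle hc fun q _ => by simp [hV]
  refine ⟨fun hb => (key b hb).symm, ?_⟩
  rintro rfl
  obtain ⟨_, _, _, _, ⟨c, hc, _⟩, _⟩ := hc
  rwa [key c hc]

theorem TreeScale.kernelEdges_eq_core [CompactSpace X] (hT : TreeScale X h)
    (hV : kernelVertices X = ∅) (hc : (core X).Nonempty) : kernelEdges X = {core X} := by
  rw [kernelEdges, components, hV, sdiff_empty]
  have : connectedComponentIn (core X) '' core X = {core X} := by
    refine (image_congr fun x hx => ?_).trans (hc.image_const (core X))
    exact hT.isPreconnected_core.connectedComponentIn hx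
  rw [this, image_singleton, hT.isClosed_core.closure_eq]

theorem CoreApprox.core_eq_empty (hM : CoreApprox M h η) (hc : RGraph.core X = ∅) :
    RGraph.core X' = ∅ := by
  rw [eq_empty_iff_forall_notMem] at hc ⊢
  intro v' hv'
  obtain ⟨v, hv, -⟩ := hM.core' v' hv'
  exact hc v hv

/-! ### Choice of constants in the class. -/

section ClassA

variable [MeasurableSpace X] [BorelSpace X] [MeasurableSpace X'] [BorelSpace X'] {r : ℝ}

theorem InClassA.length_le (hX : InClassA r X) {e : Set X} (he : e ∈ kernelEdges X) :
    length e ≤ ENNReal.ofReal (1 / r) :=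
  (ENNReal.le_tsum (f := fun e : kernelEdges X => length (e : Set X)) ⟨e, he⟩).trans hX.2.2.1

theorem InClassA.finite_kernelEdges (h0 : 0 < r) (hX : InClassA r X) :
    (kernelEdges X).Finite := by
  have h1 := ENNReal.finite_const_le_of_tsum_ne_top
    (a := fun e : kernelEdges X => length (e : Set X)) (ε := ENNReal.ofReal r)
    (ne_top_of_le_ne_top ENNReal.ofReal_ne_top hX.2.2.1) (by simpa using h0)
  rw [show {e : kernelEdges X | ENNReal.ofReal r ≤ length (e : Set X)} = univ from
    eq_univ_of_forall fun e => hX.2.1 e e.2] at h1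
  exact finite_coe_iff.1 (finite_univ_iff.1 h1)

/-- The scale is `h = r / 100`, so `161 * δ` is an admissible error when `1610000 * δ ≤ r`. Edges
are related after thickening by `3 * (161 * δ)` on top of `40 * δ`, which gives `523 * δ`; the
distortion is then `2093 * δ`, less than `3000 * δ`. -/
theorem exists_overlay (h0 : 0 < r) {ε δ : ℝ} (hδ : 0 < δ) (hδr : 1610000 * δ ≤ r)
    (hδε : 3000 * δ ≤ ε) (hδl : 80500 * δ ≤ ε * r ^ 2) (hX : InClassA r X) (hX' : InClassA r X')
    {C : Set (X × X')} (hC : IsCorrespondence C) (hdis : dis C ≤ ENNReal.ofReal δ) :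
    ∃ C' : Set (X × X'), C ⊆ C' ∧ IsOverlay ε C' := by
  have := hX.1.1
  have := hX'.1.1
  have hT : TreeScale X (r / 100) := hX.1.treeScale (by linarith) (by linarith) hX.2.1
  have hT' : TreeScale X' (r / 100) := hX'.1.treeScale (by linarith) (by linarith) hX'.2.1
  have hE : ∀ e ∈ kernelEdges X, ENNReal.ofReal (r / 100) ≤ length e := fun e he =>
    (ENNReal.ofReal_le_ofReal (by linarith)).trans (hX.2.1 e he)
  have hE' : ∀ e ∈ kernelEdges X', ENNReal.ofReal (r / 100) ≤ length e := fun e he =>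
    (ENNReal.ofReal_le_ofReal (by linarith)).trans (hX'.2.1 e he)
  have hl : ∀ e ∈ kernelEdges X, (length e).toReal ≤ 1 / r := fun e he =>
    ENNReal.toReal_le_of_le_ofReal (by positivity) (hX.length_le he)
  have hl' : ∀ e ∈ kernelEdges X', (length e).toReal ≤ 1 / r := fun e he =>
    ENNReal.toReal_le_of_le_ofReal (by positivity) (hX'.length_le he)
  have hsep : ∀ u ∈ kernelVertices X, ∀ v ∈ kernelVertices X, u ≠ v → 8 * (r / 100) < dist u v :=
    fun u hu v hv => hT.lt_dist_of_mem_kernelVertices (by linarith) hX.2.1 hu hv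
  have hsep' : ∀ u ∈ kernelVertices X', ∀ v ∈ kernelVertices X', u ≠ v →
      8 * (r / 100) < dist u v :=
    fun u hu v hv => hT'.lt_dist_of_mem_kernelVertices (by linarith) hX'.2.1 hu hv
  set N : X → X' → Prop := fun x x' => (x, x') ∈ closure C
  have hN : Approx N δ := approx_closure hδ.le hC.2.1 hC.2.2 hdis
  have hM := hN.coreApprox hT hT' hδ.le (by linarith) hsep hsep'
  have hthick : ∀ {x x'}, Thick (Thick N (40 * δ)) (3 * (161 * δ)) x x' →
      Thick N (523 * δ) x x' := fun hx => hx.thick.mono (by linarith)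
  -- Here `80500 = 5 * 100 * 161`, and `1 / r` bounds the length of each edge.
  have hlen : 5 * (1 / r) / (r / 100) * (161 * δ) ≤ ε := by
    have : 5 * (1 / r) / (r / 100) * (161 * δ) = 80500 * δ / r ^ 2 := by
      field_simp
      ring
    rw [this, div_le_iff₀ (by positivity)]
    exact hδl
  set C' : Set (X × X') := {p | Thick N (523 * δ) p.1 p.2} with hC'
  have hN' := hN.thick (κ := 523 * δ) (by linarith)
  have hmeas : MeasurableSet C' := by
    -- Second countability makes closed subsets of the product measurable for the product σ-algebra.
    have : SecondCountableTopology X := EMetric.secondCountable_of_sigmaCompact X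
    exact (isClosed_thick isClosed_closure).measurableSet
  have hdis' : dis C' < ENNReal.ofReal ε := hN'.dis_le.trans_lt
    ((ENNReal.ofReal_lt_ofReal_iff (by linarith)).2 (by linarith))
  obtain ⟨Φ, hΦ⟩ := hM.exists_edgeEquiv hE hE' hl hl'
  have hvia : ∀ e : kernelEdges X, InCorrespondenceVia C' (e : Set X) (Φ e : Set X') := by
    intro e
    refine inCorrespondenceVia hmeas (fun x hx => ?_) (fun x' hx' => ?_)
    · obtain ⟨x', h1, h2⟩ := (hΦ e).1.left x hx
      exact ⟨x', h1, hthick h2⟩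
    · obtain ⟨x, h1, h2⟩ := (hΦ e).1.right x' hx'
      exact ⟨x, h1, hthick h2⟩
  refine ⟨C', fun p hp => thick_of_rel (by linarith) (subset_closure hp),
    ⟨hmeas, hN'.left, hN'.right⟩, ?_⟩
  rcases (kernelVertices X).eq_empty_or_nonempty with hV | hV
  · have hV' := hM.vertices_empty hV
    rcases (core X).eq_empty_or_nonempty with hc | hc
    · have hc' := hM.core_eq_empty hc
      exact Or.inr (Or.inr ⟨by simp [surplus, hV, hc], by simp [surplus, hV', hc'], hdis'.le⟩)
    · have hc' : (core X').Nonempty := by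
        obtain ⟨x, hx⟩ := hc
        obtain ⟨x', hx', -⟩ := hM.core x hx
        exact ⟨x', hx'⟩
      have hmem : core X ∈ kernelEdges X := by
        rw [hT.kernelEdges_eq_core hV hc]
        exact mem_singleton _
      have heq : (Φ ⟨core X, hmem⟩ : Set X') = core X' :=
        (hT'.kernelEdges_eq_core hV' hc').subset (Φ ⟨core X, hmem⟩).2
      refine Or.inr (Or.inl ⟨by simp [surplus, hV, hc.ne_empty],
        by simp [surplus, hV', hc'.ne_empty], hdis'.le, core X, core X',
        hT.isEmbeddedCycle_iff_eq_core hV hc, hT'.isEmbeddedCycle_iff_eq_core hV' hc', ?_, ?_⟩)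
      · rw [← heq]
        exact hvia ⟨core X, hmem⟩
      · rw [← heq]
        exact (hΦ ⟨core X, hmem⟩).2.trans hlen
  · obtain ⟨Ψ, hΨ⟩ := hM.exists_vertexEquiv
    have hV' : (kernelVertices X').Nonempty := ⟨Ψ ⟨_, hV.some_mem⟩, (Ψ _).2⟩
    refine Or.inl ⟨hT.two_le_surplus hsep (hX.finite_kernelEdges h0) hV,
      hT'.two_le_surplus hsep' (hX'.finite_kernelEdges h0) hV', hdis',
      kernelIsoOfEquiv Ψ Φ fun e v => (hΦ e).1.vert v v.2 _ (Ψ v).2 (hΨ v),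
      fun v => (hΨ v).mono (by linarith : 40 * δ ≤ 523 * δ), fun e => ⟨hvia e, (hΦ e).2.trans hlen⟩⟩

end ClassA

end Overlay

end RGraph

end

theorem proposition6p4 (r : ℝ) (hr : r ∈ Set.Ioo (0 : ℝ) 1) (ε : ℝ) (hε : 0 < ε) :
    ∃ δ : ℝ, 0 < δ ∧
      ∀ (X : Type u) (X' : Type v)
        [MetricSpace X] [MeasurableSpace X] [BorelSpace X]
        [MetricSpace X'] [MeasurableSpace X'] [BorelSpace X'],
        RGraph.InClassA r X → RGraph.InClassA r X' →
        ∀ C : Set (X × X'), RGraph.IsCorrespondence C → RGraph.dis C ≤ ENNReal.ofReal δ →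
          ∃ C' : Set (X × X'), C ⊆ C' ∧ RGraph.IsOverlay ε C' := by
  have h0 := hr.1
  refine ⟨min (r / 1610000) (min (ε / 3000) (ε * r ^ 2 / 80500)), by positivity,
    fun X X' _ _ _ _ _ _ hX hX' C hC hdis => ?_⟩
  set δ := min (r / 1610000) (min (ε / 3000) (ε * r ^ 2 / 80500)) with hδ
  have h1 : δ ≤ r / 1610000 := min_le_left _ _
  have h2 : δ ≤ ε / 3000 := (min_le_right _ _).trans (min_le_left _ _)
  have h3 : δ ≤ ε * r ^ 2 / 80500 := (min_le_right _ _).trans (min_le_right _ _)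
  exact RGraph.exists_overlay h0 (by positivity) (by linarith) (by linarith) (by linarith)
    hX hX' hC hdis
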